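/- All manifolds are smooth, connected, without boundary and finite-dimensional (and second countable); $d_{\mathcal M}$, $d_{\mathcal N}$, … denote the geodesic distances, integrals over $\mathcal M$ are taken with respect to the Riemannian volume, and $\mathrm{inj}(\mathcal N)$ is the injectivity radius of $\mathcal N$. For an $m$-dimensional compact Riemannian manifold $\mathcal M$, $s \in (0,1)$, $p \in (1,\infty)$ and a measurable map $u$ from $\mathcal M$ into a Riemannian manifold $\mathcal E$, let $$E_{s,p}(u) := \int_{\mathcal M}\int_{\mathcal M} \frac{d_{\mathcal E}(u(y),u(x))^p}{d_{\mathcal M}(y,x)^{m+sp}}\,dy\,dx \in [0,\infty],$$ and let $\dot W^{s,p}(\mathcal M,\mathcal E)$ be the set of those measurable $u$ for which $E_{s,p}(u)<\infty$. A Riemannian covering $\pi:\widetilde{\mathcal N}\to\mathcal N$ is a covering map which is a local isometry (a local diffeomorphism preserving the metric tensor). Given such a covering, let $$X(\mathcal M,\widetilde{\mathcal N}) := \Bigl\{\tilde u:\mathcal M\to\widetilde{\mathcal N} \text{ measurable} : \iint_{\{(x,y)\in \mathcal M\times\mathcal M \,:\, d_{\widetilde{\mathcal N}}(\tilde u(x),\tilde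 u(y))\ge \mathrm{inj}(\mathcal N)/2\}} \frac{dy\,dx}{d_{\mathcal M}(x,y)^{m+1}}<\infty\Bigr\}.$$ **Theorem.** Let $\mathcal M$ be a compact Riemannian manifold, $m=\dim\mathcal M$, $s\in(0,1)$ and $p\in(1,\infty)$, with $sp\ge m$ and $sp>1$. (i) For every compact Riemannian manifold $\mathcal N$ and every Riemannian covering $\pi:\widetilde{\mathcal N}\to\mathcal N$ there is a constant $C\in(0,\infty)$ such that, if $\tilde u\in X(\mathcal M,\widetilde{\mathcal N})$ and $u:=\pi\circ\tilde u\in\dot W^{s,p}(\mathcal M,\mathcal N)$, then $\tilde u\in\dot W^{s,p}(\mathcal M,\widetilde{\mathcal N})$ and $$E_{s,p}(\tilde u)\le C\bigl(E_{s,p}(u)+E_{s,p}(u)^{1/s}\bigr).$$ (ii) The exponent $1/s$ is optimal: if $m\ge 1$ and $\pi:\mathbb R\to\mathbb R/2\pi\mathbb Z$ is the universal covering of the unit circle (with its arc-length distance), and if $\gamma\in\mathbb R$ is such that for some constant $C\in[0,\infty)$ the inequality $$E_{s,p}(\tilde u)\le C\bigl(E_{s,p}(\pi\circ\tilde u)+E_{s,p}(\pi\circ\tilde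 u)^{\gamma}\bigr)$$ holds for all $\tilde u\in X(\mathcal M,\mathbb R)$ with $\pi\circ\tilde u\in\dot W^{s,p}(\mathcal M,\mathbb R/2\pi\mathbb Z)$, then $\gamma\ge 1/s$. -/

import Mathlib

open MeasureTheory Set Bundle
open scoped ENNReal NNReal Manifold ContDiff Bundle

noncomputable section

namespace FractionalLifting

/-- The Gagliardo energy `∬ d(u(y), u(x))^p / d(y, x)^(m + s p) dy dx` of a map `u` from an
`m`-dimensional Riemannian manifold `M`, carrying its geodesic distance, into a metric space.
The Riemannian volume measure of `M` is the `m`-dimensional Hausdorff measure of the geodesic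
distance, normalized so as to give the Lebesgue measure on the Euclidean space of dimension `m`. -/
def gagliardoEnergy {M X : Type*} [MetricSpace M] [MeasurableSpace M] [BorelSpace M]
    [MetricSpace X] (m : ℕ) (s p : ℝ) (u : M → X) : ℝ≥0∞ :=
  ∫⁻ x, ∫⁻ y, edist (u y) (u x) ^ p / edist y x ^ ((m : ℝ) + s * p) ∂μHE[m] ∂μHE[m]

/-- Membership in the homogeneous fractional Sobolev space: `u` is measurable with respect to the
completed volume measure and its Gagliardo energy is finite. -/
def MemFractionalSobolev {M X : Type*} [MetricSpace M] [MeasurableSpace M] [BorelSpace M]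
    [MetricSpace X] [MeasurableSpace X] [BorelSpace X] (m : ℕ) (s p : ℝ) (u : M → X) : Prop :=
  AEMeasurable u (μHE[m] : Measure M) ∧ gagliardoEnergy m s p u < ⊤

/-- `c`, restricted to `[0, ℓ]`, is a geodesic parametrized by arc length: it is locally
distance-realizing. -/
def IsUnitSpeedGeodesic {X : Type*} [MetricSpace X] (c : ℝ → X) (ℓ : ℝ) : Prop :=
  ∀ t ∈ Icc 0 ℓ, ∃ ε > 0, ∀ t₁ ∈ Icc 0 ℓ, ∀ t₂ ∈ Icc 0 ℓ,
    |t₁ - t| < ε → |t₂ - t| < ε → dist (c t₁) (c t₂) = |t₁ - t₂|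

/-- The injectivity radius of a complete Riemannian manifold endowed with its geodesic distance:
the infimum over all points of the distance to the cut locus, that is, the supremum of the `r` such
that every unit speed geodesic of length at most `r`, from any point and in any direction, is
minimizing. It is `∞` when there is no cut point. -/
def injectivityRadius (X : Type*) [MetricSpace X] : ℝ≥0∞ :=
  ⨆ (r : ℝ≥0) (_ : ∀ (ℓ : ℝ) (c : ℝ → X), 0 ≤ ℓ → ℓ ≤ r → IsUnitSpeedGeodesic c ℓ →
    dist (c 0) (c ℓ) = ℓ), (r : ℝ≥0∞)

/-- Membership in the space `X(M, Ñ)`, `N` being the base of the covering: `w : M → Ñ` is measurable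
and the integral of `1 / d(x, y)^(m + 1)` over the pairs with `d(w(x), w(y)) ≥ inj(N) / 2` is
finite. -/
def MemX {M N' : Type*} [MetricSpace M] [MeasurableSpace M] [BorelSpace M]
    [MetricSpace N'] [MeasurableSpace N'] [BorelSpace N']
    (N : Type*) [MetricSpace N] (m : ℕ) (w : M → N') : Prop :=
  AEMeasurable w (μHE[m] : Measure M) ∧
    ∫⁻ x, ∫⁻ y in {y | injectivityRadius N / 2 ≤ edist (w x) (w y)},
      1 / edist x y ^ ((m : ℝ) + 1) ∂μHE[m] ∂μHE[m] < ⊤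

/-- A Riemannian covering map: a (topological) covering map which is a local isometry, that is,
a smooth local diffeomorphism preserving the metric tensor. -/
structure IsRiemannianCovering {n : ℕ} {N' N : Type*}
    [TopologicalSpace N'] [ChartedSpace (EuclideanSpace ℝ (Fin n)) N']
    [RiemannianBundle (fun x : N' ↦ TangentSpace (𝓡 n) x)]
    [TopologicalSpace N] [ChartedSpace (EuclideanSpace ℝ (Fin n)) N]
    [RiemannianBundle (fun x : N ↦ TangentSpace (𝓡 n) x)]
    (pr : N' → N) : Prop where
  isCoveringMap : IsCoveringMap pr
  isLocalDiffeomorph : IsLocalDiffeomorph (𝓡 n) (𝓡 n) ∞ pr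
  inner_mfderiv : ∀ (x : N') (v w : TangentSpace (𝓡 n) x),
    inner ℝ (mfderiv (𝓡 n) (𝓡 n) pr x v) (mfderiv (𝓡 n) (𝓡 n) pr x w) = inner ℝ v w

end FractionalLifting

end

set_option linter.unusedSectionVars false

/-! Write `q = s p`, let `δ` be a scale below which the covering is isometric, and let `f x y` be
the distance between the values of the lifting at `x` and `y`, divided by `δ`. Pairs with `f < 1`
contribute to the energy of the lifting exactly what they contribute to that of the projected map,
so everything rests on bounding the pairs with `f ≥ 1` by the pairs with `f < 1`. From there on only
the triangle inequality for `f` is used, and the target disappears.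

Locally, in a Euclidean space of dimension `d`, segments are cut at their midpoints. If `f ≥ 1` at
the endpoints, then either one half still has `f ≥ 1`, or one half has `1/2 ≤ f < 1`. In an
iteration each step costs a factor `2 ^ (d + 1)`. The finiteness of the integral of `1_{f ≥ 1} / |x
- y| ^ (d + 1)`, which is the condition defining `X`, is exactly what makes the remainder vanish by
dominated convergence, and `q > 1` makes the accumulated series converge. This gives
`pairIntegral_largePairs_le`: the integral of `1_{f ≥ 1} / |x - y| ^ (d + q)` is controlled by the
small values.

The number of large pairs is thus controlled, but not yet the size of `f` on them. The density `Γ z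
= ∫ 1_{f(z, y) ≥ 1} / |z - y| ^ (d + 1) dy` plays the role of the modulus of a gradient. The same
subdivision gives a Poincaré inequality (`lintegral_large_le`), and `Γ` lies in `L ^ q` by
`lintegral_largeDensity_rpow_le`. So the large part of `f` behaves like a function with gradient in
`L ^ q`, and the remaining step resembles the embedding of `W^{1,q}` into `W^{s,p}` with `s p = q`.
The hypothesis `q ≥ d` bounds `2 ^ (-j)` times the average of `Γ` at scale `2 ^ (-j)` uniformly, and
interpolation (`exists_tsum_lintegral_average_le`) produces the power `p / q = 1 / s`. Mean
oscillations at all scales are then converted back into the energy by a discrete Hardy inequality,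
first for bounded `f` so that quantities to be absorbed are finite (`exists_energy_le_of_bounded`),
then by truncation (`exists_energy_le`).

Bi-Lipschitz charts carry the estimate to the manifold, and compactness and connectedness patch the
local estimates (`exists_kernelEnergy_le_of_local`). The threshold `inj(N) / 2` in `X` is admissible
because a Riemannian covering is isometric below the injectivity radius
(`IsRiemannianCovering.edist_eq_of_lt_injectivityRadius`).

For optimality, take the liftings `n ψ` with `ψ` a fixed Lipschitz function. Their energy is `n ^ p`
times that of `ψ`, whereas the projections to the circle are bounded and `n`-Lipschitz, so that
their energy is `O(n ^ (s p))`. Comparing the growth forces `γ ≥ 1 / s`. -/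

namespace FractionalLifting


/-! ### Geometric sums over dyadic scales -/

section DyadicSums

lemma dyadic_rpow (l : ℕ) (β : ℝ) : ((2 : ℝ≥0∞) ^ l) ^ β = ((2 : ℝ≥0∞) ^ β) ^ l := by
  rw [← ENNReal.rpow_natCast, ← ENNReal.rpow_mul, mul_comm, ENNReal.rpow_mul, ENNReal.rpow_natCast]

lemma two_rpow_neg_lt_one {β : ℝ} (hβ : 0 < β) : (2 : ℝ≥0∞) ^ (-β) < 1 :=
  ENNReal.rpow_lt_one_of_one_lt_of_neg (by norm_num) (by linarith)

/-- The sum of the geometric series of ratio `2 ^ (-β)`. -/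
noncomputable def geomConst (β : ℝ) : ℝ≥0∞ := (1 - (2 : ℝ≥0∞) ^ (-β))⁻¹

lemma geomConst_ne_top {β : ℝ} (hβ : 0 < β) : geomConst β ≠ ⊤ := by
  rw [geomConst, ENNReal.inv_ne_top]
  exact (tsub_pos_of_lt (two_rpow_neg_lt_one hβ)).ne'

lemma tsum_dyadic_neg (β : ℝ) : ∑' l : ℕ, ((2 : ℝ≥0∞) ^ l) ^ (-β) = geomConst β := by
  simp_rw [dyadic_rpow, ENNReal.tsum_geometric, geomConst]

/-- Fixed-point form of the series, valid even when the sum is infinite. It closes the induction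
over scales below and shows that the constant is nonzero. -/
lemma geomConst_eq (β : ℝ) : geomConst β = 1 + (2 : ℝ≥0∞) ^ (-β) * geomConst β := by
  conv_lhs => rw [← tsum_dyadic_neg,
    ← Summable.sum_add_tsum_nat_add' (k := 1) ENNReal.summable]
  simp_rw [Finset.sum_range_one, dyadic_rpow, pow_succ', pow_zero, ENNReal.tsum_mul_left,
    ENNReal.tsum_geometric, geomConst]

/-- An increasing geometric sum is dominated by its last term, and the last power of two that counts
is less than `τ`. Read backwards from that term, the sum is bounded by the decreasing series, hence
the constant. -/
lemma tsum_dyadic_lt_le {β : ℝ} (hβ : 0 < β) (τ : ℝ≥0∞) :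
    ∑' l : ℕ, (if (2 : ℝ≥0∞) ^ l < τ then ((2 : ℝ≥0∞) ^ l) ^ β else 0) ≤ geomConst β * τ ^ β := by
  have hfull : ∀ n : ℕ, ∑ l ∈ Finset.range (n + 1), ((2 : ℝ≥0∞) ^ l) ^ β
      ≤ geomConst β * ((2 : ℝ≥0∞) ^ n) ^ β := by
    intro n
    induction n with
    | zero => simp only [zero_add, Finset.range_one, Finset.sum_singleton, pow_zero,
                ENNReal.one_rpow, mul_one]; rw [geomConst_eq]; exact le_self_add
    | succ n ih =>
      rw [Finset.sum_range_succ]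
      refine (add_le_add_left ih _).trans ?_
      conv_rhs => rw [geomConst_eq]
      have : (2 : ℝ≥0∞) ^ (-β) * geomConst β * ((2 : ℝ≥0∞) ^ (n + 1)) ^ β
          = geomConst β * ((2 : ℝ≥0∞) ^ n) ^ β := by
        rw [dyadic_rpow, dyadic_rpow, pow_succ']
        have h2 : (2 : ℝ≥0∞) ^ (-β) * 2 ^ β = 1 := by
          rw [← ENNReal.rpow_add _ _ (by norm_num) (by norm_num)]; simp
        calc _ = ((2 : ℝ≥0∞) ^ (-β) * 2 ^ β) * (geomConst β * (2 ^ β) ^ n) := by ring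
          _ = _ := by rw [h2, one_mul]
      rw [add_mul, this, one_mul, add_comm]
  refine ENNReal.tsum_le_of_sum_range_le fun n ↦ ?_
  induction n with
  | zero => simp
  | succ n ih =>
    by_cases h : (2 : ℝ≥0∞) ^ n < τ
    · refine (Finset.sum_le_sum (g := fun l ↦ ((2 : ℝ≥0∞) ^ l) ^ β) fun l _ ↦ ?_).trans
        ((hfull n).trans ?_)
      · split_ifs <;> simp
      · gcongr
    · rw [Finset.sum_range_succ, if_neg h, add_zero]; exact ih

/-- The first scale reaching `τ` dominates the others; if no scale does, the sum is empty. -/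
lemma tsum_dyadic_ge_le {α : ℝ} (hα : 0 < α) (τ : ℝ≥0∞) :
    ∑' l : ℕ, (if τ ≤ (2 : ℝ≥0∞) ^ l then ((2 : ℝ≥0∞) ^ l) ^ (-α) else 0)
      ≤ geomConst α * τ ^ (-α) := by
  classical
  by_cases hex : ∃ l : ℕ, τ ≤ (2 : ℝ≥0∞) ^ l
  · set g : ℕ → ℝ≥0∞ := fun l ↦ if τ ≤ (2 : ℝ≥0∞) ^ l then ((2 : ℝ≥0∞) ^ l) ^ (-α) else 0 with hg
    have h0 : ∑ l ∈ Finset.range (Nat.find hex), g l = 0 :=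
      Finset.sum_eq_zero fun i hi ↦ if_neg (Nat.find_min hex (Finset.mem_range.1 hi))
    rw [← Summable.sum_add_tsum_nat_add' (f := g) (k := Nat.find hex) ENNReal.summable, h0,
      zero_add]
    calc _ ≤ ∑' i : ℕ, ((2 : ℝ≥0∞) ^ i) ^ (-α) * ((2 : ℝ≥0∞) ^ (Nat.find hex)) ^ (-α) := by
          refine ENNReal.tsum_le_tsum fun i ↦ ?_
          simp only [hg]
          split_ifs
          · rw [dyadic_rpow, dyadic_rpow, dyadic_rpow, pow_add]
          · simp
      _ = geomConst α * ((2 : ℝ≥0∞) ^ (Nat.find hex)) ^ (-α) := by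
          rw [ENNReal.tsum_mul_right, tsum_dyadic_neg]
      _ ≤ _ := by
          refine mul_le_mul_right ?_ _
          rw [ENNReal.rpow_neg, ENNReal.rpow_neg, ENNReal.inv_le_inv]
          exact ENNReal.rpow_le_rpow (Nat.find_spec hex) hα.le
  · push Not at hex
    simp [not_le.2 (hex _)]

end DyadicSums

/-! ### Double integrals over pairs of points and iterated subdivision of segments -/

section PairIntegrals

variable {E : Type*} [NormedAddCommGroup E] [NormedSpace ℝ E] [FiniteDimensional ℝ E]
  [MeasurableSpace E] [BorelSpace E] (μ : Measure E) [μ.IsAddHaarMeasure]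

local notation "dim" => Module.finrank ℝ E

/-- A dilation is a homeomorphism, so the change of variables needs no measurability of `g`. -/
lemma lintegral_comp_smul_of_pos (g : E → ℝ≥0∞) {r : ℝ} (hr : 0 < r) :
    ∫⁻ h, g h ∂μ = ENNReal.ofReal r ^ dim * ∫⁻ h, g (r • h) ∂μ := by
  have h := lintegral_map_equiv (μ := μ) g
    (Homeomorph.smulOfNeZero r hr.ne' : E ≃ₜ E).toMeasurableEquiv
  have h2 := Measure.map_addHaar_smul μ hr.ne'
  simp only [Homeomorph.toMeasurableEquiv_coe, Homeomorph.smulOfNeZero_apply] at h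
  rw [h2, lintegral_smul_measure] at h
  rw [← h, smul_eq_mul, ← mul_assoc]
  have : ENNReal.ofReal r ^ dim * ENNReal.ofReal |(r ^ dim)⁻¹| = 1 := by
    rw [abs_of_pos (by positivity), ENNReal.ofReal_inv_of_pos (by positivity),
      ENNReal.ofReal_pow hr.le]
    exact ENNReal.mul_inv_cancel (by simp [hr]) (by simp)
  rw [this, one_mul]

lemma lintegral_comp_two_smul (g : E → ℝ≥0∞) :
    ∫⁻ h, g h ∂μ = 2 ^ dim * ∫⁻ h, g ((2 : ℝ) • h) ∂μ := by
  simpa using lintegral_comp_smul_of_pos μ g (r := 2) (by norm_num)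

/-- The weighted integral of `a x y` over pairs of points, in the variables `x` and `y - x`. -/
noncomputable def pairIntegral (a : E → E → ℝ≥0∞) (φ : E → ℝ≥0∞) : ℝ≥0∞ :=
  ∫⁻ x, ∫⁻ h, a x (x + h) * φ h ∂μ ∂μ

variable {μ}

lemma measurable_pair {a : E → E → ℝ≥0∞} (ha : Measurable (Function.uncurry a)) :
    Measurable (fun z : E × E ↦ a z.1 (z.1 + z.2)) :=
  ha.comp (measurable_fst.prodMk (measurable_fst.add measurable_snd))

lemma measurable_pair_mul {a : E → E → ℝ≥0∞} (ha : Measurable (Function.uncurry a))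
    {φ : E → ℝ≥0∞} (hφ : Measurable φ) :
    Measurable (Function.uncurry fun x h : E ↦ a x (x + h) * φ h) :=
  (measurable_pair ha).mul (hφ.comp measurable_snd)

lemma measurable_pair_right {a : E → E → ℝ≥0∞} (ha : Measurable (Function.uncurry a)) (x : E) :
    Measurable (fun h : E ↦ a x (x + h)) :=
  (measurable_pair ha).comp measurable_prodMk_left

lemma pairIntegral_eq_prod {a : E → E → ℝ≥0∞} (ha : Measurable (Function.uncurry a))
    {φ : E → ℝ≥0∞} (hφ : Measurable φ) :
    pairIntegral μ a φ = ∫⁻ z : E × E, a z.1 (z.1 + z.2) * φ z.2 ∂(μ.prod μ) := by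
  exact (lintegral_prod _ (measurable_pair_mul ha hφ).aemeasurable).symm

lemma pairIntegral_mono {a b : E → E → ℝ≥0∞} {φ ψ : E → ℝ≥0∞}
    (h : ∀ x h, a x (x + h) * φ h ≤ b x (x + h) * ψ h) :
    pairIntegral μ a φ ≤ pairIntegral μ b ψ :=
  lintegral_mono fun x ↦ lintegral_mono fun y ↦ h x y

lemma pairIntegral_mono_ae {a b : E → E → ℝ≥0∞} {φ ψ : E → ℝ≥0∞}
    (h : ∀ x, ∀ᵐ h ∂μ, a x (x + h) * φ h ≤ b x (x + h) * ψ h) :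
    pairIntegral μ a φ ≤ pairIntegral μ b ψ :=
  lintegral_mono fun x ↦ lintegral_mono_ae (h x)

lemma pairIntegral_const_mul_right {a : E → E → ℝ≥0∞} {φ : E → ℝ≥0∞}
    {c : ℝ≥0∞} (hc : c ≠ ⊤) :
    pairIntegral μ a (fun h ↦ c * φ h) = c * pairIntegral μ a φ := by
  unfold pairIntegral
  rw [← lintegral_const_mul' _ _ hc]
  refine lintegral_congr fun x ↦ ?_
  rw [← lintegral_const_mul' _ _ hc]
  exact lintegral_congr fun h ↦ by ring

lemma pairIntegral_const_mul_left {a : E → E → ℝ≥0∞} {φ : E → ℝ≥0∞}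
    {c : ℝ≥0∞} (hc : c ≠ ⊤) :
    pairIntegral μ (fun x y ↦ c * a x y) φ = c * pairIntegral μ a φ := by
  rw [← pairIntegral_const_mul_right hc]
  unfold pairIntegral
  refine lintegral_congr fun x ↦ lintegral_congr fun h ↦ by ring

lemma pairIntegral_add_left {a b : E → E → ℝ≥0∞} (ha : Measurable (Function.uncurry a))
    {φ : E → ℝ≥0∞} (hφ : Measurable φ) :
    pairIntegral μ (fun x y ↦ a x y + b x y) φ = pairIntegral μ a φ + pairIntegral μ b φ := by
  unfold pairIntegral
  rw [← lintegral_add_left (Measurable.lintegral_prod_right (measurable_pair_mul ha hφ))]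
  refine lintegral_congr fun x ↦ ?_
  have hm : Measurable fun h ↦ a x (x + h) * φ h := (measurable_pair_right ha x).mul hφ
  rw [← lintegral_add_left hm]
  exact lintegral_congr fun h ↦ by ring

lemma pairIntegral_swap {a : E → E → ℝ≥0∞} (ha : Measurable (Function.uncurry a))
    {φ : E → ℝ≥0∞} (hφ : Measurable φ) :
    pairIntegral μ a φ = ∫⁻ h, ∫⁻ x, a x (x + h) * φ h ∂μ ∂μ :=
  lintegral_lintegral_swap (measurable_pair_mul ha hφ).aemeasurable

lemma pairIntegral_tsum {a : E → E → ℝ≥0∞} (ha : Measurable (Function.uncurry a))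
    {φ : ℕ → E → ℝ≥0∞} (hφ : ∀ l, Measurable (φ l)) :
    pairIntegral μ a (fun h ↦ ∑' l, φ l h) = ∑' l, pairIntegral μ a (φ l) := by
  unfold pairIntegral
  rw [← lintegral_tsum fun l ↦
    (Measurable.lintegral_prod_right (measurable_pair_mul ha (hφ l))).aemeasurable]
  refine lintegral_congr fun x ↦ ?_
  have hm : ∀ l, AEMeasurable (fun h ↦ a x (x + h) * φ l h) μ := fun l ↦
    ((measurable_pair_right ha x).mul (hφ l)).aemeasurable
  rw [← lintegral_tsum hm]
  exact lintegral_congr fun h ↦ ENNReal.tsum_mul_left.symm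

lemma measurable_half_left {a : E → E → ℝ≥0∞} (ha : Measurable (Function.uncurry a))
    {φ : E → ℝ≥0∞} (hφ : Measurable φ) :
    Measurable (Function.uncurry fun x h : E ↦ a x (x + (1 / 2 : ℝ) • h) * φ h) := by
  have h1 : Measurable fun z : E × E ↦ (z.1, z.1 + (1 / 2 : ℝ) • z.2) := by fun_prop
  exact (ha.comp h1).mul (hφ.comp measurable_snd)

lemma measurable_half_right {a : E → E → ℝ≥0∞} (ha : Measurable (Function.uncurry a))
    {φ : E → ℝ≥0∞} (hφ : Measurable φ) :
    Measurable (Function.uncurry fun x h : E ↦ a (x + (1 / 2 : ℝ) • h) (x + h) * φ h) := by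
  have h1 : Measurable fun z : E × E ↦ (z.1 + (1 / 2 : ℝ) • z.2, z.1 + z.2) := by fun_prop
  exact (ha.comp h1).mul (hφ.comp measurable_snd)

lemma lintegral_half_left (a : E → E → ℝ≥0∞) (φ : E → ℝ≥0∞) :
    ∫⁻ x, ∫⁻ h, a x (x + (1 / 2 : ℝ) • h) * φ h ∂μ ∂μ
      = 2 ^ dim * pairIntegral μ a (fun h ↦ φ ((2 : ℝ) • h)) := by
  rw [pairIntegral, ← lintegral_const_mul' _ _ (by simp)]
  refine lintegral_congr fun x ↦ ?_
  rw [lintegral_comp_two_smul]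
  simp [smul_smul]

/-- For fixed `h`, translating `x` by `h / 2` moves the second half of the segment onto the first
half, where `lintegral_half_left` applies. -/
lemma lintegral_half_right {a : E → E → ℝ≥0∞} (ha : Measurable (Function.uncurry a))
    {φ : E → ℝ≥0∞} (hφ : Measurable φ) :
    ∫⁻ x, ∫⁻ h, a (x + (1 / 2 : ℝ) • h) (x + h) * φ h ∂μ ∂μ
      = 2 ^ dim * pairIntegral μ a (fun h ↦ φ ((2 : ℝ) • h)) := by
  have hm := measurable_half_right ha hφ
  have hm' := measurable_half_left ha hφ
  rw [← lintegral_half_left, lintegral_lintegral_swap hm.aemeasurable,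
    lintegral_lintegral_swap hm'.aemeasurable]
  refine lintegral_congr fun h ↦ ?_
  rw [← lintegral_add_right_eq_self (fun x ↦ a x (x + (1 / 2 : ℝ) • h) * φ h) ((1 / 2 : ℝ) • h)]
  refine lintegral_congr fun x ↦ ?_
  rw [add_assoc x, ← add_smul]
  norm_num

/-- One step of the subdivision of segments at their midpoints. -/
lemma pairIntegral_le_of_midpoint {a b : E → E → ℝ≥0∞} (ha : Measurable (Function.uncurry a))
    (hb : Measurable (Function.uncurry b)) {φ : E → ℝ≥0∞} (hφ : Measurable φ)
    (h : ∀ x h, a x (x + h) ≤ b x (x + h) + (a x (x + (1 / 2 : ℝ) • h)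
      + a (x + (1 / 2 : ℝ) • h) (x + h))) :
    pairIntegral μ a φ ≤ pairIntegral μ b φ
      + 2 ^ (dim + 1) * pairIntegral μ a (fun h ↦ φ ((2 : ℝ) • h)) := by
  have hm := measurable_half_right ha hφ
  have hm' := measurable_half_left ha hφ
  -- Each half of the segment costs `2 ^ dim`, the Jacobian of doubling the increment; the presence
  -- of two halves gives the remaining factor 2.
  have h2 : (2 : ℝ≥0∞) ^ (dim + 1) * pairIntegral μ a (fun h ↦ φ ((2 : ℝ) • h))
      = ∫⁻ x, ∫⁻ h, a x (x + (1 / 2 : ℝ) • h) * φ h ∂μ ∂μ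
        + ∫⁻ x, ∫⁻ h, a (x + (1 / 2 : ℝ) • h) (x + h) * φ h ∂μ ∂μ := by
    rw [lintegral_half_left, lintegral_half_right ha hφ, pow_succ]; ring
  rw [h2]
  conv_rhs => rw [pairIntegral, ← lintegral_add_left hm'.lintegral_prod_right,
    ← lintegral_add_left (Measurable.lintegral_prod_right (measurable_pair_mul hb hφ))]
  refine lintegral_mono fun x ↦ ?_
  rw [← lintegral_add_left (f := fun y ↦ a x (x + (1 / 2 : ℝ) • y) * φ y)
      (hm'.comp measurable_prodMk_left),
    ← lintegral_add_left (f := fun y ↦ b x (x + y) * φ y)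
      ((measurable_pair_mul hb hφ).comp measurable_prodMk_left)]
  refine lintegral_mono fun y ↦ ?_
  rw [← add_mul, ← add_mul]
  gcongr
  exact h x y

/-- The sum of the rescalings of a weight produced by iterated subdivisions. -/
noncomputable def dyadicWeight (φ : E → ℝ≥0∞) (h : E) : ℝ≥0∞ :=
  ∑' l : ℕ, (2 ^ (dim + 1)) ^ l * φ ((2 : ℝ) ^ l • h)

/-- Iterating the midpoint step `L` times dilates the weight by 2 and multiplies it by `2 ^ (dim +
1)` each time. The terms in `b` add up to a partial sum of `dyadicWeight φ`, and a remainder in `a`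
survives. -/
lemma pairIntegral_le_sum_of_midpoint {a b : E → E → ℝ≥0∞} (ha : Measurable (Function.uncurry a))
    (hb : Measurable (Function.uncurry b)) {φ : E → ℝ≥0∞} (hφ : Measurable φ)
    (h : ∀ x h, a x (x + h) ≤ b x (x + h) + (a x (x + (1 / 2 : ℝ) • h)
      + a (x + (1 / 2 : ℝ) • h) (x + h))) (L : ℕ) :
    pairIntegral μ a φ ≤ pairIntegral μ b (dyadicWeight φ)
      + pairIntegral μ a (fun h ↦ (2 ^ (dim + 1)) ^ L * φ ((2 : ℝ) ^ L • h)) := by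
  have hφl : ∀ l : ℕ, Measurable fun h ↦ φ ((2 : ℝ) ^ l • h) := fun l ↦
    hφ.comp (measurable_const_smul _)
  have key : pairIntegral μ a φ ≤ ∑ l ∈ Finset.range L,
      pairIntegral μ b (fun h ↦ (2 ^ (dim + 1)) ^ l * φ ((2 : ℝ) ^ l • h))
      + pairIntegral μ a (fun h ↦ (2 ^ (dim + 1)) ^ L * φ ((2 : ℝ) ^ L • h)) := by
    induction L with
    | zero => simp
    | succ L ih =>
      refine ih.trans ?_
      rw [Finset.sum_range_succ, add_assoc]
      gcongr
      rw [pairIntegral_const_mul_right (by simp), pairIntegral_const_mul_right (by simp),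
        pairIntegral_const_mul_right (by simp)]
      have := pairIntegral_le_of_midpoint (μ := μ) ha hb (hφl L) h
      simp only [smul_smul] at this
      refine (mul_le_mul_right this ((2 ^ (dim + 1)) ^ L)).trans_eq ?_
      rw [mul_add, ← mul_assoc, pow_succ ((2 : ℝ≥0∞) ^ (dim + 1)), pow_succ (2 : ℝ)]
  refine key.trans ?_
  gcongr
  unfold dyadicWeight
  rw [pairIntegral_tsum hb fun l ↦ (hφl l).const_mul _]
  exact ENNReal.sum_le_tsum _

/-- Iterated subdivision of segments at their midpoints: if the remainder is dominated, it
disappears in the limit. -/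
lemma pairIntegral_le_dyadicWeight [Nontrivial E] {a b K : E → E → ℝ≥0∞}
    (ha : Measurable (Function.uncurry a)) (hb : Measurable (Function.uncurry b))
    (hK : Measurable (Function.uncurry K)) {φ ψ : E → ℝ≥0∞} (hφ : Measurable φ)
    (hψ : Measurable ψ)
    (h : ∀ x h, a x (x + h) ≤ b x (x + h) + (a x (x + (1 / 2 : ℝ) • h)
      + a (x + (1 / 2 : ℝ) • h) (x + h)))
    {κ C : ℝ≥0∞} (hκ : κ ≠ ⊤) (hC : C ≠ ⊤) (haK : ∀ x y, a x y ≤ κ * K x y)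
    (hKψ : pairIntegral μ K ψ ≠ ⊤)
    (hφψ : ∀ (l : ℕ) (h : E), (2 ^ (dim + 1)) ^ l * φ ((2 : ℝ) ^ l • h) ≤ C * ψ h)
    (hS : ∀ h : E, h ≠ 0 → dyadicWeight φ h ≠ ⊤) (haT : ∀ x y, a x y ≠ ⊤) :
    pairIntegral μ a φ ≤ pairIntegral μ b (dyadicWeight φ) := by
  have hφl : ∀ l : ℕ, Measurable fun h ↦ (2 ^ (dim + 1)) ^ l * φ ((2 : ℝ) ^ l • h) := fun l ↦
    (hφ.comp (measurable_const_smul _)).const_mul _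
  -- The remainder tends to zero by dominated convergence: the integrands are dominated by `κ * C *
  -- K * ψ`, and converge to zero pointwise for `h ≠ 0`, because the weights are the terms of the
  -- convergent series `dyadicWeight φ h` and `a` is finite.
  have hlim : Filter.Tendsto (fun l : ℕ ↦
      pairIntegral μ a (fun h ↦ (2 ^ (dim + 1)) ^ l * φ ((2 : ℝ) ^ l • h))) Filter.atTop
      (nhds 0) := by
    have heq : ∀ l : ℕ, _ := fun l ↦ pairIntegral_eq_prod (μ := μ) ha (hφl l)
    simp_rw [heq]
    rw [show (0 : ℝ≥0∞) = ∫⁻ z : E × E, 0 ∂(μ.prod μ) by simp]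
    refine tendsto_lintegral_of_dominated_convergence
      (fun z : E × E ↦ κ * C * (K z.1 (z.1 + z.2) * ψ z.2)) (fun l ↦ ?_) (fun l ↦ ?_) ?_ ?_
    · exact measurable_pair_mul ha (hφl l)
    · refine ae_of_all _ fun z ↦ ?_
      calc _ ≤ κ * K z.1 (z.1 + z.2) * (C * ψ z.2) := mul_le_mul' (haK _ _) (hφψ _ _)
        _ = _ := by ring
    · rw [lintegral_const_mul' _ _ (ENNReal.mul_ne_top hκ hC), ← pairIntegral_eq_prod hK hψ]
      exact ENNReal.mul_ne_top (ENNReal.mul_ne_top hκ hC) hKψ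
    · have h0 : ∀ᵐ z : E × E ∂(μ.prod μ), z.2 ≠ 0 := by
        have : ∀ᵐ h : E ∂μ, h ≠ 0 := by simp [ae_iff, measure_singleton]
        exact Measure.quasiMeasurePreserving_snd.ae this
      filter_upwards [h0] with z hz
      have h1 := ENNReal.tendsto_atTop_zero_of_tsum_ne_top (hS z.2 hz)
      simpa using ENNReal.Tendsto.const_mul h1 (Or.inr (haT z.1 (z.1 + z.2)))
  have hlim' := hlim.const_add (pairIntegral μ b (dyadicWeight φ))
  rw [add_zero] at hlim'
  exact ge_of_tendsto' hlim' fun L ↦ pairIntegral_le_sum_of_midpoint ha hb hφ h L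

end PairIntegrals

end FractionalLifting

namespace FractionalLifting

/-! ### Improved integrability of the set of pairs with large values -/

section LargePairs

variable {E : Type*} [NormedAddCommGroup E] [NormedSpace ℝ E] [FiniteDimensional ℝ E]
  [MeasurableSpace E] [BorelSpace E] {μ : Measure E} [μ.IsAddHaarMeasure]

local notation "dim" => Module.finrank ℝ E

open Classical in
/-- The indicator function of the pairs of points of `V` at which `f` is at least `1`. -/
noncomputable def largePairs (V : Set E) (f : E → E → ℝ≥0∞) (x y : E) : ℝ≥0∞ :=
  if x ∈ V ∧ y ∈ V ∧ 1 ≤ f x y then 1 else 0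

open Classical in
/-- The indicator function of the pairs of points of `V` at which `f` is in `[1/2, 1)`. -/
noncomputable def middlePairs (V : Set E) (f : E → E → ℝ≥0∞) (x y : E) : ℝ≥0∞ :=
  if x ∈ V ∧ y ∈ V ∧ 1 ≤ 2 * f x y ∧ f x y < 1 then 1 else 0

/-- The homogeneous weight of exponent `-β`. -/
noncomputable def normWeight (β : ℝ) (h : E) : ℝ≥0∞ := ‖h‖ₑ ^ (-β)

lemma measurable_normWeight (β : ℝ) : Measurable (normWeight (E := E) β) :=
  measurable_enorm.pow_const _

lemma measurableSet_prod_mem {V : Set E} (hV : MeasurableSet V) {f : E → E → ℝ≥0∞}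
    (hf : Measurable (Function.uncurry f)) {S : Set ℝ≥0∞} (hS : MeasurableSet S) :
    MeasurableSet {z : E × E | z.1 ∈ V ∧ z.2 ∈ V ∧ f z.1 z.2 ∈ S} :=
  (measurable_fst hV).inter ((measurable_snd hV).inter (hf hS))

lemma measurable_largePairs {V : Set E} (hV : MeasurableSet V) {f : E → E → ℝ≥0∞}
    (hf : Measurable (Function.uncurry f)) : Measurable (Function.uncurry (largePairs V f)) :=
  Measurable.ite (measurableSet_prod_mem hV hf measurableSet_Ici) measurable_const measurable_const

lemma measurable_middlePairs {V : Set E} (hV : MeasurableSet V) {f : E → E → ℝ≥0∞}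
    (hf : Measurable (Function.uncurry f)) : Measurable (Function.uncurry (middlePairs V f)) :=
  Measurable.ite (measurableSet_prod_mem hV hf (S := {t | 1 ≤ 2 * t ∧ t < 1})
    ((measurableSet_le measurable_const (measurable_id.const_mul 2)).inter measurableSet_Iio))
    measurable_const measurable_const

lemma largePairs_le_one (V : Set E) (f : E → E → ℝ≥0∞) (x y : E) : largePairs V f x y ≤ 1 := by
  unfold largePairs; split_ifs <;> simp

lemma half_mem_of_convex {V : Set E} (hV : Convex ℝ V) {x h : E} (hx : x ∈ V) (hh : x + h ∈ V) :
    x + (1 / 2 : ℝ) • h ∈ V := by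
  have := hV.add_smul_sub_mem hx hh (t := 1 / 2) ⟨by norm_num, by norm_num⟩
  simpa using this

lemma enorm_two_pow_smul (l : ℕ) (h : E) : ‖(2 : ℝ) ^ l • h‖ₑ = 2 ^ l * ‖h‖ₑ := by
  rw [enorm_smul, enorm_pow]
  congr 2
  rw [Real.enorm_eq_ofReal (by norm_num)]; simp

lemma two_pow_rpow_add (l : ℕ) (α β : ℝ) :
    ((2 : ℝ≥0∞) ^ l) ^ (α + β) = ((2 : ℝ≥0∞) ^ l) ^ α * ((2 : ℝ≥0∞) ^ l) ^ β :=
  ENNReal.rpow_add _ _ (by simp) (by simp)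

lemma two_pow_pow_eq_rpow (k l : ℕ) : ((2 : ℝ≥0∞) ^ k) ^ l = ((2 : ℝ≥0∞) ^ l) ^ (k : ℝ) := by
  rw [ENNReal.rpow_natCast, ← pow_mul, ← pow_mul, mul_comm]

lemma normWeight_two_pow_smul (β : ℝ) (l : ℕ) (h : E) :
    normWeight β ((2 : ℝ) ^ l • h) = ((2 : ℝ≥0∞) ^ l) ^ (-β) * normWeight β h := by
  rw [normWeight, enorm_two_pow_smul, ENNReal.mul_rpow_of_ne_top (by simp) (by simp), normWeight]

lemma normWeight_two_smul_le {β : ℝ} (hβ : 0 ≤ β) (h : E) :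
    normWeight β ((2 : ℝ) • h) ≤ normWeight β h := by
  have := normWeight_two_pow_smul β 1 h
  rw [pow_one, pow_one] at this
  rw [this]
  refine mul_le_of_le_one_left' ?_
  rcases hβ.eq_or_lt with rfl | h
  · simp
  · exact (two_rpow_neg_lt_one h).le

open Classical in
/-- The homogeneous weight of exponent `-β`, truncated at the origin. -/
noncomputable def truncWeight (β : ℝ) (η : ℝ≥0∞) (h : E) : ℝ≥0∞ :=
  if η ≤ ‖h‖ₑ then normWeight β h else 0

lemma measurable_truncWeight (β : ℝ) (η : ℝ≥0∞) : Measurable (truncWeight (E := E) β η) :=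
  Measurable.ite (measurableSet_le measurable_const measurable_enorm) (measurable_normWeight β)
    measurable_const

lemma truncWeight_le (β : ℝ) (η : ℝ≥0∞) (h : E) : truncWeight β η h ≤ normWeight β h := by
  unfold truncWeight; split_ifs <;> simp

/-- The homogeneity `-(dim + q)` against the factor `2 ^ (dim + 1)` leaves the ratio `2 ^ (-(q -
1))`, so that `q > 1` makes the constant finite. The bound does not depend on the truncation `η`. -/
lemma dyadicWeight_truncWeight_le (q : ℝ) (η : ℝ≥0∞) (h : E) :
    dyadicWeight (truncWeight (dim + q) η) h ≤ geomConst (q - 1) * normWeight (dim + q) h := by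
  rw [← tsum_dyadic_neg, ← ENNReal.tsum_mul_right]
  refine ENNReal.tsum_le_tsum fun l ↦ ?_
  calc _ ≤ (2 ^ (dim + 1)) ^ l * normWeight (dim + q) ((2 : ℝ) ^ l • h) := by
        gcongr; exact truncWeight_le _ _ _
    _ = _ := by
        rw [normWeight_two_pow_smul, ← mul_assoc, two_pow_pow_eq_rpow, ← two_pow_rpow_add]
        congr 2
        push_cast; ring

/-- The factor `2 ^ ((dim + 1) l)` exactly compensates a homogeneity of degree `-(dim + 1)`; the
excess power of the norm has negative exponent `1 - q` and is bounded because of the truncation.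
This uniform domination is where the exponent `dim + 1` of the finiteness assumption comes from. -/
lemma truncWeight_dilation_le {q : ℝ} (hq : 1 < q) {η : ℝ≥0∞} (hη : η ≠ 0) (l : ℕ) (h : E) :
    (2 ^ (dim + 1)) ^ l * truncWeight (dim + q) η ((2 : ℝ) ^ l • h)
      ≤ η ^ (1 - q) * normWeight (dim + 1) h := by
  unfold truncWeight
  split_ifs with hh
  · have h0 : ‖(2 : ℝ) ^ l • h‖ₑ ≠ 0 := fun h0 ↦ hη (by simpa [h0] using hh)
    have h1 : normWeight (dim + q) ((2 : ℝ) ^ l • h)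
        = ‖(2 : ℝ) ^ l • h‖ₑ ^ (1 - q) * normWeight (dim + 1) ((2 : ℝ) ^ l • h) := by
      rw [normWeight, normWeight, ← ENNReal.rpow_add _ _ h0 (by simp)]
      congr 1; ring
    rw [h1, normWeight_two_pow_smul, two_pow_pow_eq_rpow]
    calc _ = ‖(2 : ℝ) ^ l • h‖ₑ ^ (1 - q) * (((2 : ℝ≥0∞) ^ l) ^ ((dim + 1 : ℕ) : ℝ)
          * ((2 : ℝ≥0∞) ^ l) ^ (-(dim + 1 : ℝ))) * normWeight (dim + 1) h := by ring
      _ = ‖(2 : ℝ) ^ l • h‖ₑ ^ (1 - q) * normWeight (dim + 1) h := by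
          rw [← two_pow_rpow_add]; simp
      _ ≤ _ := by
          refine mul_le_mul_left ?_ _
          rw [show 1 - q = -(q - 1) by ring, ENNReal.rpow_neg, ENNReal.rpow_neg,
            ENNReal.inv_le_inv]
          exact ENNReal.rpow_le_rpow hh (by linarith)
  · simp

/-- If `f < 1` on both halves, the triangle inequality makes the larger of the two values at least
`1/2`, so that this half is a middle pair. Convexity keeps the midpoint in `V`. -/
lemma largePairs_le_midpoint {V : Set E} (hV : Convex ℝ V) {f : E → E → ℝ≥0∞}
    (htri : ∀ x y z, f x z ≤ f x y + f y z) (x h : E) :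
    largePairs V f x (x + h) ≤ (middlePairs V f x (x + (1 / 2 : ℝ) • h)
      + middlePairs V f (x + (1 / 2 : ℝ) • h) (x + h))
      + (largePairs V f x (x + (1 / 2 : ℝ) • h)
        + largePairs V f (x + (1 / 2 : ℝ) • h) (x + h)) := by
  rw [largePairs]
  split_ifs with hh
  · obtain ⟨hx, hy, hxy⟩ := hh
    have hz := half_mem_of_convex hV hx hy
    set z := x + (1 / 2 : ℝ) • h
    have ht := hxy.trans (htri x z (x + h))
    by_cases h1 : 1 ≤ f x z
    · refine le_add_left (le_add_right ?_)
      simp [largePairs, hx, hz, h1]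
    by_cases h2 : 1 ≤ f z (x + h)
    · refine le_add_left (le_add_left ?_)
      simp [largePairs, hy, hz, h2]
    refine le_add_right ?_
    rcases le_total (f x z) (f z (x + h)) with h3 | h3
    · refine le_add_left ?_
      have : 1 ≤ 2 * f z (x + h) := ht.trans (by rw [two_mul]; gcongr)
      simp [middlePairs, hy, hz, this, not_le.1 h2]
    · refine le_add_right ?_
      have : 1 ≤ 2 * f x z := ht.trans (by rw [two_mul]; gcongr)
      simp [middlePairs, hx, hz, this, not_le.1 h1]
  · simp

/-- If `∬ 1_{f ≥ 1} / |x - y| ^ (d + 1)` is finite, then the large values of `f` are controlled by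
its intermediate values. -/
theorem pairIntegral_largePairs_le [Nontrivial E] {V : Set E} (hV : Convex ℝ V)
    (hVm : MeasurableSet V)
    {f : E → E → ℝ≥0∞} (hf : Measurable (Function.uncurry f))
    (htri : ∀ x y z, f x z ≤ f x y + f y z) {q : ℝ} (hq : 1 < q)
    (hfin : pairIntegral μ (largePairs V f) (normWeight (dim + 1)) ≠ ⊤) :
    pairIntegral μ (largePairs V f) (normWeight (dim + q))
      ≤ 2 ^ (dim + 1) * geomConst (q - 1)
        * pairIntegral μ (middlePairs V f) (normWeight (dim + q)) := by
  have hK := measurable_largePairs hVm hf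
  have hK' := measurable_middlePairs hVm hf
  have hqd : (0 : ℝ) ≤ dim + q := by positivity
  -- The subdivision lemma wants a function of the two endpoints, hence the midpoint written as `x +
  -- (y - x) / 2`.
  set b : E → E → ℝ≥0∞ := fun x y ↦ middlePairs V f x (x + (1 / 2 : ℝ) • (y - x))
      + middlePairs V f (x + (1 / 2 : ℝ) • (y - x)) y with hb_def
  have hb : Measurable (Function.uncurry b) := by
    have h1 : Measurable fun z : E × E ↦ (z.1, z.1 + (1 / 2 : ℝ) • (z.2 - z.1)) := by fun_prop
    have h2 : Measurable fun z : E × E ↦ (z.1 + (1 / 2 : ℝ) • (z.2 - z.1), z.2) := by fun_prop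
    exact (hK'.comp h1).add (hK'.comp h2)
  have hbJ : pairIntegral μ b (normWeight (dim + q))
      ≤ 2 ^ (dim + 1) * pairIntegral μ (middlePairs V f) (normWeight (dim + q)) := by
    have h1 : pairIntegral μ b (normWeight (dim + q))
        = 2 ^ (dim + 1) * pairIntegral μ (middlePairs V f)
            (fun h ↦ normWeight (dim + q) ((2 : ℝ) • h)) := by
      have hm := measurable_half_left hK' (measurable_normWeight (E := E) (dim + q))
      calc _ = ∫⁻ x, ∫⁻ h, (middlePairs V f x (x + (1 / 2 : ℝ) • h) * normWeight (dim + q) h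
                + middlePairs V f (x + (1 / 2 : ℝ) • h) (x + h)
                  * normWeight (dim + q) h) ∂μ ∂μ := by
              refine lintegral_congr fun x ↦ lintegral_congr fun h ↦ ?_
              simp only [hb_def, add_sub_cancel_left, add_mul]
        _ = ∫⁻ x, (∫⁻ h, middlePairs V f x (x + (1 / 2 : ℝ) • h) * normWeight (dim + q) h ∂μ
              + ∫⁻ h, middlePairs V f (x + (1 / 2 : ℝ) • h) (x + h) * normWeight (dim + q) h ∂μ)
              ∂μ :=
              lintegral_congr fun x ↦ lintegral_add_left (hm.comp measurable_prodMk_left) _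
        _ = _ := by
              rw [lintegral_add_left hm.lintegral_prod_right, lintegral_half_left,
                lintegral_half_right hK' (measurable_normWeight _), pow_succ]
              ring
    rw [h1]
    gcongr
    refine pairIntegral_mono fun x h ↦ ?_
    gcongr
    exact normWeight_two_smul_le hqd h
  -- The domination needed for the iteration holds only for weights truncated at the origin. The
  -- resulting bound is independent of `n`, and monotone convergence removes the truncation.
  have htrunc : ∀ n : ℕ, pairIntegral μ (largePairs V f) (truncWeight (dim + q) ((n : ℝ≥0∞) + 1)⁻¹)
      ≤ 2 ^ (dim + 1) * geomConst (q - 1)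
        * pairIntegral μ (middlePairs V f) (normWeight (dim + q)) := by
    intro n
    have hη : ((n : ℝ≥0∞) + 1)⁻¹ ≠ 0 := by simp
    refine (pairIntegral_le_dyadicWeight (b := b) (ψ := normWeight (dim + 1)) hK hb hK
      (measurable_truncWeight _ _) (measurable_normWeight _) (fun x h ↦ ?_) (κ := 1)
      (C := (((n : ℝ≥0∞) + 1)⁻¹) ^ (1 - q)) (by simp) ?_ (fun x y ↦ by simp) hfin
      (truncWeight_dilation_le hq hη) (fun h hh ↦ ?_) (fun x y ↦ ?_)).trans ?_
    · simpa [hb_def] using largePairs_le_midpoint hV htri x h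
    · refine ENNReal.rpow_ne_top_of_ne_zero hη (by simp)
    · refine ne_top_of_le_ne_top ?_ (dyadicWeight_truncWeight_le q _ h)
      refine ENNReal.mul_ne_top (geomConst_ne_top (by linarith)) ?_
      exact ENNReal.rpow_ne_top_of_ne_zero (by simpa using hh) (by simp)
    · exact ((largePairs_le_one V f x y).trans_lt ENNReal.one_lt_top).ne
    · calc _ ≤ pairIntegral μ b (fun h ↦ geomConst (q - 1) * normWeight (dim + q) h) :=
            pairIntegral_mono fun x h ↦ by gcongr; exact dyadicWeight_truncWeight_le q _ h
        _ = geomConst (q - 1) * pairIntegral μ b (normWeight (dim + q)) :=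
            pairIntegral_const_mul_right (geomConst_ne_top (by linarith))
        _ ≤ _ := by
            refine (mul_le_mul_right hbJ _).trans_eq ?_
            ring
  have hlim : Filter.Tendsto (fun n : ℕ ↦ pairIntegral μ (largePairs V f)
      (truncWeight (dim + q) ((n : ℝ≥0∞) + 1)⁻¹)) Filter.atTop
      (nhds (pairIntegral μ (largePairs V f) (normWeight (dim + q)))) := by
    have heq : ∀ n : ℕ, _ := fun n ↦ pairIntegral_eq_prod (μ := μ) hK
      (measurable_truncWeight (dim + q) ((n : ℝ≥0∞) + 1)⁻¹)
    simp_rw [heq, pairIntegral_eq_prod hK (measurable_normWeight _)]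
    have h0 : ∀ᵐ z : E × E ∂(μ.prod μ), z.2 ≠ 0 := by
      have : ∀ᵐ h : E ∂μ, h ≠ 0 := by simp [ae_iff, measure_singleton]
      exact Measure.quasiMeasurePreserving_snd.ae this
    refine lintegral_tendsto_of_tendsto_of_monotone
      (fun n ↦ (measurable_pair_mul hK (measurable_truncWeight _ _)).aemeasurable) ?_ ?_
    · refine ae_of_all _ fun z n k hnk ↦ ?_
      refine mul_le_mul_right ?_ _
      unfold truncWeight
      split_ifs with h1 h2
      · exact le_rfl
      · refine absurd (le_trans ?_ h1) h2
        gcongr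
      · simp
      · simp
    · filter_upwards [h0] with z hz
      refine tendsto_const_nhds.congr' ?_
      have hz' : ‖z.2‖ₑ ≠ 0 := by simpa using hz
      obtain ⟨n, hn⟩ := ENNReal.exists_inv_nat_lt hz'
      filter_upwards [Filter.eventually_ge_atTop n] with k hk
      have : ((k : ℝ≥0∞) + 1)⁻¹ ≤ ‖z.2‖ₑ := by
        refine le_trans ?_ hn.le
        rw [ENNReal.inv_le_inv]
        exact (Nat.cast_le.2 hk).trans le_self_add
      simp [truncWeight, this]
  exact le_of_tendsto' hlim htrunc

end LargePairs

end FractionalLifting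

namespace FractionalLifting

/-! ### A Poincaré inequality for the large values -/

section Poincare

variable {E : Type*} [NormedAddCommGroup E] [NormedSpace ℝ E] [FiniteDimensional ℝ E]
  [MeasurableSpace E] [BorelSpace E] {μ : Measure E} [μ.IsAddHaarMeasure]

local notation "dim" => Module.finrank ℝ E

lemma largePairs_mono {B V : Set E} (hBV : B ⊆ V) (f : E → E → ℝ≥0∞) (x y : E) :
    largePairs B f x y ≤ largePairs V f x y := by
  unfold largePairs
  split_ifs with h1 h2
  · exact le_rfl
  · exact absurd ⟨hBV h1.1, hBV h1.2.1, h1.2.2⟩ h2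
  · simp
  · simp

variable (μ) in
/-- The analogue of the modulus of the gradient: the integral of `1 / |z - y| ^ (d + β)` over the
`y` such that `f z y` is at least `1`. -/
noncomputable def largeDensity (V : Set E) (f : E → E → ℝ≥0∞) (β : ℝ) (z : E) : ℝ≥0∞ :=
  ∫⁻ h, largePairs V f z (z + h) * normWeight (dim + β) h ∂μ

lemma measurable_largeDensity {V : Set E} (hV : MeasurableSet V) {f : E → E → ℝ≥0∞}
    (hf : Measurable (Function.uncurry f)) (β : ℝ) : Measurable (largeDensity μ V f β) :=
  Measurable.lintegral_prod_right
    (measurable_pair_mul (measurable_largePairs hV hf) (measurable_normWeight _))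

lemma lintegral_largeDensity (V : Set E) (f : E → E → ℝ≥0∞) (β : ℝ) :
    ∫⁻ z, largeDensity μ V f β z ∂μ = pairIntegral μ (largePairs V f) (normWeight (dim + β)) := rfl

open Classical in
/-- A Poincaré inequality: the large values of a bounded pseudometric on a convex set. -/
theorem lintegral_large_le [Nontrivial E] {B V : Set E} (hBV : B ⊆ V) (hB : Convex ℝ B)
    (hBm : MeasurableSet B)
    {f : E → E → ℝ≥0∞} (hf : Measurable (Function.uncurry f))
    (htri : ∀ x y z, f x z ≤ f x y + f y z) {κ : ℝ≥0∞} (hκ : κ ≠ ⊤) (hfκ : ∀ x y, f x y ≤ κ)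
    (hfin : pairIntegral μ (largePairs V f) (normWeight (dim + 1)) ≠ ⊤)
    {ρ : ℝ≥0∞} (hρ : ρ ≠ ⊤) (hBρ : ∀ x ∈ B, ∀ y ∈ B, edist x y < ρ) :
    ∫⁻ x in B, ∫⁻ y in B, (if 1 ≤ f x y then f x y else 0) ∂μ ∂μ
      ≤ 2 * geomConst (dim + 1) * ρ ^ (dim + 1) * ∫⁻ z in B, largeDensity μ V f 1 z ∂μ := by
  have hK := measurable_largePairs hBm hf
  have hdim : (0 : ℝ) < dim + 1 := by positivity
  have hgc := geomConst_ne_top hdim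
  set a : E → E → ℝ≥0∞ := fun x y ↦ largePairs B f x y * f x y with ha_def
  have ha : Measurable (Function.uncurry a) := hK.mul hf
  -- All increments between points of `B` have norm less than `ρ`, so this cutoff is invisible on
  -- `B`; it stops the subdivision sum after finitely many scales for each `h ≠ 0`.
  set φ : E → ℝ≥0∞ := fun h ↦ if ‖h‖ₑ < ρ then 1 else 0 with hφ_def
  have hφ : Measurable φ :=
    Measurable.ite (measurableSet_lt measurable_enorm measurable_const) measurable_const
      measurable_const
  have hfinB : pairIntegral μ (largePairs B f) (normWeight (dim + 1)) ≠ ⊤ :=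
    ne_top_of_le_ne_top hfin (pairIntegral_mono fun x h ↦ by
      gcongr; exact largePairs_mono hBV _ _ _)
  have hle_a : ∀ {x y}, x ∈ B → y ∈ B → f x y ≤ a x y + 1 := by
    intro x y hx hy
    by_cases h : 1 ≤ f x y
    · simp [ha_def, largePairs, hx, hy, h]
    · exact (not_le.1 h).le.trans le_add_self
  -- A half on which `f` is less than 1 is dropped at the price of at most 1. The price is paid only
  -- at pairs where `f` itself is at least 1, which gives `2 * largePairs`.
  have hmid : ∀ x h, a x (x + h) ≤ 2 * largePairs B f x (x + h)
      + (a x (x + (1 / 2 : ℝ) • h) + a (x + (1 / 2 : ℝ) • h) (x + h)) := by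
    intro x h
    by_cases hh : x ∈ B ∧ x + h ∈ B ∧ 1 ≤ f x (x + h)
    · have hz := half_mem_of_convex hB hh.1 hh.2.1
      have h1 : largePairs B f x (x + h) = 1 := by simp only [largePairs, if_pos hh]
      calc a x (x + h) = f x (x + h) := by simp [ha_def, h1]
        _ ≤ f x (x + (1 / 2 : ℝ) • h) + f (x + (1 / 2 : ℝ) • h) (x + h) := htri _ _ _
        _ ≤ (a x (x + (1 / 2 : ℝ) • h) + 1) + (a (x + (1 / 2 : ℝ) • h) (x + h) + 1) :=
            add_le_add (hle_a hh.1 hz) (hle_a hz hh.2.1)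
        _ = _ := by rw [h1]; ring
    · simp [ha_def, largePairs, hh]
  -- Only the scales with `2 ^ l < ρ / ‖h‖` contribute, so the sum is comparable to `(ρ / ‖h‖) ^
  -- (dim + 1)`, the kernel defining `largeDensity` with `β = 1`.
  have hdw : ∀ h : E, h ≠ 0 → dyadicWeight φ h
      ≤ geomConst (dim + 1) * ρ ^ (dim + 1) * normWeight (dim + 1) h := by
    intro h hh
    have hn : ‖h‖ₑ ≠ 0 := by simpa using hh
    have := tsum_dyadic_lt_le hdim (ρ / ‖h‖ₑ)
    calc dyadicWeight φ h = ∑' l : ℕ,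
          (if (2 : ℝ≥0∞) ^ l < ρ / ‖h‖ₑ then ((2 : ℝ≥0∞) ^ l) ^ ((dim : ℝ) + 1) else 0) := by
          refine tsum_congr fun l ↦ ?_
          simp only [hφ_def, enorm_two_pow_smul]
          simp only [ENNReal.lt_div_iff_mul_lt (Or.inl hn) (Or.inl enorm_ne_top)]
          rw [two_pow_pow_eq_rpow]
          split_ifs <;> simp
      _ ≤ _ := this
      _ = _ := by
          rw [ENNReal.div_rpow_of_nonneg _ _ hdim.le, div_eq_mul_inv, ← ENNReal.rpow_neg,
            normWeight, mul_assoc]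
          congr 2
          rw [← ENNReal.rpow_natCast]; push_cast; rfl
  -- The `+ 1` keeps the constant nonzero, which makes the bound hold also at `h = 0`, where the
  -- weight on the right is infinite.
  have hterm : ∀ (l : ℕ) (h : E), (2 ^ (dim + 1)) ^ l * φ ((2 : ℝ) ^ l • h)
      ≤ (geomConst (dim + 1) * ρ ^ (dim + 1) + 1) * normWeight (dim + 1) h := by
    intro l h
    by_cases hh : h = 0
    · have : normWeight ((dim : ℝ) + 1) h = ⊤ := by
        simp [normWeight, hh, ENNReal.zero_rpow_of_neg (by linarith : -1 + -(dim : ℝ) < 0)]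
      rw [this, ENNReal.mul_top (by simp)]
      exact le_top
    · refine (ENNReal.le_tsum (f := fun l : ℕ ↦ (2 ^ (dim + 1)) ^ l * φ ((2 : ℝ) ^ l • h)) l).trans
        ((hdw h hh).trans ?_)
      gcongr
      exact le_self_add
  have hCne : geomConst (dim + 1) * ρ ^ (dim + 1) ≠ ⊤ :=
    ENNReal.mul_ne_top hgc (ENNReal.pow_ne_top hρ)
  have key := pairIntegral_le_dyadicWeight (μ := μ) (b := fun x y ↦ 2 * largePairs B f x y)
    (ψ := normWeight (dim + 1)) ha (hK.const_mul 2) hK hφ (measurable_normWeight _) hmid hκ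
    (C := geomConst (dim + 1) * ρ ^ (dim + 1) + 1) (ENNReal.add_ne_top.2 ⟨hCne, by simp⟩)
    (fun x y ↦ by rw [mul_comm κ]; exact mul_le_mul_right (hfκ x y) _) hfinB hterm
    (fun h hh ↦ ne_top_of_le_ne_top (ENNReal.mul_ne_top hCne
      (ENNReal.rpow_ne_top_of_ne_zero (by simpa using hh) (by simp))) (hdw h hh))
    (fun x y ↦ ENNReal.mul_ne_top ((largePairs_le_one B f x y).trans_lt ENNReal.one_lt_top).ne
      (ne_top_of_le_ne_top hκ (hfκ x y)))
  have hleft : ∫⁻ x in B, ∫⁻ y in B, (if 1 ≤ f x y then f x y else 0) ∂μ ∂μ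
      ≤ pairIntegral μ a φ := by
    rw [← lintegral_indicator hBm]
    refine lintegral_mono fun x ↦ ?_
    by_cases hx : x ∈ B
    · rw [indicator_of_mem hx, ← lintegral_indicator hBm, ← lintegral_add_left_eq_self _ x]
      refine lintegral_mono fun h ↦ ?_
      by_cases hy : x + h ∈ B
      · rw [indicator_of_mem hy]
        have : ‖h‖ₑ < ρ := by simpa [edist_eq_enorm_sub] using hBρ (x + h) hy x hx
        simp only [ha_def, hφ_def, largePairs, hx, hy, this, true_and, if_true, mul_one]
        split_ifs <;> simp
      · rw [indicator_of_notMem hy]; simp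
    · rw [indicator_of_notMem hx]; simp
  refine hleft.trans (key.trans ?_)
  have h0 : ∀ᵐ h : E ∂μ, h ≠ 0 := by simp [ae_iff, measure_singleton]
  calc _ ≤ pairIntegral μ (fun x y ↦ 2 * largePairs B f x y)
          (fun h ↦ geomConst (dim + 1) * ρ ^ (dim + 1) * normWeight (dim + 1) h) := by
        refine pairIntegral_mono_ae fun x ↦ ?_
        filter_upwards [h0] with h hh
        exact mul_le_mul_right (hdw h hh) _
    _ = 2 * geomConst (dim + 1) * ρ ^ (dim + 1)
          * pairIntegral μ (largePairs B f) (normWeight (dim + 1)) := by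
        rw [pairIntegral_const_mul_right hCne, pairIntegral_const_mul_left (by simp)]
        ring
    _ ≤ _ := by
        refine mul_le_mul_right ?_ _
        rw [← lintegral_indicator hBm]
        refine lintegral_mono fun x ↦ ?_
        by_cases hx : x ∈ B
        · rw [indicator_of_mem hx]
          exact lintegral_mono fun h ↦ mul_le_mul_left (largePairs_mono hBV _ _ _) _
        · simp [largePairs, hx]

end Poincare

/-! ### The density of large pairs belongs to `L ^ q` -/

section Density

variable {E : Type*} [NormedAddCommGroup E] [NormedSpace ℝ E] [FiniteDimensional ℝ E]
  [MeasurableSpace E] [BorelSpace E] {μ : Measure E} [μ.IsAddHaarMeasure]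

local notation "dim" => Module.finrank ℝ E

variable (μ) in
/-- The integral of `1 / |h| ^ (d + 1)` outside of the unit ball. -/
noncomputable def tailConst : ℝ≥0∞ := ∫⁻ h : E, truncWeight (dim + 1) 1 h ∂μ

lemma tailConst_ne_top : tailConst (E := E) μ ≠ ⊤ := by
  have h := finite_integral_one_add_norm (E := E) (μ := μ) (r := dim + 1) (by linarith)
  have hd : (0 : ℝ) < dim + 1 := by positivity
  refine ne_top_of_le_ne_top (ENNReal.mul_ne_top (ENNReal.ofReal_ne_top (r := 2 ^ ((dim : ℝ) + 1)))
    h.ne) ?_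
  rw [← lintegral_const_mul' _ _ ENNReal.ofReal_ne_top]
  refine lintegral_mono fun x ↦ ?_
  unfold truncWeight normWeight
  split_ifs with hx
  · have hx' : 1 ≤ ‖x‖ := by
      rwa [← ofReal_norm, ENNReal.one_le_ofReal] at hx
    rw [← ENNReal.ofReal_mul (by positivity), ← ofReal_norm,
      ENNReal.ofReal_rpow_of_pos (by linarith)]
    refine ENNReal.ofReal_le_ofReal ?_
    have h2 : (2 * ‖x‖) ^ (-((dim : ℝ) + 1)) ≤ (1 + ‖x‖) ^ (-((dim : ℝ) + 1)) :=
      Real.rpow_le_rpow_of_nonpos (by positivity) (by linarith) (by linarith)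
    calc ‖x‖ ^ (-((dim : ℝ) + 1)) = 2 ^ ((dim : ℝ) + 1) * (2 * ‖x‖) ^ (-((dim : ℝ) + 1)) := by
          rw [Real.mul_rpow (by norm_num) (by positivity), ← mul_assoc,
            ← Real.rpow_add (by norm_num)]
          simp
      _ ≤ _ := by gcongr
  · simp

lemma lintegral_truncWeight {ρ : ℝ≥0∞} (h0 : ρ ≠ 0) (ht : ρ ≠ ⊤) :
    ∫⁻ h : E, truncWeight (dim + 1) ρ h ∂μ = ρ⁻¹ * tailConst (E := E) μ := by
  have hr : 0 < ρ.toReal := ENNReal.toReal_pos h0 ht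
  have he : ENNReal.ofReal ρ.toReal = ρ := ENNReal.ofReal_toReal ht
  have hw : ∀ h : E, truncWeight ((dim : ℝ) + 1) ρ (ρ.toReal • h)
      = ρ ^ (-((dim : ℝ) + 1)) * truncWeight (dim + 1) 1 h := by
    intro h
    have h1 : ‖ρ.toReal • h‖ₑ = ρ * ‖h‖ₑ := by
      rw [enorm_smul, Real.enorm_eq_ofReal hr.le, he]
    have h2 : ρ ≤ ρ * ‖h‖ₑ ↔ 1 ≤ ‖h‖ₑ := by
      conv_lhs => rw [← mul_one ρ, mul_assoc, one_mul]
      exact ENNReal.mul_le_mul_iff_right h0 ht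
    simp only [truncWeight, normWeight, h1, h2]
    split_ifs
    · rw [ENNReal.mul_rpow_of_ne_top ht (by simp)]
    · simp
  rw [lintegral_comp_smul_of_pos μ _ hr, he]
  simp_rw [hw]
  rw [lintegral_const_mul' _ _ (ENNReal.rpow_ne_top_of_ne_zero h0 ht), ← mul_assoc, tailConst]
  congr 1
  rw [← ENNReal.rpow_natCast, ← ENNReal.rpow_add _ _ h0 ht, ← ENNReal.rpow_neg_one]
  congr 1; ring

/-- The integrand being an indicator function, no Hölder inequality is needed: increments with `‖h‖
≥ ρ` contribute at most `tailConst / ρ`, shorter ones at most `ρ ^ (q - 1)` times the density of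
exponent `q`, and `ρ` is free. -/
lemma largeDensity_rpow_le [Nontrivial E] {V : Set E} (hV : MeasurableSet V) {f : E → E → ℝ≥0∞}
    (hf : Measurable (Function.uncurry f)) {q : ℝ} (hq : 1 < q) (z : E) :
    largeDensity μ V f 1 z ^ q ≤ (tailConst (E := E) μ + 1) ^ q * largeDensity μ V f q z := by
  have hm : Measurable fun h ↦ largePairs V f z (z + h) :=
    measurable_pair_right (measurable_largePairs hV hf) z
  have hae : ∀ᵐ h : E ∂μ, h ≠ 0 := by simp [ae_iff, measure_singleton]
  have hq0 : 0 < q := by linarith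
  set H := largeDensity μ V f q z with hH
  rcases eq_or_ne H ⊤ with hT | hT
  · rw [hT, ENNReal.mul_top]
    · exact le_top
    · exact (ENNReal.rpow_pos (by positivity) (ENNReal.add_ne_top.2
        ⟨tailConst_ne_top, by simp⟩)).ne'
  rcases eq_or_ne H 0 with h0 | h0
  · have h1 : largeDensity μ V f 1 z = 0 := by
      have hm' : ∀ β : ℝ, Measurable fun h ↦ largePairs V f z (z + h) * normWeight (dim + β) h :=
        fun β ↦ hm.mul (measurable_normWeight _)
      rw [hH, largeDensity, lintegral_eq_zero_iff (hm' _)] at h0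
      rw [largeDensity, lintegral_eq_zero_iff (hm' _)]
      filter_upwards [h0] with h hh
      have : normWeight (dim + q) h ≠ 0 := by
        rw [normWeight, Ne, ENNReal.rpow_eq_zero_iff]
        simp
        intro; linarith [(Nat.cast_nonneg dim : (0:ℝ) ≤ dim)]
      have h3 : largePairs V f z (z + h) = 0 := by
        simpa [this] using hh
      simp [h3]
    rw [h1, ENNReal.zero_rpow_of_pos hq0]
    exact zero_le
  have key : ∀ ρ : ℝ≥0∞, ρ ≠ 0 → ρ ≠ ⊤ →
      largeDensity μ V f 1 z ≤ ρ⁻¹ * tailConst (E := E) μ + ρ ^ (q - 1) * H := by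
    intro ρ hρ0 hρt
    rw [← lintegral_truncWeight hρ0 hρt, hH, largeDensity, largeDensity,
      ← lintegral_const_mul' _ _ (ENNReal.rpow_ne_top_of_nonneg (by linarith) hρt),
      ← lintegral_add_left (measurable_truncWeight _ _)]
    refine lintegral_mono_ae ?_
    filter_upwards [hae] with h hh
    by_cases hρh : ρ ≤ ‖h‖ₑ
    · refine le_add_right ?_
      rw [truncWeight, if_pos hρh]
      exact mul_le_of_le_one_left' (largePairs_le_one _ _ _ _)
    · refine le_add_left ?_
      have hn : ‖h‖ₑ ≠ 0 := by simpa using hh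
      have : normWeight (dim + 1) h = ‖h‖ₑ ^ (q - 1) * normWeight (dim + q) h := by
        rw [normWeight, normWeight, ← ENNReal.rpow_add _ _ hn (by simp)]
        congr 1; ring
      rw [this, mul_left_comm]
      refine mul_le_mul_left ?_ _
      exact ENNReal.rpow_le_rpow (not_le.1 hρh).le (by linarith)
  -- This `ρ` balances the two contributions: both are then multiples of `H ^ (1 / q)`.
  have hk := key (H ^ (-(1 / q))) (by
    rw [Ne, ENNReal.rpow_eq_zero_iff]; simp [h0, hT]) (ENNReal.rpow_ne_top_of_ne_zero h0 hT)
  have h2 : largeDensity μ V f 1 z ≤ (tailConst (E := E) μ + 1) * H ^ (1 / q) := by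
    refine hk.trans_eq ?_
    rw [← ENNReal.rpow_neg, neg_neg, ← ENNReal.rpow_mul]
    conv_lhs => enter [2, 2]; rw [← ENNReal.rpow_one H]
    rw [← ENNReal.rpow_add _ _ h0 hT]
    have : -(1 / q) * (q - 1) + 1 = 1 / q := by field_simp; ring
    rw [this]; ring
  calc _ ≤ ((tailConst (E := E) μ + 1) * H ^ (1 / q)) ^ q := ENNReal.rpow_le_rpow h2 hq0.le
    _ = _ := by
      rw [ENNReal.mul_rpow_of_nonneg _ _ hq0.le, ← ENNReal.rpow_mul, one_div,
        inv_mul_cancel₀ hq0.ne', ENNReal.rpow_one]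

lemma lintegral_largeDensity_rpow_le [Nontrivial E] {V : Set E} (hV : MeasurableSet V)
    {f : E → E → ℝ≥0∞} (hf : Measurable (Function.uncurry f)) {q : ℝ} (hq : 1 < q) :
    ∫⁻ z, largeDensity μ V f 1 z ^ q ∂μ ≤ (tailConst (E := E) μ + 1) ^ q
      * pairIntegral μ (largePairs V f) (normWeight (dim + q)) := by
  rw [← lintegral_largeDensity, ← lintegral_const_mul _ (measurable_largeDensity hV hf q)]
  exact lintegral_mono fun z ↦ largeDensity_rpow_le hV hf hq z

end Density

end FractionalLifting

namespace FractionalLifting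

/-! ### Averages over dyadic balls -/

section Averages

variable {E : Type*} [NormedAddCommGroup E] [NormedSpace ℝ E] [FiniteDimensional ℝ E]
  [MeasurableSpace E] [BorelSpace E] {μ : Measure E} [μ.IsAddHaarMeasure]

local notation "dim" => Module.finrank ℝ E

variable (E) in
/-- The open ball of radius `2 ^ (-j)` centered at the origin. -/
def dyadicBall (j : ℕ) : Set E := {h | 2 ^ j * ‖h‖ₑ < 1}

lemma measurableSet_dyadicBall (j : ℕ) : MeasurableSet (dyadicBall E j) :=
  measurableSet_lt (measurable_enorm.const_mul _) measurable_const

lemma dyadicBall_eq_ball (j : ℕ) : dyadicBall E j = Metric.ball 0 ((2 : ℝ) ^ j)⁻¹ := by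
  ext h
  have h2 : (2 : ℝ≥0∞) ^ j * ‖h‖ₑ = ENNReal.ofReal (2 ^ j * ‖h‖) := by
    rw [ENNReal.ofReal_mul (by positivity), ENNReal.ofReal_pow (by norm_num), ofReal_norm]
    simp
  rw [mem_ball_zero_iff, dyadicBall, mem_ofPred_eq, h2, ENNReal.ofReal_lt_one,
    ← one_div, lt_div_iff₀ (by positivity), mul_comm]

lemma dyadicBall_zero : dyadicBall E 0 = Metric.ball 0 1 := by
  simp [dyadicBall_eq_ball]

lemma dyadicBall_succ_subset (j : ℕ) : dyadicBall E (j + 1) ⊆ dyadicBall E j := by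
  intro h (hh : 2 ^ (j + 1) * ‖h‖ₑ < 1)
  change 2 ^ j * ‖h‖ₑ < 1
  refine lt_of_le_of_lt ?_ hh
  gcongr
  · norm_num
  · omega

variable (μ) in
/-- The measure of the unit ball. -/
noncomputable def ballVolume : ℝ≥0∞ := μ (Metric.ball 0 1)

lemma ballVolume_ne_zero : ballVolume (E := E) μ ≠ 0 := (Metric.measure_ball_pos μ 0 one_pos).ne'

lemma ballVolume_ne_top : ballVolume (E := E) μ ≠ ⊤ := measure_ball_lt_top.ne

lemma measure_dyadicBall (j : ℕ) : (2 ^ j) ^ dim * μ (dyadicBall E j) = ballVolume (E := E) μ := by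
  have h := lintegral_comp_smul_of_pos μ ((dyadicBall E 0).indicator 1) (r := 2 ^ j) (by positivity)
  have h2 : ∀ x : E, (dyadicBall E 0).indicator (1 : E → ℝ≥0∞) ((2 : ℝ) ^ j • x)
      = (dyadicBall E j).indicator 1 x := by
    intro x
    have hiff : (2 : ℝ) ^ j • x ∈ dyadicBall E 0 ↔ x ∈ dyadicBall E j := by
      simp only [dyadicBall, mem_ofPred_eq, enorm_two_pow_smul, pow_zero, one_mul]
    by_cases hx : x ∈ dyadicBall E j
    · rw [indicator_of_mem hx, indicator_of_mem (hiff.2 hx)]; rfl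
    · rw [indicator_of_notMem hx, indicator_of_notMem (mt hiff.1 hx)]
  simp_rw [h2] at h
  rw [lintegral_indicator_one (measurableSet_dyadicBall _),
    lintegral_indicator_one (measurableSet_dyadicBall _), ENNReal.ofReal_pow (by norm_num),
    ENNReal.ofReal_ofNat, dyadicBall_zero] at h
  exact h.symm

variable (μ) in
/-- The uniform probability measure on the ball of radius `2 ^ (-j)` centered at the origin. -/
noncomputable def ballProb (j : ℕ) : Measure E :=
  ((ballVolume (E := E) μ)⁻¹ * (2 ^ j) ^ dim) • μ.restrict (dyadicBall E j)

instance (j : ℕ) : IsProbabilityMeasure (ballProb (E := E) μ j) := by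
  constructor
  rw [ballProb, Measure.smul_apply, Measure.restrict_apply_univ, smul_eq_mul, mul_assoc,
    measure_dyadicBall, ENNReal.inv_mul_cancel ballVolume_ne_zero ballVolume_ne_top]

lemma lintegral_ballProb (j : ℕ) (g : E → ℝ≥0∞) :
    ∫⁻ h, g h ∂ballProb μ j = (ballVolume (E := E) μ)⁻¹ * (2 ^ j) ^ dim
      * ∫⁻ h in dyadicBall E j, g h ∂μ := by
  rw [ballProb, lintegral_smul_measure, smul_eq_mul]

lemma lintegral_ballProb_mono_fun {j : ℕ} {g g' : E → ℝ≥0∞}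
    (h : ∀ x ∈ dyadicBall E j, g x ≤ g' x) :
    ∫⁻ h, g h ∂ballProb μ j ≤ ∫⁻ h, g' h ∂ballProb μ j := by
  rw [lintegral_ballProb, lintegral_ballProb]
  exact mul_le_mul_right (setLIntegral_mono' (measurableSet_dyadicBall _) h) _

lemma lintegral_ballProb_succ_le (j : ℕ) (g : E → ℝ≥0∞) :
    ∫⁻ h, g h ∂ballProb μ (j + 1) ≤ 2 ^ dim * ∫⁻ h, g h ∂ballProb μ j := by
  rw [lintegral_ballProb, lintegral_ballProb]
  calc _ = 2 ^ dim * ((ballVolume (E := E) μ)⁻¹ * (2 ^ j) ^ dim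
          * ∫⁻ h in dyadicBall E (j + 1), g h ∂μ) := by rw [pow_succ, mul_pow]; ring
    _ ≤ _ := by
        gcongr
        exact dyadicBall_succ_subset j

lemma lintegral_lintegral_ballProb (j : ℕ) {g : E → ℝ≥0∞} (hg : Measurable g) :
    ∫⁻ x, ∫⁻ h, g (x + h) ∂ballProb μ j ∂μ = ∫⁻ x, g x ∂μ := by
  have hm : Measurable (Function.uncurry fun x h : E ↦ g (x + h)) :=
    hg.comp (measurable_fst.add measurable_snd)
  rw [lintegral_lintegral_swap hm.aemeasurable]
  simp_rw [lintegral_add_right_eq_self (μ := μ) g]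
  simp

lemma measurable_lintegral_ballProb (j : ℕ) {g : E → ℝ≥0∞} (hg : Measurable g) :
    Measurable fun x ↦ ∫⁻ h, g (x + h) ∂ballProb μ j := by
  have hm : Measurable (Function.uncurry fun x h : E ↦ g (x + h)) :=
    hg.comp (measurable_fst.add measurable_snd)
  exact hm.lintegral_prod_right

/-- Jensen's inequality for `t ↦ t ^ p`, read off from the monotonicity of `L ^ p` norms on a
probability space. -/
lemma rpow_lintegral_le {α : Type*} [MeasurableSpace α] {ν : Measure α} [IsProbabilityMeasure ν]
    {g : α → ℝ≥0∞} (hg : AEMeasurable g ν) {p : ℝ} (hp : 1 ≤ p) :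
    (∫⁻ x, g x ∂ν) ^ p ≤ ∫⁻ x, g x ^ p ∂ν := by
  have hp0 : 0 < p := by linarith
  have h := eLpNorm'_le_eLpNorm'_of_exponent_le (f := g) (μ := ν) one_pos hp
    hg.aestronglyMeasurable
  simp only [eLpNorm', enorm_eq_self, ENNReal.rpow_one, one_div, inv_one] at h
  calc _ ≤ ((∫⁻ x, g x ^ p ∂ν) ^ p⁻¹) ^ p := ENNReal.rpow_le_rpow h hp0.le
    _ = _ := by rw [← ENNReal.rpow_mul, inv_mul_cancel₀ hp0.ne', ENNReal.rpow_one]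

lemma lintegral_rpow_ballProb_le (j : ℕ) {g : E → ℝ≥0∞} (hg : Measurable g) {p : ℝ} (hp : 1 ≤ p) :
    ∫⁻ x, (∫⁻ h, g (x + h) ∂ballProb μ j) ^ p ∂μ ≤ ∫⁻ x, g x ^ p ∂μ := by
  rw [← lintegral_lintegral_ballProb j (hg.pow_const p)]
  exact lintegral_mono fun x ↦
    rpow_lintegral_le (hg.comp (measurable_const_add x)).aemeasurable hp

end Averages

/-! ### Sums over scales and a discrete Hardy inequality -/

section Sums

/-- Split at `2 ^ j = τ`. Below `τ` the terms are `2 ^ (j q)`, increasing; above it they are `τ ^ p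
* 2 ^ (-j (p - q))`, decreasing. Both geometric sums are of order `τ ^ q`. -/
lemma tsum_dyadic_min_le {p q : ℝ} (hq : 0 < q) (hqp : q < p) (τ : ℝ≥0∞) :
    ∑' j : ℕ, ((2 : ℝ≥0∞) ^ j) ^ (q - p) * (min τ (2 ^ j)) ^ p
      ≤ (geomConst (p - q) + geomConst q) * τ ^ q := by
  have hp : 0 < p := hq.trans hqp
  rcases eq_or_ne τ 0 with h0 | h0
  · simp [h0, ENNReal.zero_rpow_of_pos hp]
  rcases eq_or_ne τ ⊤ with hT | hT
  · rw [hT, ENNReal.top_rpow_of_pos hq, ENNReal.mul_top]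
    · exact le_top
    · have : geomConst q ≠ 0 := by rw [geomConst_eq]; simp
      exact fun h ↦ this (by simpa using (add_eq_zero.1 h).2)
  have h1 := tsum_dyadic_ge_le (sub_pos.2 hqp) τ
  have h2 := tsum_dyadic_lt_le hq τ
  calc _ ≤ ∑' j : ℕ, (τ ^ p * (if τ ≤ (2 : ℝ≥0∞) ^ j then ((2 : ℝ≥0∞) ^ j) ^ (-(p - q)) else 0)
          + (if (2 : ℝ≥0∞) ^ j < τ then ((2 : ℝ≥0∞) ^ j) ^ q else 0)) := by
        refine ENNReal.tsum_le_tsum fun j ↦ ?_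
        rcases le_or_gt τ (2 ^ j) with h | h
        · rw [min_eq_left h, if_pos h, if_neg (not_lt.2 h), add_zero, mul_comm, neg_sub]
        · rw [min_eq_right h.le, if_neg (not_le.2 h), if_pos h, mul_zero, zero_add,
            ← two_pow_rpow_add, sub_add_cancel]
    _ ≤ τ ^ p * (geomConst (p - q) * τ ^ (-(p - q))) + geomConst q * τ ^ q := by
        rw [ENNReal.tsum_add, ENNReal.tsum_mul_left]
        gcongr
    _ = _ := by
        rw [mul_left_comm, ← ENNReal.rpow_add _ _ h0 hT, add_mul]
        congr 3
        ring

lemma tsum_dyadic_indicator_le {q : ℝ} (hq : 1 < q) (τ : ℝ≥0∞) :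
    ∑' j : ℕ, ((2 : ℝ≥0∞) ^ j) ^ (q - 1) * (if (2 : ℝ≥0∞) ^ j < τ then τ else 0)
      ≤ geomConst (q - 1) * τ ^ q := by
  have h2 := tsum_dyadic_lt_le (sub_pos.2 hq) τ
  calc _ = (∑' j : ℕ, (if (2 : ℝ≥0∞) ^ j < τ then ((2 : ℝ≥0∞) ^ j) ^ (q - 1) else 0)) * τ := by
        rw [← ENNReal.tsum_mul_right]
        refine tsum_congr fun j ↦ ?_
        split_ifs <;> simp
    _ ≤ geomConst (q - 1) * τ ^ (q - 1) * τ := by gcongr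
    _ = _ := by
        rw [mul_assoc]
        congr 1
        nth_rw 2 [← ENNReal.rpow_one τ]
        rw [← ENNReal.rpow_add_of_nonneg _ _ (by linarith) zero_le_one, sub_add_cancel]

/-- Convexity with weights `t` and `1 - t`, where `t ^ (1 - p) = 2 ^ q`. The coefficient of `a ^ p`
can be taken arbitrarily close to 1, which the absorption in the Hardy inequality requires. -/
lemma exists_rpow_add_le {p : ℝ} (hp : 1 < p) {q : ℝ} (hq : 0 < q) :
    ∃ C : ℝ≥0∞, C ≠ ⊤ ∧ ∀ a b : ℝ≥0∞, (a + b) ^ p ≤ 2 ^ q * a ^ p + C * b ^ p := by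
  have hp1 : 0 < p - 1 := by linarith
  set t : ℝ≥0∞ := 2 ^ (-(q / (p - 1))) with ht
  have ht1 : t < 1 := two_rpow_neg_lt_one (by positivity)
  have ht0 : t ≠ 0 := by rw [ht, Ne, ENNReal.rpow_eq_zero_iff]; simp
  have htt : t ≠ ⊤ := (ht1.trans ENNReal.one_lt_top).ne
  set u := 1 - t
  have hu0 : u ≠ 0 := (tsub_pos_of_lt ht1).ne'
  have hut : u ≠ ⊤ := ENNReal.sub_ne_top (by simp)
  have htu : t + u = 1 := add_tsub_cancel_of_le ht1.le
  have hw : ∀ w a : ℝ≥0∞, w ≠ 0 → w ≠ ⊤ → w * (w⁻¹ * a) ^ p = w ^ (1 - p) * a ^ p := by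
    intro w a h0 hT
    rw [ENNReal.mul_rpow_of_nonneg _ _ (by linarith), ← ENNReal.rpow_neg_one, ← ENNReal.rpow_mul,
      ← mul_assoc]
    nth_rw 1 [← ENNReal.rpow_one w]
    rw [← ENNReal.rpow_add _ _ h0 hT]
    congr 2; ring
  refine ⟨u ^ (1 - p), ENNReal.rpow_ne_top_of_ne_zero hu0 hut, fun a b ↦ ?_⟩
  have h := ENNReal.rpow_arith_mean_le_arith_mean2_rpow t u (t⁻¹ * a) (u⁻¹ * b) htu hp.le
  rw [hw t a ht0 htt, hw u b hu0 hut, ← mul_assoc, ← mul_assoc, ENNReal.mul_inv_cancel ht0 htt,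
    ENNReal.mul_inv_cancel hu0 hut, one_mul, one_mul] at h
  convert h using 3
  rw [ht, ← ENNReal.rpow_mul]
  congr 1
  field_simp
  ring

/-- A discrete Hardy inequality. -/
lemma exists_tsum_dyadic_le {p : ℝ} (hp : 1 < p) {q : ℝ} (hq : 0 < q) {D : ℝ≥0∞} (hD : D ≠ ⊤) :
    ∃ C : ℝ≥0∞, C ≠ ⊤ ∧ ∀ e a : ℕ → ℝ≥0∞, (∀ j, e j ≤ e (j + 1) + D * a j) →
      ∑' j : ℕ, ((2 : ℝ≥0∞) ^ j) ^ q * e j ^ p ≠ ⊤ →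
      ∑' j : ℕ, ((2 : ℝ≥0∞) ^ j) ^ q * e j ^ p ≤ C * ∑' j : ℕ, ((2 : ℝ≥0∞) ^ j) ^ q * a j ^ p := by
  -- The shift from `j` to `j + 1` gains `2 ^ (-q)`. Spending only half of it on the power of a sum
  -- leaves the contraction factor `2 ^ (-(q / 2))`.
  obtain ⟨C, hC, h⟩ := exists_rpow_add_le hp (half_pos hq)
  refine ⟨geomConst (q / 2) * (C * D ^ p), ENNReal.mul_ne_top (geomConst_ne_top (half_pos hq))
    (ENNReal.mul_ne_top hC (ENNReal.rpow_ne_top_of_nonneg (by linarith) hD)), fun e a hea hW ↦ ?_⟩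
  set W := ∑' j : ℕ, ((2 : ℝ≥0∞) ^ j) ^ q * e j ^ p with hWdef
  set R := C * D ^ p * ∑' j : ℕ, ((2 : ℝ≥0∞) ^ j) ^ q * a j ^ p with hR
  have hstep : W ≤ 2 ^ (-(q / 2)) * W + R := by
    have h1 : ∀ j : ℕ, ((2 : ℝ≥0∞) ^ j) ^ q * e j ^ p
        ≤ 2 ^ (-(q / 2)) * (((2 : ℝ≥0∞) ^ (j + 1)) ^ q * e (j + 1) ^ p)
          + C * D ^ p * (((2 : ℝ≥0∞) ^ j) ^ q * a j ^ p) := by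
      intro j
      have h2 : (2 : ℝ≥0∞) ^ (-(q / 2)) * ((2 : ℝ≥0∞) ^ (j + 1)) ^ q
          = ((2 : ℝ≥0∞) ^ j) ^ q * 2 ^ (q / 2) := by
        rw [pow_succ, ENNReal.mul_rpow_of_nonneg _ _ hq.le, mul_left_comm,
          ← ENNReal.rpow_add _ _ (by simp) (by simp)]
        congr 2; ring
      calc _ ≤ ((2 : ℝ≥0∞) ^ j) ^ q * (e (j + 1) + D * a j) ^ p := by
            gcongr; exact hea j
        _ ≤ ((2 : ℝ≥0∞) ^ j) ^ q * (2 ^ (q / 2) * e (j + 1) ^ p + C * (D * a j) ^ p) := by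
            gcongr; exact h _ _
        _ = _ := by
            rw [← mul_assoc (2 ^ (-(q / 2))), h2, ENNReal.mul_rpow_of_nonneg _ _ (by linarith)]
            ring
    refine (ENNReal.tsum_le_tsum h1).trans ?_
    rw [ENNReal.tsum_add, ENNReal.tsum_mul_left, ENNReal.tsum_mul_left]
    gcongr
    exact ENNReal.tsum_comp_le_tsum_of_injective (add_left_injective 1)
      (fun j : ℕ ↦ ((2 : ℝ≥0∞) ^ j) ^ q * e j ^ p)
  have hθ : (2 : ℝ≥0∞) ^ (-(q / 2)) < 1 := two_rpow_neg_lt_one (half_pos hq)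
  -- Absorbing the multiple of `W` into the left side is legitimate because `W` is assumed finite.
  have h3 : (1 - (2 : ℝ≥0∞) ^ (-(q / 2))) * W ≤ R := by
    rw [ENNReal.sub_mul (fun _ _ ↦ hW), one_mul]
    exact tsub_le_iff_left.2 hstep
  rw [mul_assoc, ← hR, geomConst, mul_comm, ← div_eq_mul_inv,
    ENNReal.le_div_iff_mul_le (Or.inl (tsub_pos_of_lt hθ).ne')
      (Or.inl (ENNReal.sub_ne_top (by simp))), mul_comm]
  exact h3

end Sums

/-! ### Interpolation between a uniform bound on averages and an `L ^ q` bound -/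

section Interpolation

variable {E : Type*} [NormedAddCommGroup E] [NormedSpace ℝ E] [FiniteDimensional ℝ E]
  [MeasurableSpace E] [BorelSpace E] {μ : Measure E} [μ.IsAddHaarMeasure]

local notation "dim" => Module.finrank ℝ E

/-- Interpolation between a uniform bound on `2 ^ (-j)` times the averages of `g` at scale
`2 ^ (-j)` and an integral bound on `g ^ q`. -/
lemma tsum_lintegral_average_le_of_le_one {p q : ℝ} (hq : 1 < q) (hqp : q < p) {g : E → ℝ≥0∞}
    (hg : Measurable g) (hM : ∀ (j : ℕ) (x : E), (2 ^ j)⁻¹ * ∫⁻ h, g (x + h) ∂ballProb μ j ≤ 1) :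
    ∑' j : ℕ, ((2 : ℝ≥0∞) ^ j) ^ q * ∫⁻ x, ((2 ^ j)⁻¹ * ∫⁻ h, g (x + h) ∂ballProb μ j) ^ p ∂μ
      ≤ 2 ^ p * (geomConst (p - q) + geomConst q + geomConst (q - 1)) * ∫⁻ x, g x ^ q ∂μ := by
  have hp : 1 < p := hq.trans hqp
  have hp0 : 0 < p := by linarith
  -- `g` is cut at the height `2 ^ j`, which depends on the scale: the low part is treated in `L ^
  -- p`, the high part in `L ^ 1`. Both sums over `j` reproduce `g ^ q` pointwise.
  set lo : ℕ → E → ℝ≥0∞ := fun j x ↦ min (g x) (2 ^ j) with hlo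
  set hi : ℕ → E → ℝ≥0∞ := fun j x ↦ if 2 ^ j < g x then g x else 0 with hhi
  have hlom : ∀ j, Measurable (lo j) := fun j ↦ hg.min measurable_const
  have hhim : ∀ j, Measurable (hi j) := fun j ↦
    Measurable.ite (measurableSet_lt measurable_const hg) hg measurable_const
  have hsplit : ∀ j x, g x ≤ lo j x + hi j x := by
    intro j x
    simp only [hlo, hhi]
    split_ifs with h
    · exact le_add_self
    · rw [min_eq_left (not_lt.1 h), add_zero]
  have h1 : ∀ (j : ℕ) (x : E), ((2 : ℝ≥0∞) ^ j) ^ q *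
      ((2 ^ j)⁻¹ * ∫⁻ h, g (x + h) ∂ballProb μ j) ^ p
      ≤ 2 ^ p * (((2 : ℝ≥0∞) ^ j) ^ (q - p) * (∫⁻ h, lo j (x + h) ∂ballProb μ j) ^ p
        + ((2 : ℝ≥0∞) ^ j) ^ (q - 1) * ∫⁻ h, hi j (x + h) ∂ballProb μ j) := by
    intro j x
    set m := ∫⁻ h, lo j (x + h) ∂ballProb μ j
    set n := ∫⁻ h, hi j (x + h) ∂ballProb μ j
    set P := ∫⁻ h, g (x + h) ∂ballProb μ j with hP
    have hPmn : P ≤ m + n := by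
      rw [hP, ← lintegral_add_left (f := fun h ↦ lo j (x + h))
        ((hlom j).comp (measurable_const_add x))]
      exact lintegral_mono fun h ↦ hsplit j (x + h)
    have hc : ((2 : ℝ≥0∞) ^ j)⁻¹ = ((2 : ℝ≥0∞) ^ j) ^ (-1 : ℝ) := by
      rw [ENNReal.rpow_neg_one]
    have hlow : P ≤ 2 * m → ((2 : ℝ≥0∞) ^ j) ^ q * ((2 ^ j)⁻¹ * P) ^ p
        ≤ 2 ^ p * (((2 : ℝ≥0∞) ^ j) ^ (q - p) * m ^ p) := by
      intro h
      calc _ ≤ ((2 : ℝ≥0∞) ^ j) ^ q * ((2 ^ j)⁻¹ * (2 * m)) ^ p := by gcongr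
        _ = _ := by
          rw [ENNReal.mul_rpow_of_nonneg _ _ hp0.le, ENNReal.mul_rpow_of_nonneg _ _ hp0.le, hc,
            ← ENNReal.rpow_mul, ← mul_assoc, ← two_pow_rpow_add, neg_one_mul, ← sub_eq_add_neg]
          ring
    -- The normalized average is at most 1, so its power `p` may be replaced by its first power.
    have hhigh : P ≤ 2 * n → ((2 : ℝ≥0∞) ^ j) ^ q * ((2 ^ j)⁻¹ * P) ^ p
        ≤ 2 ^ p * (((2 : ℝ≥0∞) ^ j) ^ (q - 1) * n) := by
      intro h
      calc _ ≤ ((2 : ℝ≥0∞) ^ j) ^ q * ((2 ^ j)⁻¹ * P) := by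
            gcongr
            conv_rhs => rw [← ENNReal.rpow_one ((2 ^ j)⁻¹ * P)]
            exact ENNReal.rpow_le_rpow_of_exponent_ge (hM j x) hp.le
        _ ≤ ((2 : ℝ≥0∞) ^ j) ^ q * ((2 ^ j)⁻¹ * (2 * n)) := by gcongr
        _ = 2 * (((2 : ℝ≥0∞) ^ j) ^ (q - 1) * n) := by
            rw [hc, sub_eq_add_neg, two_pow_rpow_add]; ring
        _ ≤ _ := by
            gcongr
            conv_lhs => rw [← ENNReal.rpow_one 2]
            exact ENNReal.rpow_le_rpow_of_exponent_le (by norm_num) hp.le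
    rcases le_total n m with hnm | hnm
    · refine (hlow (hPmn.trans (by rw [two_mul]; gcongr))).trans ?_
      gcongr
      exact le_self_add
    · refine (hhigh (hPmn.trans (by rw [two_mul]; gcongr))).trans ?_
      gcongr
      exact le_add_self
  have h2 : ∀ j : ℕ, ((2 : ℝ≥0∞) ^ j) ^ q *
      ∫⁻ x, ((2 ^ j)⁻¹ * ∫⁻ h, g (x + h) ∂ballProb μ j) ^ p ∂μ
      ≤ 2 ^ p * ∫⁻ x, (((2 : ℝ≥0∞) ^ j) ^ (q - p) * lo j x ^ p
        + ((2 : ℝ≥0∞) ^ j) ^ (q - 1) * hi j x) ∂μ := by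
    intro j
    have hmlo := measurable_lintegral_ballProb (μ := μ) j (hlom j)
    rw [← lintegral_const_mul' _ _ (ENNReal.rpow_ne_top_of_nonneg (by linarith) (by simp))]
    refine (lintegral_mono (h1 j)).trans ?_
    rw [lintegral_const_mul' _ _ (ENNReal.rpow_ne_top_of_nonneg hp0.le (by simp)),
      lintegral_add_left ((hmlo.pow_const p).const_mul _),
      lintegral_add_left (((hlom j).pow_const p).const_mul _),
      lintegral_const_mul _ (hmlo.pow_const p), lintegral_const_mul _ ((hlom j).pow_const p),
      lintegral_const_mul _ (measurable_lintegral_ballProb (μ := μ) j (hhim j)),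
      lintegral_const_mul _ (hhim j), lintegral_lintegral_ballProb j (hhim j)]
    refine mul_le_mul_right (add_le_add_left (mul_le_mul_right ?_ _) _) _
    exact lintegral_rpow_ballProb_le j (hlom j) hp.le
  have h3 : ∀ j : ℕ, AEMeasurable (fun x ↦ ((2 : ℝ≥0∞) ^ j) ^ (q - p) * lo j x ^ p
        + ((2 : ℝ≥0∞) ^ j) ^ (q - 1) * hi j x) μ := fun j ↦
    ((((hlom j).pow_const p).const_mul _).add ((hhim j).const_mul _)).aemeasurable
  refine (ENNReal.tsum_le_tsum h2).trans ?_
  rw [ENNReal.tsum_mul_left, ← lintegral_tsum h3, mul_assoc,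
    ← lintegral_const_mul _ (hg.pow_const q)]
  gcongr with x
  rw [ENNReal.tsum_add, add_mul]
  exact add_le_add (tsum_dyadic_min_le (by linarith) hqp _) (tsum_dyadic_indicator_le hq _)

/-- The interpolation inequality behind the nonlinear estimate: `q ≥ d` gives a uniform bound on
the averages. -/
lemma exists_tsum_lintegral_average_le (μ : Measure E) [μ.IsAddHaarMeasure] {p q : ℝ} (hq : 1 < q)
    (hqp : q < p) (hd : (dim : ℝ) ≤ q) :
    ∃ C : ℝ≥0∞, C ≠ ⊤ ∧ ∀ g : E → ℝ≥0∞, Measurable g →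
    ∑' j : ℕ, ((2 : ℝ≥0∞) ^ j) ^ q * ∫⁻ x, ((2 ^ j)⁻¹ * ∫⁻ h, g (x + h) ∂ballProb μ j) ^ p ∂μ
      ≤ C * (∫⁻ x, g x ^ q ∂μ) ^ (p / q) := by
  have hq0 : 0 < q := by linarith
  have hp0 : 0 < p := by linarith
  set v := ballVolume (E := E) μ with hv
  have hv0 : v⁻¹ ≠ 0 := ENNReal.inv_ne_zero.2 ballVolume_ne_top
  have hvt : v⁻¹ ≠ ⊤ := ENNReal.inv_ne_top.2 ballVolume_ne_zero
  set C₁ := 2 ^ p * (geomConst (p - q) + geomConst q + geomConst (q - 1)) with hC₁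
  have hC₁t : C₁ ≠ ⊤ := by
    refine ENNReal.mul_ne_top (ENNReal.rpow_ne_top_of_nonneg hp0.le (by simp)) ?_
    simp only [ENNReal.add_ne_top]
    exact ⟨⟨geomConst_ne_top (by linarith), geomConst_ne_top hq0⟩, geomConst_ne_top (by linarith)⟩
  have hC₁0 : C₁ ≠ 0 := by
    refine mul_ne_zero (by rw [Ne, ENNReal.rpow_eq_zero_iff]; simp) ?_
    rw [geomConst_eq (p - q)]; simp
  have hvp0 : v⁻¹ ^ (p / q - 1) ≠ 0 := by rw [Ne, ENNReal.rpow_eq_zero_iff]; simp [hv0, hvt]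
  refine ⟨C₁ * v⁻¹ ^ (p / q - 1), ENNReal.mul_ne_top hC₁t
    (ENNReal.rpow_ne_top_of_ne_zero hv0 hvt), fun g hg ↦ ?_⟩
  set I := ∫⁻ x, g x ^ q ∂μ with hI
  -- Jensen's inequality on the ball of radius `2 ^ (-j)` costs `2 ^ (j dim)`, and the normalization
  -- gains `2 ^ (-j q)`. This is where `q ≥ dim` enters.
  have hbound : ∀ (j : ℕ) (x : E),
      ((2 ^ j)⁻¹ * ∫⁻ h, g (x + h) ∂ballProb μ j) ^ q ≤ v⁻¹ * I := by
    intro j x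
    have hgx : Measurable fun h ↦ g (x + h) := hg.comp (measurable_const_add x)
    calc _ = ((2 : ℝ≥0∞) ^ j) ^ (-q) * (∫⁻ h, g (x + h) ∂ballProb μ j) ^ q := by
          rw [ENNReal.mul_rpow_of_nonneg _ _ hq0.le, ENNReal.inv_rpow, ENNReal.rpow_neg]
      _ ≤ ((2 : ℝ≥0∞) ^ j) ^ (-q) * (v⁻¹ * (2 ^ j) ^ dim * I) := by
          gcongr
          refine (rpow_lintegral_le hgx.aemeasurable hq.le).trans ?_
          rw [lintegral_ballProb]
          gcongr
          rw [hI, ← lintegral_add_left_eq_self (μ := μ) _ x]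
          exact setLIntegral_le_lintegral _ _
      _ = ((2 : ℝ≥0∞) ^ j) ^ (-(q - dim)) * (v⁻¹ * I) := by
          rw [neg_sub, sub_eq_add_neg, two_pow_rpow_add, ENNReal.rpow_natCast]; ring
      _ ≤ _ := by
          refine mul_le_of_le_one_left' ?_
          rw [ENNReal.rpow_neg]
          refine ENNReal.inv_le_one.2 ?_
          conv_lhs => rw [← ENNReal.one_rpow (q - dim)]
          exact ENNReal.rpow_le_rpow (one_le_pow₀ (by norm_num)) (by linarith)
  rcases eq_or_ne I ⊤ with hIt | hIt
  · rw [hIt, ENNReal.top_rpow_of_pos (by positivity), ENNReal.mul_top (mul_ne_zero hC₁0 hvp0)]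
    exact le_top
  rcases eq_or_ne I 0 with hI0 | hI0
  · have : ∀ (j : ℕ) (x : E), (2 ^ j)⁻¹ * ∫⁻ h, g (x + h) ∂ballProb μ j = 0 := by
      intro j x
      have h := hbound j x
      rw [hI0, mul_zero, nonpos_iff_eq_zero, ENNReal.rpow_eq_zero_iff_of_pos hq0] at h
      exact h
    simp [this, ENNReal.zero_rpow_of_pos hp0]
  -- `g` is divided by the uniform bound `A` on its normalized averages. Undoing this multiplies `I`
  -- by `A ^ (p - q)`, which is a multiple of `I ^ (p / q - 1)`: hence the nonlinear power.
  set A := (v⁻¹ * I) ^ (1 / q) with hA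
  have hvI0 : v⁻¹ * I ≠ 0 := mul_ne_zero hv0 hI0
  have hvIt : v⁻¹ * I ≠ ⊤ := ENNReal.mul_ne_top hvt hIt
  have hA0 : A ≠ 0 := by rw [hA, Ne, ENNReal.rpow_eq_zero_iff]; simp [hvI0, hvIt]
  have hAt : A ≠ ⊤ := ENNReal.rpow_ne_top_of_ne_zero hvI0 hvIt
  have hMA : ∀ (j : ℕ) (x : E), (2 ^ j)⁻¹ * ∫⁻ h, g (x + h) ∂ballProb μ j ≤ A := by
    intro j x
    have := ENNReal.rpow_le_rpow (hbound j x) (z := 1 / q) (by positivity)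
    rwa [← ENNReal.rpow_mul, mul_one_div_cancel hq0.ne', ENNReal.rpow_one] at this
  have hscale : ∀ (j : ℕ) (x : E), (2 ^ j)⁻¹ * ∫⁻ h, A⁻¹ * g (x + h) ∂ballProb μ j
      = A⁻¹ * ((2 ^ j)⁻¹ * ∫⁻ h, g (x + h) ∂ballProb μ j) := by
    intro j x
    rw [lintegral_const_mul' _ _ (ENNReal.inv_ne_top.2 hA0)]; ring
  have key := tsum_lintegral_average_le_of_le_one (μ := μ) hq hqp (hg.const_mul A⁻¹) (fun j x ↦ by
    rw [hscale, mul_comm, ← div_eq_mul_inv]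
    exact ENNReal.div_le_of_le_mul (by simpa using hMA j x))
  have hAp : A⁻¹ ^ p ≠ ⊤ := ENNReal.rpow_ne_top_of_nonneg hp0.le (ENNReal.inv_ne_top.2 hA0)
  have hAq : A⁻¹ ^ q ≠ ⊤ := ENNReal.rpow_ne_top_of_nonneg hq0.le (ENNReal.inv_ne_top.2 hA0)
  simp_rw [hscale, ENNReal.mul_rpow_of_nonneg _ _ hp0.le, ENNReal.mul_rpow_of_nonneg _ _ hq0.le,
    lintegral_const_mul' _ _ hAp, lintegral_const_mul' _ _ hAq] at key
  simp_rw [mul_left_comm _ (A⁻¹ ^ p), ENNReal.tsum_mul_left] at key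
  have hfin : A ^ p * A⁻¹ ^ p = 1 := by
    rw [← ENNReal.mul_rpow_of_nonneg _ _ hp0.le, ENNReal.mul_inv_cancel hA0 hAt, ENNReal.one_rpow]
  simp_rw [ENNReal.mul_rpow_of_nonneg _ _ hp0.le]
  calc _ = A ^ p * A⁻¹ ^ p * _ := by rw [hfin, one_mul]
    _ ≤ A ^ p * (C₁ * (A⁻¹ ^ q * I)) := by
        rw [mul_assoc]; exact mul_le_mul_right key _
    _ = C₁ * ((A ^ p * A⁻¹ ^ q) * I) := by ring
    _ = C₁ * ((v⁻¹ * I) ^ (p / q - 1) * I) := by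
        congr 2
        have : A ^ p * A⁻¹ ^ q = A ^ (p - q) := by
          rw [ENNReal.inv_rpow, ← ENNReal.rpow_neg, ← ENNReal.rpow_add _ _ hA0 hAt, sub_eq_add_neg]
        rw [this, hA, ← ENNReal.rpow_mul]
        congr 1; field_simp
    _ = _ := by
        have : I ^ (p / q - 1) * I = I ^ (p / q) := by
          nth_rw 2 [← ENNReal.rpow_one I]
          rw [← ENNReal.rpow_add _ _ hI0 hIt, sub_add_cancel]
        rw [ENNReal.mul_rpow_of_ne_top hvt hIt, mul_assoc _ _ I, this, hC₁]
        ring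

end Interpolation

end FractionalLifting

namespace FractionalLifting

/-! ### Mean oscillations at dyadic scales -/

section Oscillation

variable {E : Type*} [NormedAddCommGroup E] [NormedSpace ℝ E] [FiniteDimensional ℝ E]
  [MeasurableSpace E] [BorelSpace E] {μ : Measure E} [μ.IsAddHaarMeasure]

local notation "dim" => Module.finrank ℝ E

variable (μ) in
/-- The average of `f x y` over the `y` in the ball of radius `2 ^ (-j)` centered at `x`. -/
noncomputable def meanFrom (f : E → E → ℝ≥0∞) (j : ℕ) (x : E) : ℝ≥0∞ :=
  ∫⁻ h, f x (x + h) ∂ballProb μ j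

variable (μ) in
/-- The mean oscillation: the average of `f y z` over the `y` and `z` in the ball of
radius `2 ^ (-j)` centered at `x`. -/
noncomputable def meanOsc (f : E → E → ℝ≥0∞) (j : ℕ) (x : E) : ℝ≥0∞ :=
  ∫⁻ h, ∫⁻ k, f (x + h) (x + k) ∂ballProb μ j ∂ballProb μ j

lemma measurable_add_add {f : E → E → ℝ≥0∞} (hf : Measurable (Function.uncurry f)) (x : E) :
    Measurable (Function.uncurry fun h k ↦ f (x + h) (x + k)) :=
  hf.comp (((measurable_const_add x).comp measurable_fst).prodMk
    ((measurable_const_add x).comp measurable_snd))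

lemma measurable_meanFrom {f : E → E → ℝ≥0∞} (hf : Measurable (Function.uncurry f)) (j : ℕ) :
    Measurable (meanFrom μ f j) :=
  Measurable.lintegral_prod_right (f := fun x h ↦ f x (x + h)) (measurable_pair hf)

lemma measurable_meanOsc {f : E → E → ℝ≥0∞} (hf : Measurable (Function.uncurry f)) (j : ℕ) :
    Measurable (meanOsc μ f j) := by
  have h1 : Measurable fun z : (E × E) × E ↦ f (z.1.1 + z.1.2) (z.1.1 + z.2) :=
    hf.comp (((measurable_fst.comp measurable_fst).add (measurable_snd.comp measurable_fst)).prodMk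
      ((measurable_fst.comp measurable_fst).add measurable_snd))
  have h2 : Measurable fun z : E × E ↦ ∫⁻ k, f (z.1 + z.2) (z.1 + k) ∂ballProb μ j :=
    h1.lintegral_prod_right'
  exact h2.lintegral_prod_right'

/-- Average the triangle inequality through an intermediate point of the ball of half radius;
comparing that ball with the larger one costs `2 ^ dim`. This is the recursion in `j` fed to the
Hardy inequality. -/
lemma meanFrom_le {f : E → E → ℝ≥0∞} (hf : Measurable (Function.uncurry f))
    (hsymm : ∀ x y, f x y = f y x) (htri : ∀ x y z, f x z ≤ f x y + f y z) (j : ℕ) (x : E) :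
    meanFrom μ f j x ≤ meanFrom μ f (j + 1) x + 2 ^ dim * meanOsc μ f j x := by
  have hm := measurable_pair_right hf x
  calc meanFrom μ f j x
      ≤ ∫⁻ h, ∫⁻ k, (f x (x + k) + f (x + h) (x + k)) ∂ballProb μ (j + 1) ∂ballProb μ j := by
        refine lintegral_mono fun h ↦ ?_
        calc f x (x + h) = ∫⁻ _, f x (x + h) ∂ballProb μ (j + 1) := by simp
          _ ≤ _ := lintegral_mono fun k ↦ by
              rw [hsymm (x + h) (x + k)]; exact htri _ _ _
    _ = meanFrom μ f (j + 1) x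
          + ∫⁻ h, ∫⁻ k, f (x + h) (x + k) ∂ballProb μ (j + 1) ∂ballProb μ j := by
        simp_rw [lintegral_add_left hm]
        rw [lintegral_add_left measurable_const]
        simp [meanFrom]
    _ ≤ _ := by
        gcongr
        rw [meanOsc, ← lintegral_const_mul' _ _ (by simp)]
        exact lintegral_mono fun h ↦ lintegral_ballProb_succ_le j _

lemma setLIntegral_dyadicBall_shift_le (j : ℕ) {h : E} (hh : h ∈ dyadicBall E (j + 1))
    (g : E → ℝ≥0∞) :
    ∫⁻ k in dyadicBall E (j + 1), g k ∂μ ≤ ∫⁻ k in dyadicBall E j, g (h + k) ∂μ := by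
  rw [← lintegral_indicator (measurableSet_dyadicBall _),
    ← lintegral_indicator (measurableSet_dyadicBall _), ← lintegral_add_left_eq_self (μ := μ) _ h]
  refine lintegral_mono fun k ↦ ?_
  by_cases hk : h + k ∈ dyadicBall E (j + 1)
  · have hk' : k ∈ dyadicBall E j := by
      have h1 : 2 ^ (j + 1) * ‖h‖ₑ < 1 := hh
      have h2 : 2 ^ (j + 1) * ‖h + k‖ₑ < 1 := hk
      have h3 : ‖k‖ₑ ≤ ‖h + k‖ₑ + ‖h‖ₑ := by
        calc ‖k‖ₑ = ‖(h + k) - h‖ₑ := by simp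
          _ ≤ _ := enorm_sub_le
      change 2 ^ j * ‖k‖ₑ < 1
      have h4 : 2 * (2 ^ j * ‖k‖ₑ) < 2 * 1 := by
        calc 2 * (2 ^ j * ‖k‖ₑ) ≤ 2 * (2 ^ j * (‖h + k‖ₑ + ‖h‖ₑ)) := by gcongr
          _ = 2 ^ (j + 1) * ‖h + k‖ₑ + 2 ^ (j + 1) * ‖h‖ₑ := by rw [pow_succ]; ring
          _ < 1 + 1 := ENNReal.add_lt_add h2 h1
          _ = 2 * 1 := by norm_num
      exact (ENNReal.mul_lt_mul_iff_right (by simp) (by simp)).1 h4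
    rw [indicator_of_mem hk, indicator_of_mem hk']
  · rw [indicator_of_notMem hk]; simp

/-- Average the triangle inequality over a third point of the ball of radius `2 ^ (-(j + 1))`
centered at `x`. Since `‖h‖ < 2 ^ (-(j + 1))`, that ball is contained in the ball of radius `2 ^
(-j)` centered at `x + h`. -/
lemma le_meanFrom_add {f : E → E → ℝ≥0∞} (hf : Measurable (Function.uncurry f))
    (hsymm : ∀ x y, f x y = f y x) (htri : ∀ x y z, f x z ≤ f x y + f y z) (j : ℕ) (x : E) {h : E}
    (hh : h ∈ dyadicBall E (j + 1)) :
    f x (x + h) ≤ 2 ^ dim * (meanFrom μ f j x + meanFrom μ f j (x + h)) := by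
  have hm := measurable_pair_right hf x
  calc f x (x + h) = ∫⁻ _, f x (x + h) ∂ballProb μ (j + 1) := by simp
    _ ≤ ∫⁻ k, (f x (x + k) + f (x + h) (x + k)) ∂ballProb μ (j + 1) :=
        lintegral_mono fun k ↦ by rw [hsymm (x + h) (x + k)]; exact htri _ _ _
    _ = meanFrom μ f (j + 1) x + ∫⁻ k, f (x + h) (x + k) ∂ballProb μ (j + 1) :=
        lintegral_add_left hm _
    _ ≤ 2 ^ dim * meanFrom μ f j x + 2 ^ dim * meanFrom μ f j (x + h) := by
        refine add_le_add (lintegral_ballProb_succ_le j _) ?_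
        rw [meanFrom, lintegral_ballProb, lintegral_ballProb, pow_succ, mul_pow]
        calc _ ≤ (ballVolume (E := E) μ)⁻¹ * ((2 ^ j) ^ dim * 2 ^ dim)
              * ∫⁻ k in dyadicBall E j, f (x + h) (x + (h + k)) ∂μ := by
              exact mul_le_mul_right (setLIntegral_dyadicBall_shift_le (μ := μ) j hh
                fun k ↦ f (x + h) (x + k)) _
          _ = _ := by simp_rw [add_assoc]; ring
    _ = _ := by ring

lemma meanOsc_rpow_le {f : E → E → ℝ≥0∞} (hf : Measurable (Function.uncurry f)) {p : ℝ}
    (hp : 1 ≤ p) (j : ℕ) (x : E) :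
    meanOsc μ f j x ^ p ≤ meanOsc μ (fun x y ↦ f x y ^ p) j x := by
  have hm := measurable_add_add hf x
  refine (rpow_lintegral_le hm.lintegral_prod_right.aemeasurable hp).trans ?_
  exact lintegral_mono fun h ↦
    rpow_lintegral_le (hm.comp measurable_prodMk_left).aemeasurable hp

/-- After integration in `x`, only the difference `u = k - h` of the two increments matters, by
translation invariance, and `‖u‖ < 2 * 2 ^ (-j)`. -/
lemma lintegral_meanOsc_le {g : E → E → ℝ≥0∞} (hg : Measurable (Function.uncurry g)) (j : ℕ) :
    ∫⁻ x, meanOsc μ g j x ∂μ ≤ (ballVolume (E := E) μ)⁻¹ * (2 ^ j) ^ dim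
      * ∫⁻ u in {u | 2 ^ j * ‖u‖ₑ < 2}, ∫⁻ x, g x (x + u) ∂μ ∂μ := by
  have h1 : Measurable fun z : (E × E) × E ↦ g (z.1.1 + z.1.2) (z.1.1 + z.2) :=
    hg.comp (((measurable_fst.comp measurable_fst).add (measurable_snd.comp measurable_fst)).prodMk
      ((measurable_fst.comp measurable_fst).add measurable_snd))
  have h2 : Measurable (Function.uncurry fun x h : E ↦
      ∫⁻ k, g (x + h) (x + k) ∂ballProb μ j) := h1.lintegral_prod_right'
  have hS : MeasurableSet {u : E | 2 ^ j * ‖u‖ₑ < 2} :=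
    measurableSet_lt (measurable_enorm.const_mul _) measurable_const
  unfold meanOsc
  rw [lintegral_lintegral_swap h2.aemeasurable]
  have h3 : ∀ h ∈ dyadicBall E j, ∫⁻ x, ∫⁻ k, g (x + h) (x + k) ∂ballProb μ j ∂μ
      ≤ (ballVolume (E := E) μ)⁻¹ * (2 ^ j) ^ dim
      * ∫⁻ u in {u | 2 ^ j * ‖u‖ₑ < 2}, ∫⁻ x, g x (x + u) ∂μ ∂μ := by
    intro h hh
    have h4 : Measurable (Function.uncurry fun x k : E ↦ g (x + h) (x + k)) :=
      hg.comp (((measurable_add_const h).comp measurable_fst).prodMk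
        (measurable_fst.add measurable_snd))
    rw [lintegral_lintegral_swap h4.aemeasurable, lintegral_ballProb]
    refine mul_le_mul_right ?_ _
    rw [← lintegral_indicator (measurableSet_dyadicBall _), ← lintegral_indicator hS,
      ← lintegral_add_left_eq_self (μ := μ) _ h]
    refine lintegral_mono fun u ↦ ?_
    by_cases hk : h + u ∈ dyadicBall E j
    · have hu : u ∈ {u : E | 2 ^ j * ‖u‖ₑ < 2} := by
        have h1 : 2 ^ j * ‖h‖ₑ < 1 := hh
        have h2 : 2 ^ j * ‖h + u‖ₑ < 1 := hk
        have h3 : ‖u‖ₑ ≤ ‖h + u‖ₑ + ‖h‖ₑ := by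
          calc ‖u‖ₑ = ‖(h + u) - h‖ₑ := by simp
            _ ≤ _ := enorm_sub_le
        change 2 ^ j * ‖u‖ₑ < 2
        calc 2 ^ j * ‖u‖ₑ ≤ 2 ^ j * (‖h + u‖ₑ + ‖h‖ₑ) := by gcongr
          _ = 2 ^ j * ‖h + u‖ₑ + 2 ^ j * ‖h‖ₑ := by ring
          _ < 1 + 1 := ENNReal.add_lt_add h2 h1
          _ = 2 := by norm_num
      rw [indicator_of_mem hk, indicator_of_mem hu,
        ← lintegral_add_right_eq_self (fun x ↦ g x (x + u)) h]
      exact le_of_eq (lintegral_congr fun x ↦ by rw [add_assoc])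
    · rw [indicator_of_notMem hk]; simp
  refine (lintegral_ballProb_mono_fun h3).trans ?_
  simp

/-- An increment `u` is seen exactly by the scales with `2 ^ j < 2 / ‖u‖`; summing `2 ^ (j (dim +
q))` over them rebuilds the kernel `‖u‖ ^ (-(dim + q))`. -/
lemma tsum_lintegral_meanOsc_le [Nontrivial E] {g : E → E → ℝ≥0∞}
    (hg : Measurable (Function.uncurry g)) {q : ℝ} (hq : 0 < q) :
    ∑' j : ℕ, ((2 : ℝ≥0∞) ^ j) ^ q * ∫⁻ x, meanOsc μ g j x ∂μ
      ≤ (ballVolume (E := E) μ)⁻¹ * geomConst (dim + q) * 2 ^ ((dim : ℝ) + q)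
        * pairIntegral μ g (normWeight (dim + q)) := by
  have hdq : 0 < (dim : ℝ) + q := by positivity
  have hvt : (ballVolume (E := E) μ)⁻¹ ≠ ⊤ := ENNReal.inv_ne_top.2 ballVolume_ne_zero
  have hS : ∀ j : ℕ, MeasurableSet {u : E | 2 ^ j * ‖u‖ₑ < 2} := fun j ↦
    measurableSet_lt (measurable_enorm.const_mul _) measurable_const
  set G : E → ℝ≥0∞ := fun u ↦ ∫⁻ x, g x (x + u) ∂μ with hG
  have hGm : Measurable G := (measurable_pair hg).lintegral_prod_left'
  have hae : ∀ᵐ h : E ∂μ, h ≠ 0 := by simp [ae_iff, measure_singleton]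
  calc _ ≤ ∑' j : ℕ, (ballVolume (E := E) μ)⁻¹ * ∫⁻ u, ((2 : ℝ≥0∞) ^ j) ^ ((dim : ℝ) + q)
          * {u : E | 2 ^ j * ‖u‖ₑ < 2}.indicator G u ∂μ := by
        refine ENNReal.tsum_le_tsum fun j ↦ ?_
        rw [lintegral_const_mul' _ _ (ENNReal.rpow_ne_top_of_nonneg hdq.le (by simp)),
          lintegral_indicator (hS j), two_pow_rpow_add, ENNReal.rpow_natCast]
        refine (mul_le_mul_right (lintegral_meanOsc_le hg j) _).trans_eq ?_
        ring
    _ = (ballVolume (E := E) μ)⁻¹ * ∫⁻ u, ∑' j : ℕ, ((2 : ℝ≥0∞) ^ j) ^ ((dim : ℝ) + q)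
          * {u : E | 2 ^ j * ‖u‖ₑ < 2}.indicator G u ∂μ := by
        rw [ENNReal.tsum_mul_left, lintegral_tsum fun j ↦
          ((hGm.indicator (hS j)).const_mul _).aemeasurable]
    _ ≤ (ballVolume (E := E) μ)⁻¹ * ∫⁻ u, geomConst (dim + q) * 2 ^ ((dim : ℝ) + q)
          * (G u * normWeight (dim + q) u) ∂μ := by
        refine mul_le_mul_right (lintegral_mono_ae ?_) _
        filter_upwards [hae] with u hu
        have hn : ‖u‖ₑ ≠ 0 := by simpa using hu
        calc _ = (∑' j : ℕ, (if (2 : ℝ≥0∞) ^ j < 2 / ‖u‖ₑ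
                then ((2 : ℝ≥0∞) ^ j) ^ ((dim : ℝ) + q) else 0)) * G u := by
              rw [← ENNReal.tsum_mul_right]
              refine tsum_congr fun j ↦ ?_
              simp only [ENNReal.lt_div_iff_mul_lt (Or.inl hn) (Or.inl enorm_ne_top), indicator,
                mem_ofPred_eq]
              split_ifs <;> simp
          _ ≤ geomConst (dim + q) * (2 / ‖u‖ₑ) ^ ((dim : ℝ) + q) * G u := by
              gcongr
              exact tsum_dyadic_lt_le hdq _
          _ = _ := by
              rw [ENNReal.div_rpow_of_nonneg _ _ hdq.le, div_eq_mul_inv, ← ENNReal.rpow_neg,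
                normWeight]
              ring
    _ = _ := by
        rw [lintegral_const_mul' _ _ (ENNReal.mul_ne_top (geomConst_ne_top hdq)
          (ENNReal.rpow_ne_top_of_nonneg hdq.le (by simp))),
          pairIntegral_swap hg (measurable_normWeight _), ← mul_assoc, ← mul_assoc]
        congr 1
        refine lintegral_congr fun u ↦ ?_
        have hm : Measurable fun x ↦ g x (x + u) :=
          (measurable_pair hg).comp measurable_prodMk_right
        exact (lintegral_mul_const _ hm).symm

end Oscillation

end FractionalLifting

namespace FractionalLifting

/-! ### Estimate of the oscillations in a Euclidean ball -/

section LocalEstimate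

variable {E : Type*} [NormedAddCommGroup E] [NormedSpace ℝ E] [FiniteDimensional ℝ E]
  [MeasurableSpace E] [BorelSpace E] {μ : Measure E} [μ.IsAddHaarMeasure]

local notation "dim" => Module.finrank ℝ E

open Classical in
/-- The restriction of `g` to the pairs of points of `U`, extended by `0`. -/
noncomputable def pairsIn (U : Set E) (g : E → E → ℝ≥0∞) (x y : E) : ℝ≥0∞ :=
  if x ∈ U ∧ y ∈ U then g x y else 0

open Classical in
/-- The values of `f` that are less than `1`. -/
noncomputable def smallValues {X : Type*} (f : X → X → ℝ≥0∞) (x y : X) : ℝ≥0∞ :=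
  if f x y < 1 then f x y else 0

open Classical in
/-- The values of `f` that are at least `1`. -/
noncomputable def largeValues {X : Type*} (f : X → X → ℝ≥0∞) (x y : X) : ℝ≥0∞ :=
  if 1 ≤ f x y then f x y else 0

lemma measurable_pairsIn {U : Set E} (hU : MeasurableSet U) {g : E → E → ℝ≥0∞}
    (hg : Measurable (Function.uncurry g)) : Measurable (Function.uncurry (pairsIn U g)) := by
  classical
  exact Measurable.ite ((measurable_fst hU).inter (measurable_snd hU)) hg measurable_const

lemma measurable_smallValues {X : Type*} [MeasurableSpace X] {f : X → X → ℝ≥0∞}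
    (hf : Measurable (Function.uncurry f)) :
    Measurable (Function.uncurry (smallValues f)) := by
  classical
  exact Measurable.ite (measurableSet_lt hf measurable_const) hf measurable_const

lemma smallValues_add_largeValues {X : Type*} (f : X → X → ℝ≥0∞) (x y : X) :
    smallValues f x y + largeValues f x y = f x y := by
  by_cases h : f x y < 1
  · simp [smallValues, largeValues, h, not_le.2 h]
  · simp [smallValues, largeValues, h, not_lt.1 h]

variable (μ) in
/-- The part of the Gagliardo energy on `V` due to the values of `f` that are less than `1`. -/
noncomputable def smallEnergy (V : Set E) (f : E → E → ℝ≥0∞) (p q : ℝ) : ℝ≥0∞ :=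
  pairIntegral μ (pairsIn V fun x y ↦ smallValues f x y ^ p) (normWeight (dim + q))

lemma middlePairs_le (V : Set E) (f : E → E → ℝ≥0∞) {p : ℝ} (hp : 0 < p) (x y : E) :
    middlePairs V f x y ≤ 2 ^ p * pairsIn V (fun x y ↦ smallValues f x y ^ p) x y := by
  unfold middlePairs
  split_ifs with h
  · obtain ⟨hx, hy, h1, h2⟩ := h
    rw [pairsIn, if_pos ⟨hx, hy⟩, smallValues, if_pos h2, ← ENNReal.mul_rpow_of_nonneg _ _ hp.le]
    exact ENNReal.one_le_rpow h1 hp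
  · simp

lemma rpow_le_largePairs_add {V : Set E} {f : E → E → ℝ≥0∞} {p : ℝ} (hp : 0 < p) {κ : ℝ≥0∞}
    (hfκ : ∀ x y, f x y ≤ κ) {x y : E} (hx : x ∈ V) (hy : y ∈ V) :
    f x y ^ p ≤ κ ^ p * largePairs V f x y + pairsIn V (fun x y ↦ smallValues f x y ^ p) x y := by
  rw [pairsIn, if_pos ⟨hx, hy⟩, smallValues, largePairs]
  by_cases h : f x y < 1
  · simp [h]
  · rw [if_pos ⟨hx, hy, not_lt.1 h⟩, mul_one]
    exact (ENNReal.rpow_le_rpow (hfκ x y) hp.le).trans le_self_add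

/-- Middle pairs carry small values bounded below by `1/2`, so they cost at most `2 ^ p` times the
small energy. -/
lemma largeEnergy_le [Nontrivial E] {V : Set E} (hV : Convex ℝ V) (hVm : MeasurableSet V)
    {f : E → E → ℝ≥0∞} (hf : Measurable (Function.uncurry f))
    (htri : ∀ x y z, f x z ≤ f x y + f y z) {p q : ℝ} (hp : 0 < p) (hq : 1 < q)
    (hfin : pairIntegral μ (largePairs V f) (normWeight (dim + 1)) ≠ ⊤) :
    pairIntegral μ (largePairs V f) (normWeight (dim + q))
      ≤ 2 ^ (dim + 1) * geomConst (q - 1) * 2 ^ p * smallEnergy μ V f p q := by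
  refine (pairIntegral_largePairs_le hV hVm hf htri hq hfin).trans ?_
  rw [mul_assoc _ ((2 : ℝ≥0∞) ^ p), smallEnergy, ← pairIntegral_const_mul_left (c := 2 ^ p)
    (by finiteness)]
  refine mul_le_mul_right (pairIntegral_mono fun x h ↦ ?_) _
  exact mul_le_mul_left (middlePairs_le V f hp _ _) _

lemma setLIntegral_ball_eq (j : ℕ) (x : E) (g : E → ℝ≥0∞) :
    ∫⁻ y in Metric.ball x ((2 : ℝ) ^ j)⁻¹, g y ∂μ = ∫⁻ h in dyadicBall E j, g (x + h) ∂μ := by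
  rw [← lintegral_indicator (measurableSet_dyadicBall _),
    ← lintegral_indicator measurableSet_ball, ← lintegral_add_left_eq_self (μ := μ) _ x]
  refine lintegral_congr fun h ↦ ?_
  have : x + h ∈ Metric.ball x ((2 : ℝ) ^ j)⁻¹ ↔ h ∈ dyadicBall E j := by
    rw [dyadicBall_eq_ball]; simp
  by_cases hh : h ∈ dyadicBall E j
  · rw [indicator_of_mem hh, indicator_of_mem (this.2 hh)]
  · rw [indicator_of_notMem hh, indicator_of_notMem (fun h' ↦ hh (this.1 h'))]

/-- The Poincaré inequality on a ball with `ρ = 2 * 2 ^ (-j)`. Two normalizations `2 ^ (j dim)`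
stand against `ρ ^ (dim + 1)`: one of them turns the integral of the density into an average, and
the other leaves a gain of `2 ^ (-j)`. -/
lemma meanOsc_largeValues_le [Nontrivial E] {V : Set E} {j : ℕ} {x : E}
    (hx : Metric.ball x ((2 : ℝ) ^ j)⁻¹ ⊆ V)
    {f : E → E → ℝ≥0∞} (hf : Measurable (Function.uncurry f))
    (htri : ∀ x y z, f x z ≤ f x y + f y z) {κ : ℝ≥0∞} (hκ : κ ≠ ⊤) (hfκ : ∀ x y, f x y ≤ κ)
    (hfin : pairIntegral μ (largePairs V f) (normWeight (dim + 1)) ≠ ⊤) :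
    meanOsc μ (largeValues f) j x ≤ (ballVolume (E := E) μ)⁻¹ * 2 ^ (dim + 2) * geomConst (dim + 1)
      * ((2 ^ j)⁻¹ * ∫⁻ h, largeDensity μ V f 1 (x + h) ∂ballProb μ j) := by
  have hvt : (ballVolume (E := E) μ)⁻¹ ≠ ⊤ := ENNReal.inv_ne_top.2 ballVolume_ne_zero
  have key := lintegral_large_le hx (convex_ball x _) measurableSet_ball hf htri hκ hfκ hfin
    (ρ := 2 * (2 ^ j)⁻¹) (by finiteness) (fun y hy z hz ↦ by
      have h1 : edist y x < (2 ^ j)⁻¹ := by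
        rw [edist_dist]
        have : ((2 : ℝ≥0∞) ^ j)⁻¹ = ENNReal.ofReal ((2 : ℝ) ^ j)⁻¹ := by
          rw [ENNReal.ofReal_inv_of_pos (by positivity), ENNReal.ofReal_pow (by norm_num)]; simp
        rw [this]
        exact (ENNReal.ofReal_lt_ofReal_iff (by positivity)).2 hy
      have h2 : edist z x < (2 ^ j)⁻¹ := by
        rw [edist_dist]
        have : ((2 : ℝ≥0∞) ^ j)⁻¹ = ENNReal.ofReal ((2 : ℝ) ^ j)⁻¹ := by
          rw [ENNReal.ofReal_inv_of_pos (by positivity), ENNReal.ofReal_pow (by norm_num)]; simp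
        rw [this]
        exact (ENNReal.ofReal_lt_ofReal_iff (by positivity)).2 hz
      calc edist y z ≤ edist y x + edist z x := edist_triangle_right _ _ _
        _ < (2 ^ j)⁻¹ + (2 ^ j)⁻¹ := ENNReal.add_lt_add h1 h2
        _ = _ := (two_mul _).symm)
  have hL : meanOsc μ (largeValues f) j x = ((ballVolume (E := E) μ)⁻¹ * (2 ^ j) ^ dim)
      * (((ballVolume (E := E) μ)⁻¹ * (2 ^ j) ^ dim)
      * ∫⁻ y in Metric.ball x ((2 : ℝ) ^ j)⁻¹, ∫⁻ z in Metric.ball x ((2 : ℝ) ^ j)⁻¹,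
        largeValues f y z ∂μ ∂μ) := by
    simp_rw [setLIntegral_ball_eq]
    rw [meanOsc]
    simp_rw [lintegral_ballProb]
    rw [lintegral_const_mul' _ _ (by finiteness)]
  have h2 : ((2 : ℝ≥0∞) ^ j) ^ dim * (2 * (2 ^ j)⁻¹) ^ (dim + 1)
      = 2 ^ (dim + 1) * (2 ^ j)⁻¹ := by
    rw [mul_pow, pow_succ (((2 : ℝ≥0∞) ^ j)⁻¹), ← mul_assoc, mul_comm _ ((2 : ℝ≥0∞) ^ (dim + 1)),
      mul_assoc, ← mul_assoc _ _ ((2 : ℝ≥0∞) ^ j)⁻¹, ← mul_pow,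
      ENNReal.mul_inv_cancel (by simp) (by simp), one_pow, one_mul]
  rw [hL, lintegral_ballProb, ← setLIntegral_ball_eq]
  calc _ ≤ ((ballVolume (E := E) μ)⁻¹ * (2 ^ j) ^ dim)
      * (((ballVolume (E := E) μ)⁻¹ * (2 ^ j) ^ dim) * (2 * geomConst (dim + 1)
        * (2 * (2 ^ j)⁻¹) ^ (dim + 1)
        * ∫⁻ z in Metric.ball x ((2 : ℝ) ^ j)⁻¹, largeDensity μ V f 1 z ∂μ)) :=
        mul_le_mul_right (mul_le_mul_right key _) _
    _ = (ballVolume (E := E) μ)⁻¹ * (2 * (((2 : ℝ≥0∞) ^ j) ^ dim * (2 * (2 ^ j)⁻¹) ^ (dim + 1)))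
        * geomConst (dim + 1) * ((ballVolume (E := E) μ)⁻¹ * (2 ^ j) ^ dim
        * ∫⁻ z in Metric.ball x ((2 : ℝ) ^ j)⁻¹, largeDensity μ V f 1 z ∂μ) := by ring
    _ = _ := by rw [h2]; ring

/-- The inner ball has radius `1/4`, so the dyadic balls centered at its points, of radius at most
1, stay in the outer ball of radius 2. -/
lemma add_mem_ball_two {x : E} (hx : x ∈ dyadicBall E 2) {j : ℕ} {h : E} (hh : h ∈ dyadicBall E j) :
    x + h ∈ Metric.ball (0 : E) 2 := by
  rw [dyadicBall_eq_ball, mem_ball_zero_iff] at hx hh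
  rw [mem_ball_zero_iff]
  have h1 : ((2 : ℝ) ^ j)⁻¹ ≤ 1 := inv_le_one_of_one_le₀ (one_le_pow₀ (by norm_num))
  calc ‖x + h‖ ≤ ‖x‖ + ‖h‖ := norm_add_le _ _
    _ < 2 := by norm_num at hx; linarith

lemma ball_subset_ball_two {x : E} (hx : x ∈ dyadicBall E 2) (j : ℕ) :
    Metric.ball x ((2 : ℝ) ^ j)⁻¹ ⊆ Metric.ball (0 : E) 2 := by
  intro y hy
  have : y - x ∈ dyadicBall E j := by
    rw [dyadicBall_eq_ball, mem_ball_zero_iff]; simpa [dist_eq_norm] using hy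
  simpa using add_mem_ball_two hx this

lemma smallValues_pairsIn_rpow {V : Set E} {f : E → E → ℝ≥0∞} {p : ℝ} (hp : 0 < p) (x y : E) :
    pairsIn V (smallValues f) x y ^ p = pairsIn V (fun x y ↦ smallValues f x y ^ p) x y := by
  unfold pairsIn
  split_ifs
  · rfl
  · simp [hp]

lemma meanOsc_le_add [Nontrivial E] {f : E → E → ℝ≥0∞} (hf : Measurable (Function.uncurry f))
    (j : ℕ) {x : E} (hx : x ∈ dyadicBall E 2) :
    meanOsc μ f j x ≤ meanOsc μ (pairsIn (Metric.ball 0 2) (smallValues f)) j x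
      + meanOsc μ (largeValues f) j x := by
  have hm := measurable_add_add (measurable_pairsIn (U := Metric.ball (0 : E) 2) measurableSet_ball
    (measurable_smallValues hf)) x
  have hm1 : ∀ h : E, Measurable fun k ↦
      pairsIn (Metric.ball 0 2) (smallValues f) (x + h) (x + k) :=
    fun h ↦ hm.comp measurable_prodMk_left
  have hm2 : Measurable fun h ↦ ∫⁻ k, pairsIn (Metric.ball 0 2) (smallValues f) (x + h) (x + k)
      ∂ballProb μ j := hm.lintegral_prod_right
  unfold meanOsc
  rw [← lintegral_add_left hm2]
  refine lintegral_ballProb_mono_fun fun h hh ↦ ?_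
  rw [← lintegral_add_left (hm1 h)]
  refine lintegral_ballProb_mono_fun fun k hk ↦ ?_
  rw [pairsIn, if_pos ⟨add_mem_ball_two hx hh, add_mem_ball_two hx hk⟩,
    smallValues_add_largeValues]

/-- The estimate of the oscillations at all scales. -/
lemma exists_tsum_meanOsc_le [Nontrivial E] (μ : Measure E) [μ.IsAddHaarMeasure] {p q : ℝ}
    (hq : 1 < q) (hqp : q < p) (hd : (dim : ℝ) ≤ q) :
    ∃ C : ℝ≥0∞, C ≠ ⊤ ∧ ∀ f : E → E → ℝ≥0∞, Measurable (Function.uncurry f) →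
      (∀ x y z, f x z ≤ f x y + f y z) → ∀ κ : ℝ≥0∞, κ ≠ ⊤ → (∀ x y, f x y ≤ κ) →
      pairIntegral μ (largePairs (Metric.ball 0 2) f) (normWeight (dim + 1)) ≠ ⊤ →
      ∫⁻ x in dyadicBall E 2, ∑' j : ℕ, ((2 : ℝ≥0∞) ^ j) ^ q * meanOsc μ f j x ^ p ∂μ
        ≤ C * (smallEnergy μ (Metric.ball 0 2) f p q
          + smallEnergy μ (Metric.ball 0 2) f p q ^ (p / q)) := by
  have hp : 1 < p := hq.trans hqp
  have hp0 : 0 < p := by linarith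
  have hq0 : 0 < q := by linarith
  have hvt : (ballVolume (E := E) μ)⁻¹ ≠ ⊤ := ENNReal.inv_ne_top.2 ballVolume_ne_zero
  obtain ⟨CI, hCI, hI⟩ := exists_tsum_lintegral_average_le μ hq hqp hd
  set V : Set E := Metric.ball 0 2 with hV
  -- `C1` comes from the Poincaré inequality for the large values, `C2` from the sum over scales of
  -- the oscillations of the small values, `C3` from the `L ^ q` bound of the density by the small
  -- energy.
  set C1 : ℝ≥0∞ := (ballVolume (E := E) μ)⁻¹ * 2 ^ (dim + 2) * geomConst (dim + 1) with hC1
  set C2 : ℝ≥0∞ := (ballVolume (E := E) μ)⁻¹ * geomConst (dim + q) * 2 ^ ((dim : ℝ) + q) with hC2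
  set C3 : ℝ≥0∞ := (tailConst (E := E) μ + 1) ^ q * (2 ^ (dim + 1) * geomConst (q - 1) * 2 ^ p)
    with hC3
  have hC1t : C1 ≠ ⊤ := ENNReal.mul_ne_top (by finiteness) (geomConst_ne_top (by positivity))
  have hC2t : C2 ≠ ⊤ := ENNReal.mul_ne_top
    (ENNReal.mul_ne_top hvt (geomConst_ne_top (by positivity))) (by finiteness)
  have hC3t : C3 ≠ ⊤ := ENNReal.mul_ne_top (ENNReal.rpow_ne_top_of_nonneg hq0.le
    (ENNReal.add_ne_top.2 ⟨tailConst_ne_top, by simp⟩)) (ENNReal.mul_ne_top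
    (ENNReal.mul_ne_top (by finiteness) (geomConst_ne_top (by linarith))) (by finiteness))
  refine ⟨2 ^ (p - 1) * (C2 + C1 ^ p * (CI * C3 ^ (p / q))), by
    have := ENNReal.rpow_ne_top_of_nonneg hp0.le hC1t
    have := ENNReal.rpow_ne_top_of_nonneg (y := p / q) (by positivity) hC3t
    have h2 : (2 : ℝ≥0∞) ^ (p - 1) ≠ ⊤ := ENNReal.rpow_ne_top_of_nonneg (by linarith) (by simp)
    finiteness, ?_⟩
  intro f hf htri κ hκ hfκ hfin
  set T := smallEnergy μ V f p q with hT
  set Γ := largeDensity μ V f 1 with hΓ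
  have hΓm : Measurable Γ := measurable_largeDensity measurableSet_ball hf 1
  have hsm := measurable_pairsIn (U := V) measurableSet_ball (measurable_smallValues hf)
  have hΓq : ∫⁻ z, Γ z ^ q ∂μ ≤ C3 * T := by
    refine (lintegral_largeDensity_rpow_le measurableSet_ball hf hq).trans ?_
    rw [hC3, mul_assoc]
    exact mul_le_mul_right (largeEnergy_le (convex_ball _ _) measurableSet_ball hf htri hp0 hq
      hfin) _
  have h2 : ∀ j : ℕ, ((2 : ℝ≥0∞) ^ j) ^ q ≠ ⊤ := fun j ↦
    ENNReal.rpow_ne_top_of_nonneg hq0.le (by simp)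
  have hC1p : C1 ^ p ≠ ⊤ := ENNReal.rpow_ne_top_of_nonneg hp0.le hC1t
  have h2p : (2 : ℝ≥0∞) ^ (p - 1) ≠ ⊤ := ENNReal.rpow_ne_top_of_nonneg (by linarith) (by simp)
  have hA : ∑' j : ℕ, ((2 : ℝ≥0∞) ^ j) ^ q
      * ∫⁻ x, meanOsc μ (pairsIn V (smallValues f)) j x ^ p ∂μ ≤ C2 * T := by
    refine le_trans ?_ (tsum_lintegral_meanOsc_le (μ := μ)
      (g := pairsIn V fun x y ↦ smallValues f x y ^ p)
      (measurable_pairsIn measurableSet_ball ((measurable_smallValues hf).pow_const p)) hq0)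
    refine ENNReal.tsum_le_tsum fun j ↦ mul_le_mul_right (lintegral_mono fun x ↦ ?_) _
    refine (meanOsc_rpow_le hsm hp.le j x).trans_eq ?_
    simp_rw [smallValues_pairsIn_rpow hp0]
  have hB := hI Γ hΓm
  set S : ℕ → E → ℝ≥0∞ := fun j x ↦ meanOsc μ (pairsIn V (smallValues f)) j x ^ p with hS
  set R : ℕ → E → ℝ≥0∞ := fun j x ↦ ((2 ^ j)⁻¹ * ∫⁻ h, Γ (x + h) ∂ballProb μ j) ^ p with hR
  have hSm : ∀ j, Measurable (S j) := fun j ↦ (measurable_meanOsc hsm j).pow_const p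
  have hRm : ∀ j, Measurable (R j) := fun j ↦
    ((measurable_lintegral_ballProb j hΓm).const_mul _).pow_const p
  have hpt : ∀ x ∈ dyadicBall E 2, ∀ j, meanOsc μ f j x ^ p
      ≤ 2 ^ (p - 1) * (S j x + C1 ^ p * R j x) := by
    intro x hx j
    calc meanOsc μ f j x ^ p
        ≤ (meanOsc μ (pairsIn V (smallValues f)) j x
          + C1 * ((2 ^ j)⁻¹ * ∫⁻ h, Γ (x + h) ∂ballProb μ j)) ^ p :=
          ENNReal.rpow_le_rpow ((meanOsc_le_add hf j hx).trans (add_le_add_right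
            (meanOsc_largeValues_le (ball_subset_ball_two hx j) hf htri hκ hfκ hfin) _)) hp0.le
      _ ≤ _ := by
          refine (ENNReal.rpow_add_le_mul_rpow_add_rpow _ _ hp.le).trans_eq ?_
          rw [ENNReal.mul_rpow_of_nonneg _ _ hp0.le]
  calc _ = ∑' j : ℕ, ((2 : ℝ≥0∞) ^ j) ^ q * ∫⁻ x in dyadicBall E 2, meanOsc μ f j x ^ p ∂μ := by
        rw [lintegral_tsum fun j ↦
          (((measurable_meanOsc hf j).pow_const p).const_mul _).aemeasurable]
        exact tsum_congr fun j ↦ lintegral_const_mul' _ _ (h2 j)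
    _ ≤ ∑' j : ℕ, ((2 : ℝ≥0∞) ^ j) ^ q
        * (2 ^ (p - 1) * (∫⁻ x, S j x ∂μ + C1 ^ p * ∫⁻ x, R j x ∂μ)) := by
        refine ENNReal.tsum_le_tsum fun j ↦ mul_le_mul_right ?_ _
        rw [← lintegral_const_mul' _ _ hC1p, ← lintegral_add_left (hSm j),
          ← lintegral_const_mul' _ _ h2p]
        exact (setLIntegral_mono' (measurableSet_dyadicBall 2) fun x hx ↦ hpt x hx j).trans
          (setLIntegral_le_lintegral _ _)
    _ = 2 ^ (p - 1) * (∑' j : ℕ, ((2 : ℝ≥0∞) ^ j) ^ q * ∫⁻ x, S j x ∂μ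
        + C1 ^ p * ∑' j : ℕ, ((2 : ℝ≥0∞) ^ j) ^ q * ∫⁻ x, R j x ∂μ) := by
        rw [← ENNReal.tsum_mul_left (a := C1 ^ p), ← ENNReal.tsum_add, ← ENNReal.tsum_mul_left]
        exact tsum_congr fun j ↦ by ring
    _ ≤ 2 ^ (p - 1) * (C2 * T + C1 ^ p * (CI * (C3 * T) ^ (p / q))) := by
        have hB' := hB.trans (mul_le_mul_right (ENNReal.rpow_le_rpow hΓq
          (by positivity : 0 ≤ p / q)) CI)
        exact mul_le_mul_right (add_le_add hA (mul_le_mul_right hB' _)) _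
    _ ≤ _ := by
        rw [ENNReal.mul_rpow_of_nonneg _ _ (by positivity : 0 ≤ p / q),
          mul_assoc ((2 : ℝ≥0∞) ^ (p - 1))]
        refine mul_le_mul_right ?_ _
        rw [mul_add, add_mul, add_mul]
        refine add_le_add le_self_add (le_add_left (le_of_eq ?_))
        ring

end LocalEstimate

end FractionalLifting

namespace FractionalLifting

/-! ### The nonlinear estimate in a Euclidean ball -/

section LocalTheorem

variable {E : Type*} [NormedAddCommGroup E] [NormedSpace ℝ E] [FiniteDimensional ℝ E]
  [MeasurableSpace E] [BorelSpace E] {μ : Measure E} [μ.IsAddHaarMeasure]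

local notation "dim" => Module.finrank ℝ E

/-- Qualitative: it provides the finiteness without which nothing can be absorbed in the Hardy
inequality. The bound depends on `κ`, but only its finiteness is used. -/
lemma lintegral_tsum_meanFrom_ne_top [Nontrivial E] {f : E → E → ℝ≥0∞}
    (hf : Measurable (Function.uncurry f)) {κ : ℝ≥0∞} (hκ : κ ≠ ⊤) (hfκ : ∀ x y, f x y ≤ κ)
    {p q : ℝ} (hp : 1 < p) (hq : 0 < q)
    (hlarge : pairIntegral μ (largePairs (Metric.ball 0 2) f) (normWeight (dim + q)) ≠ ⊤)
    (hsmall : smallEnergy μ (Metric.ball 0 2) f p q ≠ ⊤) :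
    ∫⁻ x in dyadicBall E 2, ∑' j : ℕ, ((2 : ℝ≥0∞) ^ j) ^ q * meanFrom μ f j x ^ p ∂μ ≠ ⊤ := by
  have hp0 : 0 < p := by linarith
  have hdq : 0 < (dim : ℝ) + q := by positivity
  have hvt : (ballVolume (E := E) μ)⁻¹ ≠ ⊤ := ENNReal.inv_ne_top.2 ballVolume_ne_zero
  have hgt := geomConst_ne_top hdq
  set V : Set E := Metric.ball 0 2 with hV
  have hκp : κ ^ p ≠ ⊤ := ENNReal.rpow_ne_top_of_nonneg hp0.le hκ
  have hm : ∀ x, Measurable fun h ↦ f x (x + h) ^ p := fun x ↦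
    (measurable_pair_right hf x).pow_const p
  have hae : ∀ᵐ h : E ∂μ, h ≠ 0 := by simp [ae_iff, measure_singleton]
  have hpt : ∀ x, ∑' j : ℕ, ((2 : ℝ≥0∞) ^ j) ^ q * meanFrom μ f j x ^ p
      ≤ (ballVolume (E := E) μ)⁻¹ * geomConst (dim + q)
        * ∫⁻ h in dyadicBall E 0, f x (x + h) ^ p * normWeight (dim + q) h ∂μ := by
    intro x
    calc _ ≤ ∑' j : ℕ, (ballVolume (E := E) μ)⁻¹ * ∫⁻ h, ((2 : ℝ≥0∞) ^ j) ^ ((dim : ℝ) + q)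
            * (dyadicBall E j).indicator (fun h ↦ f x (x + h) ^ p) h ∂μ := by
          refine ENNReal.tsum_le_tsum fun j ↦ ?_
          rw [lintegral_const_mul' _ _ (ENNReal.rpow_ne_top_of_nonneg hdq.le (by simp)),
            lintegral_indicator (measurableSet_dyadicBall j), two_pow_rpow_add,
            ENNReal.rpow_natCast]
          refine (mul_le_mul_right (rpow_lintegral_le
            (measurable_pair_right hf x).aemeasurable hp.le) _).trans_eq ?_
          rw [lintegral_ballProb]
          ring
      _ = (ballVolume (E := E) μ)⁻¹ * ∫⁻ h, ∑' j : ℕ, ((2 : ℝ≥0∞) ^ j) ^ ((dim : ℝ) + q)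
            * (dyadicBall E j).indicator (fun h ↦ f x (x + h) ^ p) h ∂μ := by
          rw [ENNReal.tsum_mul_left, lintegral_tsum fun j ↦
            (((hm x).indicator (measurableSet_dyadicBall j)).const_mul _).aemeasurable]
      _ ≤ (ballVolume (E := E) μ)⁻¹ * ∫⁻ h, geomConst (dim + q) * (dyadicBall E 0).indicator
            (fun h ↦ f x (x + h) ^ p * normWeight (dim + q) h) h ∂μ := by
          refine mul_le_mul_right (lintegral_mono_ae ?_) _
          filter_upwards [hae] with h hh
          have hn : ‖h‖ₑ ≠ 0 := by simpa using hh
          by_cases h0 : h ∈ dyadicBall E 0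
          · rw [indicator_of_mem h0]
            calc _ = (∑' j : ℕ, (if (2 : ℝ≥0∞) ^ j < ‖h‖ₑ⁻¹
                  then ((2 : ℝ≥0∞) ^ j) ^ ((dim : ℝ) + q) else 0)) * f x (x + h) ^ p := by
                  rw [← ENNReal.tsum_mul_right]
                  refine tsum_congr fun j ↦ ?_
                  have hiff : (2 : ℝ≥0∞) ^ j < ‖h‖ₑ⁻¹ ↔ h ∈ dyadicBall E j := by
                    rw [← one_div, ENNReal.lt_div_iff_mul_lt (Or.inl hn) (Or.inl enorm_ne_top)]
                    rfl
                  by_cases hj : h ∈ dyadicBall E j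
                  · rw [indicator_of_mem hj, if_pos (hiff.2 hj)]
                  · rw [indicator_of_notMem hj, if_neg (fun h' ↦ hj (hiff.1 h')), mul_zero,
                      zero_mul]
              _ ≤ geomConst (dim + q) * ‖h‖ₑ⁻¹ ^ ((dim : ℝ) + q) * f x (x + h) ^ p :=
                  mul_le_mul_left (tsum_dyadic_lt_le hdq _) _
              _ = _ := by
                  rw [normWeight, ENNReal.inv_rpow, ENNReal.rpow_neg]
                  ring
          · have : ∀ j : ℕ, h ∉ dyadicBall E j := fun j hj ↦ h0 (by
              induction j with
              | zero => exact hj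
              | succ j ih => exact ih (dyadicBall_succ_subset j hj))
            simp [indicator_of_notMem (this _)]
      _ = _ := by
          rw [lintegral_const_mul' _ _ hgt, lintegral_indicator (measurableSet_dyadicBall 0),
            mul_assoc]
  have hVm : MeasurableSet V := measurableSet_ball
  have hsm : Measurable (Function.uncurry (pairsIn V fun x y ↦ smallValues f x y ^ p)) :=
    measurable_pairsIn measurableSet_ball ((measurable_smallValues hf).pow_const p)
  have hlm : Measurable (Function.uncurry fun x y ↦ κ ^ p * largePairs V f x y) :=
    (measurable_largePairs hVm hf).const_mul _
  have hfinal : ∫⁻ x in dyadicBall E 2, ∑' j : ℕ, ((2 : ℝ≥0∞) ^ j) ^ q * meanFrom μ f j x ^ p ∂μ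
      ≤ (ballVolume (E := E) μ)⁻¹ * geomConst (dim + q)
        * (κ ^ p * pairIntegral μ (largePairs V f) (normWeight (dim + q))
          + smallEnergy μ V f p q) := by
    rw [← pairIntegral_const_mul_left hκp, smallEnergy,
      ← pairIntegral_add_left hlm (measurable_normWeight _), pairIntegral,
      ← lintegral_const_mul' _ _ (ENNReal.mul_ne_top hvt hgt)]
    refine (setLIntegral_mono' (measurableSet_dyadicBall 2) fun x hx ↦ ?_).trans
      (setLIntegral_le_lintegral _ _)
    refine (hpt x).trans (mul_le_mul_right ?_ _)
    refine (setLIntegral_mono' (measurableSet_dyadicBall 0) fun h hh ↦ ?_).trans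
      (setLIntegral_le_lintegral _ _)
    refine mul_le_mul_left (rpow_le_largePairs_add hp0 hfκ ?_ (add_mem_ball_two hx hh)) _
    exact ball_subset_ball_two hx 0 (Metric.mem_ball_self (by positivity))
  refine ne_top_of_le_ne_top (ENNReal.mul_ne_top (ENNReal.mul_ne_top hvt hgt)
    (ENNReal.add_ne_top.2 ⟨ENNReal.mul_ne_top hκp hlarge, hsmall⟩)) hfinal

/-- The energy is controlled by the averages at all scales. -/
lemma exists_pairIntegral_le_meanFrom [Nontrivial E] (μ : Measure E) [μ.IsAddHaarMeasure]
    {p q : ℝ} (hp : 1 < p) (hq : 0 < q) :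
    ∃ C : ℝ≥0∞, C ≠ ⊤ ∧ ∀ f : E → E → ℝ≥0∞, Measurable (Function.uncurry f) →
      (∀ x y, f x y = f y x) → (∀ x y z, f x z ≤ f x y + f y z) →
      pairIntegral μ (pairsIn (dyadicBall E 2) fun x y ↦ f x y ^ p) (normWeight (dim + q))
        ≤ C * ∫⁻ x in dyadicBall E 2, ∑' j : ℕ, ((2 : ℝ≥0∞) ^ j) ^ q * meanFrom μ f j x ^ p ∂μ := by
  have hp0 : 0 < p := by linarith
  have hdq : 0 < (dim : ℝ) + q := by positivity
  set U : Set E := dyadicBall E 2 with hU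
  have hUm : MeasurableSet U := measurableSet_dyadicBall 2
  set C0 : ℝ≥0∞ := 4 ^ ((dim : ℝ) + q) * ((2 ^ dim) ^ p * 2 ^ (p - 1)) with hC0
  have hC0t : C0 ≠ ⊤ := by
    have h1 : (4 : ℝ≥0∞) ^ ((dim : ℝ) + q) ≠ ⊤ := ENNReal.rpow_ne_top_of_nonneg hdq.le (by simp)
    have h2 : ((2 : ℝ≥0∞) ^ dim) ^ p ≠ ⊤ := ENNReal.rpow_ne_top_of_nonneg hp0.le (by simp)
    have h3 : (2 : ℝ≥0∞) ^ (p - 1) ≠ ⊤ := ENNReal.rpow_ne_top_of_nonneg (by linarith) (by simp)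
    exact ENNReal.mul_ne_top h1 (ENNReal.mul_ne_top h2 h3)
  refine ⟨2 * C0 * ballVolume (E := E) μ,
    ENNReal.mul_ne_top (ENNReal.mul_ne_top (by simp) hC0t) ballVolume_ne_top, ?_⟩
  intro f hf hsymm htri
  have hae : ∀ᵐ h : E ∂μ, h ≠ 0 := by simp [ae_iff, measure_singleton]
  set W : ℕ → E → ℝ≥0∞ := fun j x ↦ U.indicator (fun x ↦ meanFrom μ f j x ^ p) x with hW
  have hWm : ∀ j, Measurable (W j) := fun j ↦
    ((measurable_meanFrom hf j).pow_const p).indicator hUm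
  set χ : ℕ → E → ℝ≥0∞ := fun j ↦ (dyadicBall E (j + 1)).indicator fun _ ↦
    ((2 : ℝ≥0∞) ^ j) ^ ((dim : ℝ) + q) with hχ
  have hχm : ∀ j, Measurable (χ j) := fun j ↦
    measurable_const.indicator (measurableSet_dyadicBall _)
  -- Each `h` lies in an annulus `2 ^ (-(j + 2)) ≤ ‖h‖ < 2 ^ (-(j + 1))`. There the kernel is at
  -- most `4 ^ (dim + q) * 2 ^ (j (dim + q))`, and the value of `f` is controlled by the means at
  -- scale `j` at both endpoints.
  have hpt : ∀ x h : E, h ≠ 0 → pairsIn U (fun x y ↦ f x y ^ p) x (x + h) * normWeight (dim + q) h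
      ≤ C0 * ∑' j, χ j h * (W j x + W j (x + h)) := by
    intro x h hh
    unfold pairsIn
    split_ifs with hxy
    swap
    · simp
    obtain ⟨hx, hy⟩ := hxy
    have hn : ‖h‖ₑ ≠ 0 := by simpa using hh
    have h1 : h ∈ dyadicBall E 1 := by
      have hx' : (2 : ℝ≥0∞) ^ 2 * ‖x‖ₑ < 1 := hx
      have hy' : (2 : ℝ≥0∞) ^ 2 * ‖x + h‖ₑ < 1 := hy
      have h3 : ‖h‖ₑ ≤ ‖x + h‖ₑ + ‖x‖ₑ := by
        calc ‖h‖ₑ = ‖(x + h) - x‖ₑ := by simp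
          _ ≤ _ := enorm_sub_le
      change (2 : ℝ≥0∞) ^ 1 * ‖h‖ₑ < 1
      have h4 : 2 * ((2 : ℝ≥0∞) ^ 1 * ‖h‖ₑ) < 2 * 1 := by
        calc 2 * (2 ^ 1 * ‖h‖ₑ) ≤ 2 * (2 ^ 1 * (‖x + h‖ₑ + ‖x‖ₑ)) := by gcongr
          _ = 2 ^ 2 * ‖x + h‖ₑ + 2 ^ 2 * ‖x‖ₑ := by ring
          _ < 1 + 1 := ENNReal.add_lt_add hy' hx'
          _ = 2 * 1 := by norm_num
      exact (ENNReal.mul_lt_mul_iff_right (by simp) (by simp)).1 h4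
    have hex : ∃ n : ℕ, h ∉ dyadicBall E n := by
      have hlim := ENNReal.tendsto_pow_atTop_nhds_top_iff.2 (show (1 : ℝ≥0∞) < 2 by norm_num)
      obtain ⟨n, hn'⟩ := (hlim.eventually (lt_mem_nhds (a := ‖h‖ₑ⁻¹)
        (ENNReal.inv_lt_top.2 (pos_iff_ne_zero.2 hn)))).exists
      refine ⟨n, fun hc ↦ ?_⟩
      have hc' : (2 : ℝ≥0∞) ^ n * ‖h‖ₑ < 1 := hc
      refine hc'.not_ge ?_
      rw [← ENNReal.inv_mul_cancel hn enorm_ne_top]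
      exact mul_le_mul_left hn'.le _
    classical
    -- `j + 2` is the index of the first dyadic ball that misses `h`; it is at least 2 since `‖h‖ <
    -- 1/2`.
    obtain ⟨j, hj1, hj2⟩ : ∃ j : ℕ, h ∈ dyadicBall E (j + 1) ∧ h ∉ dyadicBall E (j + 2) := by
      have h2 : Nat.find hex ≠ 0 := fun h0 ↦
        (Nat.find_spec hex) (h0 ▸ dyadicBall_succ_subset 0 h1)
      have h3 : Nat.find hex ≠ 1 := fun h0 ↦ (Nat.find_spec hex) (h0 ▸ h1)
      obtain ⟨j, hj⟩ : ∃ j, Nat.find hex = j + 2 := ⟨Nat.find hex - 2, by omega⟩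
      refine ⟨j, ?_, hj ▸ Nat.find_spec hex⟩
      have := Nat.find_min hex (m := j + 1) (by omega)
      exact not_not.1 this
    have hw : normWeight (dim + q) h ≤ 4 ^ ((dim : ℝ) + q) * χ j h := by
      have h2 : 1 ≤ (2 : ℝ≥0∞) ^ (j + 2) * ‖h‖ₑ := not_lt.1 hj2
      rw [hχ]
      simp only [indicator_of_mem hj1]
      rw [← ENNReal.mul_rpow_of_nonneg _ _ hdq.le, normWeight, ENNReal.rpow_neg,
        ← ENNReal.inv_rpow]
      refine ENNReal.rpow_le_rpow ?_ hdq.le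
      calc ‖h‖ₑ⁻¹ = 1 * ‖h‖ₑ⁻¹ := (one_mul _).symm
        _ ≤ 2 ^ (j + 2) * ‖h‖ₑ * ‖h‖ₑ⁻¹ := mul_le_mul_left h2 _
        _ = 2 ^ (j + 2) := by rw [mul_assoc, ENNReal.mul_inv_cancel hn enorm_ne_top, mul_one]
        _ = 4 * 2 ^ j := by rw [pow_add]; norm_num; ring
    calc f x (x + h) ^ p * normWeight (dim + q) h
        ≤ ((2 ^ dim) ^ p * 2 ^ (p - 1) * (W j x + W j (x + h)))
          * (4 ^ ((dim : ℝ) + q) * χ j h) := by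
          refine mul_le_mul' ?_ hw
          refine (ENNReal.rpow_le_rpow (le_meanFrom_add (μ := μ) hf hsymm htri j x hj1)
            hp0.le).trans ?_
          rw [ENNReal.mul_rpow_of_nonneg _ _ hp0.le, mul_assoc]
          refine mul_le_mul_right ?_ _
          rw [hW]
          simp only [indicator_of_mem hx, indicator_of_mem hy]
          exact ENNReal.rpow_add_le_mul_rpow_add_rpow _ _ hp.le
      _ = C0 * (χ j h * (W j x + W j (x + h))) := by rw [hC0]; ring
      _ ≤ _ := mul_le_mul_right (ENNReal.le_tsum j) _
  have hint : ∀ j, ∫⁻ h, χ j h ∂μ ≤ ballVolume (E := E) μ * ((2 : ℝ≥0∞) ^ j) ^ q := by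
    intro j
    rw [lintegral_indicator (measurableSet_dyadicBall _), setLIntegral_const, two_pow_rpow_add,
      ENNReal.rpow_natCast, ← measure_dyadicBall (μ := μ) j]
    calc _ ≤ ((2 : ℝ≥0∞) ^ j) ^ dim * (2 ^ j) ^ q * μ (dyadicBall E j) :=
          mul_le_mul_right (measure_mono (dyadicBall_succ_subset j)) _
      _ = _ := by ring
  have hsum : ∀ j, ∫⁻ x, ∫⁻ h, χ j h * (W j x + W j (x + h)) ∂μ ∂μ
      ≤ 2 * ballVolume (E := E) μ * (((2 : ℝ≥0∞) ^ j) ^ q * ∫⁻ x, W j x ∂μ) := by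
    intro j
    have m1 : Measurable fun z : E × E ↦ χ j z.2 * (W j z.1 + W j (z.1 + z.2)) :=
      ((hχm j).comp measurable_snd).mul (((hWm j).comp measurable_fst).add
        ((hWm j).comp (measurable_fst.add measurable_snd)))
    have hsw : ∫⁻ x, ∫⁻ h, χ j h * (W j x + W j (x + h)) ∂μ ∂μ
        = ∫⁻ h, ∫⁻ x, χ j h * (W j x + W j (x + h)) ∂μ ∂μ :=
      lintegral_lintegral_swap m1.aemeasurable
    rw [hsw]
    have : ∀ h, ∫⁻ x, χ j h * (W j x + W j (x + h)) ∂μ = χ j h * (2 * ∫⁻ x, W j x ∂μ) := by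
      intro h
      have hm : Measurable fun x ↦ W j x + W j (x + h) :=
        (hWm j).add ((hWm j).comp (measurable_add_const h))
      rw [lintegral_const_mul _ hm, lintegral_add_left (hWm j),
        lintegral_add_right_eq_self (W j) h, two_mul]
    simp_rw [this]
    rw [lintegral_mul_const _ (hχm j)]
    refine (mul_le_mul_left (hint j) _).trans_eq ?_
    ring
  have m2 : ∀ (j : ℕ) (x : E), Measurable fun h ↦ χ j h * (W j x + W j (x + h)) := fun j x ↦
    (hχm j).mul (measurable_const.add ((hWm j).comp (measurable_const_add x)))
  have m3 : ∀ j : ℕ, Measurable fun x ↦ ∫⁻ h, χ j h * (W j x + W j (x + h)) ∂μ := fun j ↦ by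
    have m1 : Measurable fun z : E × E ↦ χ j z.2 * (W j z.1 + W j (z.1 + z.2)) :=
      ((hχm j).comp measurable_snd).mul (((hWm j).comp measurable_fst).add
        ((hWm j).comp (measurable_fst.add measurable_snd)))
    exact m1.lintegral_prod_right'
  calc _ ≤ ∫⁻ x, ∫⁻ h, C0 * ∑' j, χ j h * (W j x + W j (x + h)) ∂μ ∂μ :=
        lintegral_mono fun x ↦ lintegral_mono_ae (by
          filter_upwards [hae] with h hh using hpt x h hh)
    _ = C0 * ∑' j, ∫⁻ x, ∫⁻ h, χ j h * (W j x + W j (x + h)) ∂μ ∂μ := by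
        simp_rw [lintegral_const_mul' _ _ hC0t, lintegral_tsum fun j ↦ (m2 j _).aemeasurable]
        rw [lintegral_tsum fun j ↦ (m3 j).aemeasurable]
    _ ≤ C0 * ∑' j : ℕ, 2 * ballVolume (E := E) μ * (((2 : ℝ≥0∞) ^ j) ^ q * ∫⁻ x, W j x ∂μ) :=
        mul_le_mul_right (ENNReal.tsum_le_tsum hsum) _
    _ = 2 * C0 * ballVolume (E := E) μ * ∑' j : ℕ, ((2 : ℝ≥0∞) ^ j) ^ q * ∫⁻ x, W j x ∂μ := by
        rw [ENNReal.tsum_mul_left]; ring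
    _ = _ := by
        rw [lintegral_tsum fun j ↦
          (((measurable_meanFrom hf j).pow_const p).const_mul _).aemeasurable]
        congr 1
        refine tsum_congr fun j ↦ ?_
        rw [lintegral_const_mul' _ _ (ENNReal.rpow_ne_top_of_nonneg hq.le (by simp)), hW]
        simp only
        rw [lintegral_indicator hUm]

/-- The nonlinear estimate in a ball of the Euclidean space, for a bounded pseudometric. -/
lemma exists_energy_le_of_bounded [Nontrivial E] (μ : Measure E) [μ.IsAddHaarMeasure] {p q : ℝ}
    (hq : 1 < q) (hqp : q < p) (hd : (dim : ℝ) ≤ q) :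
    ∃ C : ℝ≥0∞, C ≠ ⊤ ∧ ∀ f : E → E → ℝ≥0∞, Measurable (Function.uncurry f) →
      (∀ x y, f x y = f y x) → (∀ x y z, f x z ≤ f x y + f y z) →
      ∀ κ : ℝ≥0∞, κ ≠ ⊤ → (∀ x y, f x y ≤ κ) →
      pairIntegral μ (largePairs (Metric.ball 0 2) f) (normWeight (dim + 1)) ≠ ⊤ →
      pairIntegral μ (pairsIn (dyadicBall E 2) fun x y ↦ f x y ^ p) (normWeight (dim + q))
        ≤ C * (smallEnergy μ (Metric.ball 0 2) f p q
          + smallEnergy μ (Metric.ball 0 2) f p q ^ (p / q)) := by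
  have hp : 1 < p := hq.trans hqp
  have hp0 : 0 < p := by linarith
  have hq0 : 0 < q := by linarith
  obtain ⟨C1, hC1, h1⟩ := exists_tsum_meanOsc_le μ hq hqp hd
  obtain ⟨C2, hC2, h2⟩ := exists_pairIntegral_le_meanFrom μ hp hq0
  obtain ⟨C3, hC3, h3⟩ := exists_tsum_dyadic_le hp hq0 (D := 2 ^ dim) (by simp)
  -- The `+ 1` makes the constant nonzero, so that the estimate is trivial when the small energy is
  -- infinite.
  refine ⟨C2 * C3 * C1 + 1, by finiteness, ?_⟩
  intro f hf hsymm htri κ hκ hfκ hfin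
  by_cases hT : smallEnergy μ (Metric.ball 0 2) f p q = ⊤
  · rw [hT]
    simp
  have hlarge : pairIntegral μ (largePairs (Metric.ball 0 2) f) (normWeight (dim + q)) ≠ ⊤ :=
    ne_top_of_le_ne_top (ENNReal.mul_ne_top (ENNReal.mul_ne_top (ENNReal.mul_ne_top (by finiteness)
      (geomConst_ne_top (by linarith))) (by finiteness)) hT)
      (largeEnergy_le (convex_ball _ _) measurableSet_ball hf htri hp0 hq hfin)
  have hm : Measurable fun x ↦ ∑' j : ℕ, ((2 : ℝ≥0∞) ^ j) ^ q * meanFrom μ f j x ^ p :=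
    Measurable.tsum fun j ↦ ((measurable_meanFrom hf j).pow_const p).const_mul _
  -- The Hardy inequality is applied at each point separately, hence needs finiteness at almost
  -- every point.
  have hae := ae_lt_top hm (lintegral_tsum_meanFrom_ne_top hf hκ hfκ hp hq0 hlarge hT)
  calc _ ≤ C2 * ∫⁻ x in dyadicBall E 2, ∑' j : ℕ, ((2 : ℝ≥0∞) ^ j) ^ q * meanFrom μ f j x ^ p ∂μ :=
        h2 f hf hsymm htri
    _ ≤ C2 * ∫⁻ x in dyadicBall E 2,
          C3 * ∑' j : ℕ, ((2 : ℝ≥0∞) ^ j) ^ q * meanOsc μ f j x ^ p ∂μ := by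
        refine mul_le_mul_right (lintegral_mono_ae ?_) _
        filter_upwards [hae] with x hx
        exact h3 _ _ (fun j ↦ meanFrom_le hf hsymm htri j x) hx.ne
    _ ≤ C2 * (C3 * (C1 * (smallEnergy μ (Metric.ball 0 2) f p q
          + smallEnergy μ (Metric.ball 0 2) f p q ^ (p / q)))) := by
        rw [lintegral_const_mul' _ _ hC3]
        exact mul_le_mul_right (mul_le_mul_right (h1 f hf htri κ hκ hfκ hfin) _) _
    _ = C2 * C3 * C1 * (smallEnergy μ (Metric.ball 0 2) f p q
          + smallEnergy μ (Metric.ball 0 2) f p q ^ (p / q)) := by ring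
    _ ≤ _ := mul_le_mul_left le_self_add _

/-- The nonlinear estimate in a ball of the Euclidean space. -/
theorem exists_energy_le [Nontrivial E] (μ : Measure E) [μ.IsAddHaarMeasure] {p q : ℝ}
    (hq : 1 < q) (hqp : q < p) (hd : (dim : ℝ) ≤ q) :
    ∃ C : ℝ≥0∞, C ≠ ⊤ ∧ ∀ f : E → E → ℝ≥0∞, Measurable (Function.uncurry f) →
      (∀ x y, f x y = f y x) → (∀ x y z, f x z ≤ f x y + f y z) → (∀ x y, f x y ≠ ⊤) →
      pairIntegral μ (largePairs (Metric.ball 0 2) f) (normWeight (dim + 1)) ≠ ⊤ →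
      pairIntegral μ (pairsIn (dyadicBall E 2) fun x y ↦ f x y ^ p) (normWeight (dim + q))
        ≤ C * (smallEnergy μ (Metric.ball 0 2) f p q
          + smallEnergy μ (Metric.ball 0 2) f p q ^ (p / q)) := by
  have hp0 : 0 < p := by linarith
  obtain ⟨C, hC, hmain⟩ := exists_energy_le_of_bounded μ hq hqp hd
  refine ⟨C, hC, fun f hf hsymm htri hft hfin ↦ ?_⟩
  set V : Set E := Metric.ball 0 2 with hV
  set U : Set E := dyadicBall E 2 with hU
  have hUm : MeasurableSet U := measurableSet_dyadicBall 2
  -- Truncation at a height at least 1 preserves the triangle inequality and changes neither the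
  -- large pairs nor the small values. The right side is therefore the same for all `n`, and
  -- monotone convergence concludes.
  set g : ℕ → E → E → ℝ≥0∞ := fun n x y ↦ min (f x y) (n + 1) with hg
  have hgm : ∀ n, Measurable (Function.uncurry (g n)) := fun n ↦ hf.min measurable_const
  have h1n : ∀ n : ℕ, (1 : ℝ≥0∞) ≤ n + 1 := fun n ↦ le_add_self
  have hlp : ∀ n, largePairs V (g n) = largePairs V f := by
    intro n; ext x y
    have : 1 ≤ g n x y ↔ 1 ≤ f x y := by
      change 1 ≤ min _ _ ↔ _
      simp [h1n n]
    by_cases h : x ∈ V ∧ y ∈ V ∧ 1 ≤ f x y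
    · rw [largePairs, largePairs, if_pos h, if_pos ⟨h.1, h.2.1, this.2 h.2.2⟩]
    · rw [largePairs, largePairs, if_neg h, if_neg fun h' ↦ h ⟨h'.1, h'.2.1, this.1 h'.2.2⟩]
  have hsv : ∀ n, smallValues (g n) = smallValues f := by
    intro n; ext x y
    have : ¬ ((n : ℝ≥0∞) + 1 < 1) := not_lt.2 (h1n n)
    by_cases h : f x y < 1
    · have h' : min (f x y) (n + 1) = f x y := min_eq_left (h.le.trans (h1n n))
      simp [smallValues, hg, h']
    · simp [smallValues, hg, h, this]
  have hbd : ∀ n, pairIntegral μ (pairsIn U fun x y ↦ g n x y ^ p) (normWeight (dim + q))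
      ≤ C * (smallEnergy μ V f p q + smallEnergy μ V f p q ^ (p / q)) := by
    intro n
    have := hmain (g n) (hgm n) (fun x y ↦ by simp only [hg, hsymm x y]) (fun x y z ↦ by
      simp only [hg]
      rcases le_total (f x y) (n + 1) with ha | ha
      · rcases le_total (f y z) (n + 1) with hb | hb
        · rw [min_eq_left ha, min_eq_left hb]; exact (min_le_left _ _).trans (htri x y z)
        · rw [min_eq_right hb]; exact (min_le_right _ _).trans le_add_self
      · rw [min_eq_right ha]; exact (min_le_right _ _).trans le_self_add)
      (n + 1) (by finiteness) (fun x y ↦ min_le_right _ _) (by rw [hlp]; exact hfin)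
    simpa only [smallEnergy, hsv] using this
  have hsup : pairIntegral μ (pairsIn U fun x y ↦ f x y ^ p) (normWeight (dim + q))
      = ⨆ n, pairIntegral μ (pairsIn U fun x y ↦ g n x y ^ p) (normWeight (dim + q)) := by
    have hPm : ∀ n, Measurable (Function.uncurry (pairsIn U fun x y ↦ g n x y ^ p)) := fun n ↦
      measurable_pairsIn hUm ((hgm n).pow_const p)
    rw [pairIntegral_eq_prod (measurable_pairsIn (g := fun x y ↦ f x y ^ p) hUm (hf.pow_const p))
      (measurable_normWeight _)]
    have hE := fun n ↦ pairIntegral_eq_prod (μ := μ) (hPm n) (measurable_normWeight (dim + q))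
    rw [iSup_congr hE]
    have hgmono : ∀ x y, Monotone fun n ↦ pairsIn U (fun x y ↦ g n x y ^ p) x y := by
      intro x y n k hnk
      change pairsIn U _ x y ≤ pairsIn U _ x y
      unfold pairsIn
      split_ifs
      · refine ENNReal.rpow_le_rpow (min_le_min_left _ ?_) hp0.le
        gcongr
      · exact le_rfl
    refine Eq.trans ?_ (lintegral_iSup
      (fun n ↦ measurable_pair_mul (hPm n) (measurable_normWeight _))
      (fun n k hnk z ↦ mul_le_mul_left (hgmono _ _ hnk) _))
    refine lintegral_congr fun z ↦ ?_
    change _ = ⨆ n, pairsIn U (fun x y ↦ g n x y ^ p) z.1 (z.1 + z.2) * normWeight (dim + q) z.2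
    rw [← ENNReal.iSup_mul]
    congr 1
    refine le_antisymm ?_ (iSup_le fun n ↦ ?_)
    · obtain ⟨n, hn⟩ := ENNReal.exists_nat_gt (hft z.1 (z.1 + z.2))
      refine le_iSup_of_le n ?_
      have : g n z.1 (z.1 + z.2) = f z.1 (z.1 + z.2) :=
        min_eq_left (hn.le.trans le_self_add)
      simp only [pairsIn, this]
      exact le_rfl
    · simp only [pairsIn]
      split_ifs
      · exact ENNReal.rpow_le_rpow (min_le_left _ _) hp0.le
      · exact le_rfl
  rw [hsup]
  exact iSup_le hbd

end LocalTheorem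

end FractionalLifting

namespace FractionalLifting

/-! ### Transfer of the estimate through a bi-Lipschitz chart -/

section Transfer

variable {E : Type*} [NormedAddCommGroup E] [NormedSpace ℝ E] [FiniteDimensional ℝ E]
  [MeasurableSpace E] [BorelSpace E] {μ : Measure E} [μ.IsAddHaarMeasure]
  {M : Type*} [MetricSpace M] [MeasurableSpace M] [BorelSpace M] [SecondCountableTopology M]

local notation "dim" => Module.finrank ℝ E

lemma pairIntegral_pairsIn {U : Set E} (hU : MeasurableSet U) (g : E → E → ℝ≥0∞)
    (φ : E → ℝ≥0∞) :
    pairIntegral μ (pairsIn U g) φ = ∫⁻ x in U, ∫⁻ y in U, g x y * φ (y - x) ∂μ ∂μ := by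
  rw [pairIntegral, ← lintegral_indicator hU]
  refine lintegral_congr fun x ↦ ?_
  have h1 : ∫⁻ h, pairsIn U g x (x + h) * φ h ∂μ = ∫⁻ y, pairsIn U g x y * φ (y - x) ∂μ := by
    rw [← lintegral_add_left_eq_self (μ := μ) (fun y ↦ pairsIn U g x y * φ (y - x)) x]
    simp
  rw [h1]
  by_cases hx : x ∈ U
  · rw [indicator_of_mem hx, ← lintegral_indicator hU]
    refine lintegral_congr fun y ↦ ?_
    by_cases hy : y ∈ U
    · rw [indicator_of_mem hy, pairsIn, if_pos ⟨hx, hy⟩]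
    · rw [indicator_of_notMem hy, pairsIn, if_neg fun h ↦ hy h.2, zero_mul]
  · rw [indicator_of_notMem hx]
    simp [pairsIn, hx]

/-- A chart at `x₀` which is bi-Lipschitz and comparable to the measures. -/
def HasRegularChart (μ : Measure E) (ν : Measure M) (x₀ : M) : Prop :=
  ∃ (ψ : E → M) (K : ℝ≥0), 1 ≤ K ∧ Measurable ψ ∧ ψ '' dyadicBall E 2 ∈ nhds x₀ ∧
    (∀ x ∈ Metric.ball (0 : E) 2, ∀ y ∈ Metric.ball (0 : E) 2,
      edist (ψ x) (ψ y) ≤ K * edist x y) ∧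
    (∀ x ∈ Metric.ball (0 : E) 2, ∀ y ∈ Metric.ball (0 : E) 2,
      edist x y ≤ K * edist (ψ x) (ψ y)) ∧
    (μ.restrict (Metric.ball 0 2)).map ψ ≤ (K : ℝ≥0∞) • ν ∧
    ν.restrict (ψ '' dyadicBall E 2) ≤ (K : ℝ≥0∞) • (μ.restrict (dyadicBall E 2)).map ψ

lemma setLIntegral_comp_le {ν : Measure M} {ψ : E → M} (hψ : Measurable ψ) {c : ℝ≥0∞} {V : Set E}
    (h : (μ.restrict V).map ψ ≤ c • ν) {g : M → ℝ≥0∞} (hg : Measurable g) :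
    ∫⁻ x in V, g (ψ x) ∂μ ≤ c * ∫⁻ y, g y ∂ν := by
  rw [← lintegral_map hg hψ]
  exact (lintegral_mono' h le_rfl).trans_eq (by rw [lintegral_smul_measure, smul_eq_mul])

lemma setLIntegral_image_le {ν : Measure M} {ψ : E → M} (hψ : Measurable ψ) {c : ℝ≥0∞} {U : Set E}
    {A : Set M}
    (h : ν.restrict A ≤ c • (μ.restrict U).map ψ) {g : M → ℝ≥0∞} (hg : Measurable g) :
    ∫⁻ y in A, g y ∂ν ≤ c * ∫⁻ x in U, g (ψ x) ∂μ := by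
  rw [← lintegral_map hg hψ]
  exact (lintegral_mono' h le_rfl).trans_eq (by rw [lintegral_smul_measure, smul_eq_mul])

lemma setLIntegral_setLIntegral_comp_le {ν : Measure M} [SFinite ν] {ψ : E → M} (hψ : Measurable ψ)
    {c : ℝ≥0∞} {V : Set E} (hc : c ≠ ⊤)
    (h : (μ.restrict V).map ψ ≤ c • ν) {g : M → M → ℝ≥0∞} (hg : Measurable (Function.uncurry g)) :
    ∫⁻ x in V, ∫⁻ y in V, g (ψ x) (ψ y) ∂μ ∂μ ≤ c ^ 2 * ∫⁻ x, ∫⁻ y, g x y ∂ν ∂ν := by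
  calc _ ≤ ∫⁻ x in V, c * ∫⁻ y, g (ψ x) y ∂ν ∂μ :=
        lintegral_mono fun x ↦ setLIntegral_comp_le hψ h (hg.comp measurable_prodMk_left)
    _ = c * ∫⁻ x in V, ∫⁻ y, g (ψ x) y ∂ν ∂μ := lintegral_const_mul' _ _ hc
    _ ≤ c * (c * ∫⁻ x, ∫⁻ y, g x y ∂ν ∂ν) :=
        mul_le_mul_right (setLIntegral_comp_le hψ h (g := fun x ↦ ∫⁻ y, g x y ∂ν)
          hg.lintegral_prod_right) _
    _ = _ := by ring

lemma setLIntegral_setLIntegral_image_le {ν : Measure M} [SFinite ν] {ψ : E → M}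
    (hψ : Measurable ψ) {c : ℝ≥0∞} {U : Set E} {A : Set M} (hc : c ≠ ⊤)
    (h : ν.restrict A ≤ c • (μ.restrict U).map ψ) {g : M → M → ℝ≥0∞}
    (hg : Measurable (Function.uncurry g)) :
    ∫⁻ x in A, ∫⁻ y in A, g x y ∂ν ∂ν ≤ c ^ 2 * ∫⁻ x in U, ∫⁻ y in U, g (ψ x) (ψ y) ∂μ ∂μ := by
  calc _ ≤ c * ∫⁻ x in U, ∫⁻ y in A, g (ψ x) y ∂ν ∂μ :=
        setLIntegral_image_le hψ h (g := fun x ↦ ∫⁻ y in A, g x y ∂ν) hg.lintegral_prod_right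
    _ ≤ c * ∫⁻ x in U, c * ∫⁻ y in U, g (ψ x) (ψ y) ∂μ ∂μ :=
        mul_le_mul_right (lintegral_mono fun x ↦ setLIntegral_image_le hψ h
          (hg.comp measurable_prodMk_left)) _
    _ = _ := by rw [lintegral_const_mul' _ _ hc]; ring

/-- The double integral of `g x y / d(x, y) ^ β`. -/
noncomputable def kernelEnergy (ν : Measure M) (β : ℝ) (g : M → M → ℝ≥0∞) : ℝ≥0∞ :=
  ∫⁻ x, ∫⁻ y, g x y / edist x y ^ β ∂ν ∂ν

open Classical in
/-- The indicator function of the pairs at which `f` is at least `1`. -/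
noncomputable def largeIndicator {X : Type*} (f : X → X → ℝ≥0∞) (x y : X) : ℝ≥0∞ :=
  if 1 ≤ f x y then 1 else 0

lemma largePairs_eq_pairsIn (V : Set E) (f : E → E → ℝ≥0∞) :
    largePairs V f = pairsIn V (largeIndicator f) := by
  ext x y
  by_cases h : x ∈ V ∧ y ∈ V
  · rw [pairsIn, if_pos h, largePairs, largeIndicator]
    by_cases h' : 1 ≤ f x y
    · rw [if_pos ⟨h.1, h.2, h'⟩, if_pos h']
    · rw [if_neg h', if_neg fun hc ↦ h' hc.2.2]
  · rw [pairsIn, if_neg h, largePairs, if_neg fun hc ↦ h ⟨hc.1, hc.2.1⟩]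

lemma measurable_largeIndicator {X : Type*} [MeasurableSpace X] {f : X → X → ℝ≥0∞}
    (hf : Measurable (Function.uncurry f)) : Measurable (Function.uncurry (largeIndicator f)) := by
  classical
  exact Measurable.ite (measurableSet_le measurable_const hf) measurable_const measurable_const

lemma measurable_div_edist {g : M → M → ℝ≥0∞} (hg : Measurable (Function.uncurry g)) (β : ℝ) :
    Measurable (Function.uncurry fun x y ↦ g x y / edist x y ^ β) :=
  hg.div (measurable_edist.pow_const β)

lemma inv_rpow_le_of_le_mul {a b : ℝ≥0∞} {K : ℝ≥0} (hK : 1 ≤ K) (h : a ≤ K * b) {β : ℝ}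
    (hβ : 0 ≤ β) : (b ^ β)⁻¹ ≤ (K : ℝ≥0∞) ^ β * (a ^ β)⁻¹ := by
  have h0 : (K : ℝ≥0∞) ^ β ≠ 0 := by
    have : (K : ℝ≥0∞) ≠ 0 := by
      simpa using (lt_of_lt_of_le zero_lt_one hK).ne'
    simp [ENNReal.rpow_eq_zero_iff, this]
  have ht : (K : ℝ≥0∞) ^ β ≠ ⊤ := ENNReal.rpow_ne_top_of_nonneg hβ ENNReal.coe_ne_top
  have h1 : a ^ β ≤ (K : ℝ≥0∞) ^ β * b ^ β := by
    rw [← ENNReal.mul_rpow_of_nonneg _ _ hβ]; exact ENNReal.rpow_le_rpow h hβ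
  calc (b ^ β)⁻¹ = (K : ℝ≥0∞) ^ β * ((K : ℝ≥0∞) ^ β * b ^ β)⁻¹ := by
        rw [ENNReal.mul_inv (Or.inl h0) (Or.inl ht), ← mul_assoc, ENNReal.mul_inv_cancel h0 ht,
          one_mul]
    _ ≤ _ := mul_le_mul_right (ENNReal.inv_le_inv.2 h1) _

lemma normWeight_sub (β : ℝ) (x y : E) : normWeight β (y - x) = (edist x y ^ β)⁻¹ := by
  rw [normWeight, ENNReal.rpow_neg, edist_comm, edist_eq_enorm_sub]

lemma pairIntegral_comp_le {ν : Measure M} [SFinite ν] {ψ : E → M} (hψ : Measurable ψ) {K : ℝ≥0}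
    (hK : 1 ≤ K) {V : Set E} (hV : MeasurableSet V)
    (hlip : ∀ x ∈ V, ∀ y ∈ V, edist (ψ x) (ψ y) ≤ K * edist x y)
    (h : (μ.restrict V).map ψ ≤ (K : ℝ≥0∞) • ν) {g : M → M → ℝ≥0∞}
    (hg : Measurable (Function.uncurry g)) {β : ℝ} (hβ : 0 ≤ β) :
    pairIntegral μ (pairsIn V fun x y ↦ g (ψ x) (ψ y)) (normWeight β)
      ≤ (K : ℝ≥0∞) ^ β * K ^ 2 * kernelEnergy ν β g := by
  have ht : (K : ℝ≥0∞) ^ β ≠ ⊤ := ENNReal.rpow_ne_top_of_nonneg hβ ENNReal.coe_ne_top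
  rw [pairIntegral_pairsIn hV]
  calc _ ≤ ∫⁻ x in V, ∫⁻ y in V, (K : ℝ≥0∞) ^ β *
        (g (ψ x) (ψ y) / edist (ψ x) (ψ y) ^ β) ∂μ ∂μ := by
        refine setLIntegral_mono' hV fun x hx ↦ setLIntegral_mono' hV fun y hy ↦ ?_
        rw [normWeight_sub, div_eq_mul_inv]
        refine (mul_le_mul_right (inv_rpow_le_of_le_mul hK (hlip x hx y hy) hβ) _).trans_eq ?_
        ring
    _ = (K : ℝ≥0∞) ^ β * ∫⁻ x in V, ∫⁻ y in V, g (ψ x) (ψ y) / edist (ψ x) (ψ y) ^ β ∂μ ∂μ := by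
        simp_rw [lintegral_const_mul' _ _ ht]
    _ ≤ (K : ℝ≥0∞) ^ β * (K ^ 2 * kernelEnergy ν β g) :=
        mul_le_mul_right (setLIntegral_setLIntegral_comp_le hψ ENNReal.coe_ne_top h
          (measurable_div_edist hg β)) _
    _ = _ := by ring

lemma setLIntegral_image_le_pairIntegral {ν : Measure M} [SFinite ν] {ψ : E → M}
    (hψ : Measurable ψ) {K : ℝ≥0} (hK : 1 ≤ K) {U : Set E} (hU : MeasurableSet U) {A : Set M}
    (hlip : ∀ x ∈ U, ∀ y ∈ U, edist x y ≤ K * edist (ψ x) (ψ y))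
    (h : ν.restrict A ≤ (K : ℝ≥0∞) • (μ.restrict U).map ψ) {g : M → M → ℝ≥0∞}
    (hg : Measurable (Function.uncurry g)) {β : ℝ} (hβ : 0 ≤ β) :
    ∫⁻ x in A, ∫⁻ y in A, g x y / edist x y ^ β ∂ν ∂ν
      ≤ (K : ℝ≥0∞) ^ 2 * K ^ β
        * pairIntegral μ (pairsIn U fun x y ↦ g (ψ x) (ψ y)) (normWeight β) := by
  have ht : (K : ℝ≥0∞) ^ β ≠ ⊤ := ENNReal.rpow_ne_top_of_nonneg hβ ENNReal.coe_ne_top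
  rw [pairIntegral_pairsIn hU]
  calc _ ≤ (K : ℝ≥0∞) ^ 2 * ∫⁻ x in U, ∫⁻ y in U, g (ψ x) (ψ y) / edist (ψ x) (ψ y) ^ β ∂μ ∂μ :=
        setLIntegral_setLIntegral_image_le hψ ENNReal.coe_ne_top h (measurable_div_edist hg β)
    _ ≤ (K : ℝ≥0∞) ^ 2 * ∫⁻ x in U, ∫⁻ y in U,
          (K : ℝ≥0∞) ^ β * (g (ψ x) (ψ y) * normWeight β (y - x)) ∂μ ∂μ := by
        refine mul_le_mul_right (setLIntegral_mono' hU fun x hx ↦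
          setLIntegral_mono' hU fun y hy ↦ ?_) _
        rw [normWeight_sub, div_eq_mul_inv]
        refine (mul_le_mul_right (inv_rpow_le_of_le_mul hK (hlip x hx y hy) hβ) _).trans_eq ?_
        ring
    _ = _ := by
        simp_rw [lintegral_const_mul' _ _ ht]
        ring

lemma add_rpow_le_mul {c T r : ℝ≥0∞} {t : ℝ} (ht : 0 ≤ t) (h : r ≤ c * T) :
    r + r ^ t ≤ (c + c ^ t) * (T + T ^ t) := by
  calc r + r ^ t ≤ c * T + c ^ t * T ^ t := by
        refine add_le_add h ?_
        rw [← ENNReal.mul_rpow_of_nonneg _ _ ht]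
        exact ENNReal.rpow_le_rpow h ht
    _ ≤ (c * T + c ^ t * T ^ t) + (c * T ^ t + c ^ t * T) := le_self_add
    _ = _ := by ring

/-- A kernel to which the estimates apply: a measurable finite pseudometric. -/
structure IsMeasurablePseudoDist {X : Type*} [MeasurableSpace X] (f : X → X → ℝ≥0∞) : Prop where
  measurable : Measurable (Function.uncurry f)
  symm : ∀ x y, f x y = f y x
  triangle : ∀ x y z, f x z ≤ f x y + f y z
  ne_top : ∀ x y, f x y ≠ ⊤

/-- The nonlinear estimate in a neighborhood of a point. -/
lemma exists_nhds_energy_le [Nontrivial E] {ν : Measure M} [SFinite ν] {x₀ : M}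
    (hx₀ : HasRegularChart μ ν x₀) {p q : ℝ} (hq : 1 < q) (hqp : q < p) (hd : (dim : ℝ) ≤ q) :
    ∃ A ∈ nhds x₀, ∃ C : ℝ≥0∞, C ≠ ⊤ ∧ ∀ f : M → M → ℝ≥0∞, IsMeasurablePseudoDist f →
      kernelEnergy ν (dim + 1) (largeIndicator f) ≠ ⊤ →
      ∫⁻ x in A, ∫⁻ y in A, f x y ^ p / edist x y ^ (dim + q) ∂ν ∂ν
        ≤ C * (kernelEnergy ν (dim + q) (fun x y ↦ smallValues f x y ^ p)
          + kernelEnergy ν (dim + q) (fun x y ↦ smallValues f x y ^ p) ^ (p / q)) := by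
  obtain ⟨ψ, K, hK, hψ, hA, hlip, hanti, hm1, hm2⟩ := hx₀
  obtain ⟨C, hC, hmain⟩ := exists_energy_le μ hq hqp hd
  have hdq : 0 ≤ (dim : ℝ) + q := by positivity
  have hpq : 0 ≤ p / q := by have : 0 < p := by linarith
                             positivity
  have hKβ : (K : ℝ≥0∞) ^ ((dim : ℝ) + q) ≠ ⊤ :=
    ENNReal.rpow_ne_top_of_nonneg hdq ENNReal.coe_ne_top
  set c : ℝ≥0∞ := (K : ℝ≥0∞) ^ ((dim : ℝ) + q) * K ^ 2 with hc
  have hct : c ≠ ⊤ := by finiteness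
  have hct' : c ^ (p / q) ≠ ⊤ := ENNReal.rpow_ne_top_of_nonneg hpq hct
  have hUV : dyadicBall E 2 ⊆ Metric.ball 0 2 := by
    rw [dyadicBall_eq_ball]; exact Metric.ball_subset_ball (by norm_num)
  refine ⟨_, hA, (K : ℝ≥0∞) ^ 2 * K ^ ((dim : ℝ) + q) * C * (c + c ^ (p / q)), by finiteness, ?_⟩
  intro f hf hfin
  have hψψ : Measurable fun z : E × E ↦ (ψ z.1, ψ z.2) :=
    (hψ.comp measurable_fst).prodMk (hψ.comp measurable_snd)
  have h1 := hmain (fun x y ↦ f (ψ x) (ψ y)) (hf.measurable.comp hψψ)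
    (fun x y ↦ hf.symm _ _) (fun x y z ↦ hf.triangle _ _ _) (fun x y ↦ hf.ne_top _ _) (by
      rw [largePairs_eq_pairsIn]
      refine ne_top_of_le_ne_top (ENNReal.mul_ne_top (b := kernelEnergy ν (dim + 1)
        (largeIndicator f)) ?_ hfin) (pairIntegral_comp_le hψ hK measurableSet_ball hlip hm1
        (measurable_largeIndicator hf.measurable) (by positivity))
      exact ENNReal.mul_ne_top (ENNReal.rpow_ne_top_of_nonneg (by positivity) ENNReal.coe_ne_top)
        (by finiteness))
  have h2 : smallEnergy μ (Metric.ball 0 2) (fun x y ↦ f (ψ x) (ψ y)) p q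
      ≤ c * kernelEnergy ν (dim + q) (fun x y ↦ smallValues f x y ^ p) :=
    pairIntegral_comp_le (g := fun x y ↦ smallValues f x y ^ p) hψ hK measurableSet_ball hlip hm1
      ((measurable_smallValues hf.measurable).pow_const p) hdq
  have h3 := setLIntegral_image_le_pairIntegral (g := fun x y ↦ f x y ^ p) hψ hK
    (measurableSet_dyadicBall 2) (fun x hx y hy ↦ hanti x (hUV hx) y (hUV hy)) hm2
    (hf.measurable.pow_const p) hdq
  refine h3.trans ((mul_le_mul_right (h1.trans (mul_le_mul_right
    (add_rpow_le_mul hpq h2) _)) _).trans_eq ?_)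
  ring

end Transfer

end FractionalLifting

namespace FractionalLifting

/-! ### From local to global estimates -/

section Patching

variable {M : Type*} [MetricSpace M] [MeasurableSpace M] [BorelSpace M] [SecondCountableTopology M]

lemma kernel_div_rpow_le {a d D : ℝ≥0∞} (hd : d ≤ D) {β : ℝ} (hβ : 0 ≤ β) (h0 : D ≠ 0)
    (ht : D ≠ ⊤) : a ≤ D ^ β * (a / d ^ β) := by
  have h0' : D ^ β ≠ 0 := by simp [ENNReal.rpow_eq_zero_iff, h0, ht]
  have ht' : D ^ β ≠ ⊤ := ENNReal.rpow_ne_top_of_nonneg hβ ht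
  calc a = D ^ β * (a / D ^ β) := (ENNReal.mul_div_cancel h0' ht').symm
    _ ≤ _ := mul_le_mul_right (ENNReal.div_le_div_left (ENNReal.rpow_le_rpow hd hβ) _) _

/-- The triangle inequality, averaged over `D`. -/
lemma setLIntegral_triangle {ν : Measure M} [IsFiniteMeasure ν] {f : M → M → ℝ≥0∞}
    (hf : IsMeasurablePseudoDist f) {p : ℝ} (hp : 1 ≤ p) (A D G : Set M) :
    ν D * ∫⁻ x in A, ∫⁻ z in G, f x z ^ p ∂ν ∂ν
      ≤ 2 ^ (p - 1) * (ν G * ∫⁻ x in A, ∫⁻ y in D, f x y ^ p ∂ν ∂ν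
        + ν A * ∫⁻ y in D, ∫⁻ z in G, f y z ^ p ∂ν ∂ν) := by
  have h2p : (2 : ℝ≥0∞) ^ (p - 1) ≠ ⊤ := ENNReal.rpow_ne_top_of_nonneg (by linarith) (by simp)
  have hfp : Measurable (Function.uncurry fun x y ↦ f x y ^ p) := hf.measurable.pow_const p
  set φ : M → ℝ≥0∞ := fun x ↦ ∫⁻ y in D, f x y ^ p ∂ν with hφ
  set χ : M → ℝ≥0∞ := fun z ↦ ∫⁻ y in D, f y z ^ p ∂ν with hχ
  have hφm : Measurable φ := hfp.lintegral_prod_right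
  have hχm : Measurable χ := hfp.lintegral_prod_left
  have hpt : ∀ x z, ν D * f x z ^ p ≤ 2 ^ (p - 1) * (φ x + χ z) := by
    intro x z
    have hm : Measurable fun y ↦ f x y ^ p := hfp.comp measurable_prodMk_left
    calc ν D * f x z ^ p = ∫⁻ _ in D, f x z ^ p ∂ν := by rw [setLIntegral_const, mul_comm]
      _ ≤ ∫⁻ y in D, 2 ^ (p - 1) * (f x y ^ p + f y z ^ p) ∂ν := lintegral_mono fun y ↦
          (ENNReal.rpow_le_rpow (hf.triangle x y z) (by linarith)).trans
            (ENNReal.rpow_add_le_mul_rpow_add_rpow _ _ hp)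
      _ = _ := by rw [lintegral_const_mul' _ _ h2p, lintegral_add_left hm]
  calc _ = ∫⁻ x in A, ∫⁻ z in G, ν D * f x z ^ p ∂ν ∂ν := by
        simp_rw [lintegral_const_mul' _ _ (measure_ne_top ν D)]
    _ ≤ ∫⁻ x in A, ∫⁻ z in G, 2 ^ (p - 1) * (φ x + χ z) ∂ν ∂ν :=
        lintegral_mono fun x ↦ lintegral_mono fun z ↦ hpt x z
    _ = 2 ^ (p - 1) * (ν G * ∫⁻ x in A, φ x ∂ν + ν A * ∫⁻ z in G, χ z ∂ν) := by
        simp_rw [lintegral_const_mul' _ _ h2p, lintegral_add_left measurable_const,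
          setLIntegral_const]
        rw [lintegral_add_left (hφm.mul_const _), lintegral_mul_const _ hφm, setLIntegral_const]
        ring
    _ = _ := by
        have : ∫⁻ z in G, χ z ∂ν = ∫⁻ y in D, ∫⁻ z in G, f y z ^ p ∂ν ∂ν :=
          lintegral_lintegral_swap (f := fun z y ↦ f y z ^ p)
            (hfp.comp measurable_swap).aemeasurable
        rw [this]

variable [CompactSpace M] [PreconnectedSpace M]

/-- Patching local estimates on a compact connected space. -/
theorem exists_kernelEnergy_le_of_local {ν : Measure M} [IsFiniteMeasure ν] [ν.IsOpenPosMeasure]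
    {p β : ℝ} (hp : 1 ≤ p) (hβ : 0 ≤ β) (𝓕 : Set (M → M → ℝ≥0∞))
    (h𝓕 : ∀ f ∈ 𝓕, IsMeasurablePseudoDist f) (Q : (M → M → ℝ≥0∞) → ℝ≥0∞)
    (hloc : ∀ x₀ : M, ∃ A ∈ nhds x₀, ∃ C : ℝ≥0∞, C ≠ ⊤ ∧ ∀ f ∈ 𝓕,
      ∫⁻ x in A, ∫⁻ y in A, f x y ^ p / edist x y ^ β ∂ν ∂ν ≤ C * Q f) :
    ∃ C : ℝ≥0∞, C ≠ ⊤ ∧ ∀ f ∈ 𝓕, kernelEnergy ν β (fun x y ↦ f x y ^ p) ≤ C * Q f := by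
  set D₀ : ℝ≥0∞ := Metric.ediam (univ : Set M) + 1 with hD₀
  have hD₀t : D₀ ≠ ⊤ :=
    ENNReal.add_ne_top.2 ⟨isCompact_univ.isBounded.ediam_ne_top, by simp⟩
  have hD₀0 : D₀ ≠ 0 := by simp [hD₀]
  have hD₀β : D₀ ^ β ≠ ⊤ := ENNReal.rpow_ne_top_of_nonneg hβ hD₀t
  have hdD : ∀ x y : M, edist x y ≤ D₀ := fun x y ↦
    (Metric.edist_le_ediam_of_mem (mem_univ x) (mem_univ y)).trans le_self_add
  have h2p : (2 : ℝ≥0∞) ^ (p - 1) ≠ ⊤ := ENNReal.rpow_ne_top_of_nonneg (by linarith) (by simp)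
  -- Control of the pairs near `(a, b)`, without the singular kernel.
  let R : M → M → Prop := fun a b ↦ ∃ A ∈ nhds a, ∃ B ∈ nhds b, ∃ C : ℝ≥0∞, C ≠ ⊤ ∧ ∀ f ∈ 𝓕,
    ∫⁻ x in A, ∫⁻ y in B, f x y ^ p ∂ν ∂ν ≤ C * Q f
  -- On a connected space a transitive relation holding between each point and its neighbors, in
  -- both orders, holds everywhere. Transitivity averages the triangle inequality over `B ∩ B'`,
  -- which has positive measure as a neighborhood of the middle point.
  have hR : ∀ a b, R a b := by
    refine fun a b ↦ PreconnectedSpace.induction₂' R (fun x₀ ↦ ?_) ⟨fun a b c hab hbc ↦ ?_⟩ a b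
    · obtain ⟨A, hA, C, hC, h⟩ := hloc x₀
      have h' : ∀ f ∈ 𝓕, ∫⁻ x in A, ∫⁻ y in A, f x y ^ p ∂ν ∂ν ≤ D₀ ^ β * C * Q f := by
        intro f hf
        calc _ ≤ ∫⁻ x in A, ∫⁻ y in A, D₀ ^ β * (f x y ^ p / edist x y ^ β) ∂ν ∂ν :=
              lintegral_mono fun x ↦ lintegral_mono fun y ↦
                kernel_div_rpow_le (hdD x y) hβ hD₀0 hD₀t
          _ = D₀ ^ β * ∫⁻ x in A, ∫⁻ y in A, f x y ^ p / edist x y ^ β ∂ν ∂ν := by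
              simp_rw [lintegral_const_mul' _ _ hD₀β]
          _ ≤ _ := by rw [mul_assoc]; exact mul_le_mul_right (h f hf) _
      filter_upwards [eventually_mem_nhds_iff.2 hA] with y hy
      exact ⟨⟨A, hA, A, hy, _, by finiteness, h'⟩, ⟨A, hy, A, hA, _, by finiteness, h'⟩⟩
    · obtain ⟨A, hA, B, hB, C₁, hC₁, h₁⟩ := hab
      obtain ⟨B', hB', G, hG, C₂, hC₂, h₂⟩ := hbc
      have hν0 : ν (B ∩ B') ≠ 0 := (Measure.measure_pos_of_mem_nhds ν (Filter.inter_mem hB hB')).ne'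
      have hνt : (ν (B ∩ B'))⁻¹ ≠ ⊤ := ENNReal.inv_ne_top.2 hν0
      have hGt := measure_ne_top ν G
      have hAt := measure_ne_top ν A
      refine ⟨A, hA, G, hG, (ν (B ∩ B'))⁻¹ * (2 ^ (p - 1) * (ν G * C₁ + ν A * C₂)), by finiteness,
        fun f hf ↦ ?_⟩
      have h3 := setLIntegral_triangle (ν := ν) (h𝓕 f hf) hp A (B ∩ B') G
      have h4 : ∫⁻ x in A, ∫⁻ y in B ∩ B', f x y ^ p ∂ν ∂ν ≤ C₁ * Q f :=
        (lintegral_mono fun x ↦ lintegral_mono_set inter_subset_left).trans (h₁ f hf)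
      have h5 : ∫⁻ x in B ∩ B', ∫⁻ y in G, f x y ^ p ∂ν ∂ν ≤ C₂ * Q f :=
        (lintegral_mono_set inter_subset_right).trans (h₂ f hf)
      calc ∫⁻ x in A, ∫⁻ z in G, f x z ^ p ∂ν ∂ν
          = (ν (B ∩ B'))⁻¹ * (ν (B ∩ B') * ∫⁻ x in A, ∫⁻ z in G, f x z ^ p ∂ν ∂ν) := by
            rw [← mul_assoc, ENNReal.inv_mul_cancel hν0 (measure_ne_top _ _), one_mul]
        _ ≤ (ν (B ∩ B'))⁻¹ * (2 ^ (p - 1) * (ν G * (C₁ * Q f) + ν A * (C₂ * Q f))) := by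
            refine mul_le_mul_right (h3.trans (mul_le_mul_right ?_ _)) _
            exact add_le_add (mul_le_mul_right h4 _) (mul_le_mul_right h5 _)
        _ = _ := by ring
  -- Compactness of `M × M`: near the diagonal the local hypothesis applies, and away from it the
  -- kernel is bounded, so that `R` suffices.
  have key : ∃ C : ℝ≥0∞, C ≠ ⊤ ∧ ∀ f ∈ 𝓕, ∫⁻ z in (univ : Set (M × M)),
      f z.1 z.2 ^ p / edist z.1 z.2 ^ β ∂(ν.prod ν) ≤ C * Q f := by
    refine isCompact_univ.induction_on (p := fun S : Set (M × M) ↦ ∃ C : ℝ≥0∞, C ≠ ⊤ ∧ ∀ f ∈ 𝓕,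
      ∫⁻ z in S, f z.1 z.2 ^ p / edist z.1 z.2 ^ β ∂(ν.prod ν) ≤ C * Q f) ?_ ?_ ?_ ?_
    · exact ⟨0, by simp, fun f _ ↦ by simp⟩
    · rintro S T hST ⟨C, hC, h⟩
      exact ⟨C, hC, fun f hf ↦ (lintegral_mono_set hST).trans (h f hf)⟩
    · rintro S T ⟨C, hC, h⟩ ⟨C', hC', h'⟩
      refine ⟨C + C', by finiteness, fun f hf ↦ (lintegral_union_le _ _ _).trans ?_⟩
      rw [add_mul]
      exact add_le_add (h f hf) (h' f hf)
    · rintro ⟨a, b⟩ -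
      rw [nhdsWithin_univ]
      have hprod : ∀ (A B : Set M), MeasurableSet A → MeasurableSet B → ∀ f ∈ 𝓕,
          ∫⁻ z in A ×ˢ B, f z.1 z.2 ^ p / edist z.1 z.2 ^ β ∂(ν.prod ν)
            = ∫⁻ x in A, ∫⁻ y in B, f x y ^ p / edist x y ^ β ∂ν ∂ν := by
        intro A B _ _ f hf
        have hm : Measurable fun z : M × M ↦ f z.1 z.2 ^ p / edist z.1 z.2 ^ β :=
          measurable_div_edist (g := fun x y ↦ f x y ^ p) ((h𝓕 f hf).measurable.pow_const p) β
        exact setLIntegral_prod _ hm.aemeasurable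
      rcases eq_or_ne a b with rfl | hab
      · obtain ⟨A, hA, C, hC, h⟩ := hloc a
        refine ⟨interior A ×ˢ interior A, prod_mem_nhds (interior_mem_nhds.2 hA)
          (interior_mem_nhds.2 hA), C, hC, fun f hf ↦ ?_⟩
        rw [hprod _ _ isOpen_interior.measurableSet isOpen_interior.measurableSet f hf]
        exact ((lintegral_mono_set interior_subset).trans
          (lintegral_mono fun x ↦ lintegral_mono_set interior_subset)).trans (h f hf)
      · obtain ⟨A, hA, B, hB, C, hC, h⟩ := hR a b
        set δ : ℝ≥0∞ := edist a b / 2 with hδ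
        have hδ0 : δ ≠ 0 := by simp [hδ, hab]
        have hδt : δ ≠ ⊤ := ENNReal.div_ne_top (edist_ne_top a b) (by simp)
        have hδβ : (δ ^ β)⁻¹ ≠ ⊤ := ENNReal.inv_ne_top.2 (by
          simp [ENNReal.rpow_eq_zero_iff, hδ0, hδt])
        have hopen : {z : M × M | δ < edist z.1 z.2} ∈ nhds (a, b) := by
          refine (isOpen_lt continuous_const continuous_edist).mem_nhds ?_
          exact ENNReal.half_lt_self (by simpa using hab) (edist_ne_top a b)
        refine ⟨(interior A ×ˢ interior B) ∩ {z : M × M | δ < edist z.1 z.2}, Filter.inter_mem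
          (prod_mem_nhds (interior_mem_nhds.2 hA) (interior_mem_nhds.2 hB)) hopen,
          (δ ^ β)⁻¹ * C, by finiteness, fun f hf ↦ ?_⟩
        have hS : MeasurableSet ((interior A ×ˢ interior B) ∩ {z : M × M | δ < edist z.1 z.2}) :=
          ((isOpen_interior.prod isOpen_interior).inter
            (isOpen_lt continuous_const continuous_edist)).measurableSet
        have hm : Measurable fun z : M × M ↦ f z.1 z.2 ^ p := (h𝓕 f hf).measurable.pow_const p
        calc _ ≤ ∫⁻ z in (interior A ×ˢ interior B) ∩ {z : M × M | δ < edist z.1 z.2},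
                (δ ^ β)⁻¹ * f z.1 z.2 ^ p ∂(ν.prod ν) := by
              refine setLIntegral_mono' hS fun z hz ↦ ?_
              rw [div_eq_mul_inv, mul_comm]
              refine mul_le_mul_left (ENNReal.inv_le_inv.2 (ENNReal.rpow_le_rpow ?_ hβ)) _
              exact le_of_lt hz.2
          _ ≤ ∫⁻ z in interior A ×ˢ interior B, (δ ^ β)⁻¹ * f z.1 z.2 ^ p ∂(ν.prod ν) :=
              lintegral_mono_set inter_subset_left
          _ = (δ ^ β)⁻¹ * ∫⁻ x in interior A, ∫⁻ y in interior B, f x y ^ p ∂ν ∂ν := by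
              rw [lintegral_const_mul' _ _ hδβ, setLIntegral_prod _ hm.aemeasurable]
          _ ≤ (δ ^ β)⁻¹ * (C * Q f) := by
              refine mul_le_mul_right (le_trans ?_ (h f hf)) _
              exact (lintegral_mono_set interior_subset).trans
                (lintegral_mono fun x ↦ lintegral_mono_set interior_subset)
          _ = _ := by ring
  obtain ⟨C, hC, h⟩ := key
  refine ⟨C, hC, fun f hf ↦ ?_⟩
  have hm : Measurable (Function.uncurry fun x y ↦ f x y ^ p / edist x y ^ β) :=
    measurable_div_edist (g := fun x y ↦ f x y ^ p) ((h𝓕 f hf).measurable.pow_const p) β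
  refine le_trans (le_of_eq ?_) (h f hf)
  rw [setLIntegral_univ]
  exact lintegral_lintegral hm.aemeasurable

end Patching

/-! ### The nonlinear estimate on a compact space -/

section Global

variable {E : Type*} [NormedAddCommGroup E] [NormedSpace ℝ E] [FiniteDimensional ℝ E]
  [MeasurableSpace E] [BorelSpace E] [Nontrivial E] (μ : Measure E) [μ.IsAddHaarMeasure]
  {M : Type*} [MetricSpace M] [MeasurableSpace M] [BorelSpace M] [SecondCountableTopology M]
  [CompactSpace M] [PreconnectedSpace M]

local notation "dim" => Module.finrank ℝ E

/-- The nonlinear estimate on a compact connected space having regular charts: the energy of a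
pseudometric `f` is controlled by the contribution of the values of `f` less than `1`, provided
that `∬ 1_{f ≥ 1} / d(x, y) ^ (m + 1)` is finite. -/
theorem exists_kernelEnergy_le {ν : Measure M} [IsFiniteMeasure ν] [ν.IsOpenPosMeasure]
    (hν : ∀ x : M, HasRegularChart μ ν x) {p q : ℝ} (hq : 1 < q) (hqp : q < p)
    (hd : (dim : ℝ) ≤ q) :
    ∃ C : ℝ≥0∞, C ≠ ⊤ ∧ ∀ f : M → M → ℝ≥0∞, IsMeasurablePseudoDist f →
      kernelEnergy ν (dim + 1) (largeIndicator f) ≠ ⊤ →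
      kernelEnergy ν (dim + q) (fun x y ↦ f x y ^ p)
        ≤ C * (kernelEnergy ν (dim + q) (fun x y ↦ smallValues f x y ^ p)
          + kernelEnergy ν (dim + q) (fun x y ↦ smallValues f x y ^ p) ^ (p / q)) := by
  obtain ⟨C, hC, h⟩ := exists_kernelEnergy_le_of_local (ν := ν) (p := p) (β := dim + q)
    (by linarith) (by positivity)
    {f | IsMeasurablePseudoDist f ∧ kernelEnergy ν (dim + 1) (largeIndicator f) ≠ ⊤}
    (fun f hf ↦ hf.1) (fun f ↦ kernelEnergy ν (dim + q) (fun x y ↦ smallValues f x y ^ p)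
          + kernelEnergy ν (dim + q) (fun x y ↦ smallValues f x y ^ p) ^ (p / q))
    (fun x ↦ by
      obtain ⟨A, hA, C, hC, h⟩ := exists_nhds_energy_le (hν x) hq hqp hd
      exact ⟨A, hA, C, hC, fun f hf ↦ h f hf.1 hf.2⟩)
  exact ⟨C, hC, fun f hf hfin ↦ h f ⟨hf, hfin⟩⟩

end Global

end FractionalLifting

namespace FractionalLifting

/-! ### Charts of a Riemannian manifold are locally bi-Lipschitz -/

section Charts

variable {m : ℕ} {M : Type*} [MetricSpace M]
    [ChartedSpace (EuclideanSpace ℝ (Fin m)) M] [IsManifold (𝓡 m) ∞ M]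
    [RiemannianBundle (fun x : M ↦ TangentSpace (𝓡 m) x)]
    [IsContMDiffRiemannianBundle (𝓡 m) ∞ (EuclideanSpace ℝ (Fin m))
      (fun x : M ↦ TangentSpace (𝓡 m) x)]

lemma enorm_le_of_norm_le {F G : Type*} [SeminormedAddGroup F] [SeminormedAddGroup G] {a : F}
    {b : G} {C : ℝ≥0} (h : ‖a‖ ≤ C * ‖b‖) : ‖a‖ₑ ≤ C * ‖b‖ₑ := by
  have : ‖a‖₊ ≤ C * ‖b‖₊ := h
  simp only [enorm]
  exact_mod_cast this

lemma isContinuousRiemannianBundle_tangentSpace :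
    IsContinuousRiemannianBundle (EuclideanSpace ℝ (Fin m))
      (fun x : M ↦ TangentSpace (𝓡 m) x) := by
  obtain ⟨g, hg, h⟩ := IsContMDiffRiemannianBundle.exists_contMDiff (IB := 𝓡 m) (n := ∞)
    (F := EuclideanSpace ℝ (Fin m)) (E := fun x : M ↦ TangentSpace (𝓡 m) x)
  exact ⟨g, hg.continuous, h⟩

local notation "𝔼" => EuclideanSpace ℝ (Fin m)

/-- The derivative of the chart is the trivialization of the tangent bundle, whose operator norm is
locally bounded by continuity of the metric. -/
lemma eventually_enorm_mfderiv_extChartAt_le (x : M) :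
    ∃ C : ℝ≥0, ∀ᶠ y in nhds x, ∀ v : TangentSpace (𝓡 m) y,
      enorm (E := 𝔼) (mfderiv (𝓡 m) 𝓘(ℝ, 𝔼) (extChartAt (𝓡 m) x) y v) ≤ C * ‖v‖ₑ := by
  have := isContinuousRiemannianBundle_tangentSpace (m := m) (M := M)
  obtain ⟨C, hC, h⟩ := eventually_norm_trivializationAt_lt 𝔼 (fun x : M ↦ TangentSpace (𝓡 m) x) x
  refine ⟨⟨C, hC.le⟩, ?_⟩
  filter_upwards [h, chart_source_mem_nhds 𝔼 x] with y hy hy' v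
  rw [← TangentBundle.continuousLinearMapAt_trivializationAt hy']
  have := ((trivializationAt 𝔼 (fun x : M ↦ TangentSpace (𝓡 m) x) x).continuousLinearMapAt ℝ
    y).le_of_opNorm_le hy.le v
  exact enorm_le_of_norm_le this

lemma eventually_enorm_mfderivWithin_extChartAt_symm_le (x : M) :
    ∃ C : ℝ≥0, ∀ᶠ y in nhds x, ∀ v : 𝔼,
    enorm (E := TangentSpace (𝓡 m) y)
      (mfderivWithin 𝓘(ℝ, 𝔼) (𝓡 m) (extChartAt (𝓡 m) x).symm (range (𝓡 m))
        (extChartAt (𝓡 m) x y) v) ≤ C * ‖v‖ₑ := by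
  have := isContinuousRiemannianBundle_tangentSpace (m := m) (M := M)
  obtain ⟨C, hC, h⟩ := eventually_norm_symmL_trivializationAt_lt 𝔼
    (fun x : M ↦ TangentSpace (𝓡 m) x) x
  refine ⟨⟨C, hC.le⟩, ?_⟩
  filter_upwards [h, chart_source_mem_nhds 𝔼 x] with y hy hy' v
  rw [← TangentBundle.symmL_trivializationAt hy']
  have := ((trivializationAt 𝔼 (fun x : M ↦ TangentSpace (𝓡 m) x) x).symmL ℝ
    y).le_of_opNorm_le hy.le v
  exact enorm_le_of_norm_le this

/-- The length of a path is measured through a chart. -/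
lemma enorm_extChartAt_sub_le {x : M} {C : ℝ≥0} {γ : ℝ → M}
    (hγ : ContMDiff 𝓘(ℝ, ℝ) (𝓡 m) 1 γ) {a b : ℝ} (hab : a ≤ b)
    (hs : ∀ t ∈ Icc a b, γ t ∈ (extChartAt (𝓡 m) x).source)
    (hC : ∀ t ∈ Icc a b, ∀ v : TangentSpace (𝓡 m) (γ t),
      enorm (E := 𝔼) (mfderiv (𝓡 m) 𝓘(ℝ, 𝔼) (extChartAt (𝓡 m) x) (γ t) v) ≤ C * ‖v‖ₑ) :
    ‖extChartAt (𝓡 m) x (γ b) - extChartAt (𝓡 m) x (γ a)‖ₑ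
      ≤ C * Manifold.pathELength (𝓡 m) γ a b := by
  have hd : ∀ t ∈ Icc a b, HasMFDerivAt 𝓘(ℝ, ℝ) 𝓘(ℝ, 𝔼) (extChartAt (𝓡 m) x ∘ γ) t
      ((mfderiv (𝓡 m) 𝓘(ℝ, 𝔼) (extChartAt (𝓡 m) x) (γ t)).comp (mfderiv 𝓘(ℝ, ℝ) (𝓡 m) γ t)) := by
    intro t ht
    have h1 : MDifferentiableAt (𝓡 m) 𝓘(ℝ, 𝔼) (extChartAt (𝓡 m) x) (γ t) :=
      mdifferentiableAt_extChartAt (by simpa using hs t ht)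
    exact h1.hasMFDerivAt.comp t ((hγ.mdifferentiable (by simp)) t).hasMFDerivAt
  have hsm : ContDiffOn ℝ 1 (extChartAt (𝓡 m) x ∘ γ) (Icc a b) := by
    rw [← contMDiffOn_iff_contDiffOn]
    refine ContMDiffOn.comp (t := (chartAt 𝔼 x).source) ?_ hγ.contMDiffOn ?_
    · exact contMDiffOn_extChartAt (n := 1)
    · exact fun t ht ↦ by simpa using hs t ht
  refine (enorm_sub_le_lintegral_deriv_of_contDiffOn_Icc hsm hab).trans ?_
  rw [Manifold.pathELength_eq_lintegral_mfderiv_Icc, ← lintegral_const_mul' _ _ ENNReal.coe_ne_top]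
  refine setLIntegral_mono' measurableSet_Icc fun t ht ↦ ?_
  rw [← fderiv_apply_one_eq_deriv, ← mfderiv_eq_fderiv, (hd t ht).mfderiv]
  exact hC t ht _

/-- The image of the straight segment competes in the definition of the geodesic distance. -/
lemma riemannianEDist_extChartAt_symm_le {x : M} {C : ℝ≥0} {S : Set 𝔼} (hS : Convex ℝ S)
    (hSt : S ⊆ (extChartAt (𝓡 m) x).target)
    (hC : ∀ y ∈ S, ∀ v : 𝔼,
      ‖mfderivWithin 𝓘(ℝ, 𝔼) (𝓡 m) (extChartAt (𝓡 m) x).symm (range (𝓡 m)) y v‖ₑ ≤ C * ‖v‖ₑ)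
    {y z : 𝔼} (hy : y ∈ S) (hz : z ∈ S) :
    Manifold.riemannianEDist (𝓡 m) ((extChartAt (𝓡 m) x).symm y) ((extChartAt (𝓡 m) x).symm z)
      ≤ C * edist y z := by
  set η : ℝ → 𝔼 := fun t ↦ y + t • (z - y) with hη
  have hmem : ∀ t ∈ Icc (0 : ℝ) 1, η t ∈ S := fun t ht ↦ hS.add_smul_sub_mem hy hz ht
  have hηd : ∀ t, HasFDerivAt η ((ContinuousLinearMap.toSpanSingleton ℝ (z - y))) t := fun t ↦ by
    exact ((by simpa [hη] using ((hasDerivAt_id t).smul_const (z - y)).const_add y :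
      HasDerivAt η (z - y) t)).hasFDerivAt
  have hηs : CMDiff 1 η := by
    rw [contMDiff_iff_contDiff]; fun_prop
  have hsm : ContMDiffOn 𝓘(ℝ, ℝ) (𝓡 m) 1 ((extChartAt (𝓡 m) x).symm ∘ η) (Icc 0 1) :=
    ContMDiffOn.comp (contMDiffOn_extChartAt_symm (n := 1) x) hηs.contMDiffOn
      (fun t ht ↦ hSt (hmem t ht))
  have h0 := Manifold.riemannianEDist_le_pathELength hsm rfl rfl zero_le_one
  simp only [Function.comp_apply, hη, zero_smul, add_zero, one_smul, add_sub_cancel] at h0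
  refine h0.trans ?_
  rw [Manifold.pathELength_eq_lintegral_mfderiv_Icc]
  calc _ ≤ ∫⁻ t in Icc (0 : ℝ) 1, C * ‖z - y‖ₑ := by
        refine setLIntegral_mono' measurableSet_Icc fun t ht ↦ ?_
        have h1 : MDifferentiableWithinAt 𝓘(ℝ, 𝔼) (𝓡 m) (extChartAt (𝓡 m) x).symm
            (range (𝓡 m)) (η t) :=
          mdifferentiableWithinAt_extChartAt_symm (hSt (hmem t ht))
        have h2 : HasMFDerivAt 𝓘(ℝ, ℝ) (𝓡 m) ((extChartAt (𝓡 m) x).symm ∘ η) t _ :=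
          HasMFDerivAt.comp t (h1.hasMFDerivWithinAt.hasMFDerivAt (by simp)) (hηd t).hasMFDerivAt
        have h3 := h2.mfderiv
        erw [h3]
        refine (hC _ (hmem t ht) _).trans_eq ?_
        change (C : ℝ≥0∞) * ‖(1 : ℝ) • (z - y)‖ₑ = _
        rw [one_smul]
    _ = _ := by simp [edist_comm y z, edist_eq_enorm_sub]

variable [IsRiemannianManifold (𝓡 m) M]

/-- Charts are locally bi-Lipschitz for the geodesic distance. -/
lemma exists_bilipschitz_extChartAt (x : M) :
    ∃ r > 0, ∃ K : ℝ≥0, Metric.ball (extChartAt (𝓡 m) x x) r ⊆ (extChartAt (𝓡 m) x).target ∧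
      ∀ y ∈ Metric.ball (extChartAt (𝓡 m) x x) r, ∀ z ∈ Metric.ball (extChartAt (𝓡 m) x x) r,
        edist ((extChartAt (𝓡 m) x).symm y) ((extChartAt (𝓡 m) x).symm z) ≤ K * edist y z ∧
        edist y z ≤ K * edist ((extChartAt (𝓡 m) x).symm y) ((extChartAt (𝓡 m) x).symm z) := by
  set φ := extChartAt (𝓡 m) x with hφ
  obtain ⟨C₁, h₁⟩ := eventually_enorm_mfderiv_extChartAt_le (m := m) x
  obtain ⟨C₂, h₂⟩ := eventually_enorm_mfderivWithin_extChartAt_symm_le (m := m) x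
  obtain ⟨ρ, hρ, hρs⟩ := Metric.mem_nhds_iff.1 (Filter.inter_mem h₁
    (extChartAt_source_mem_nhds (I := 𝓡 m) x))
  have hcont : Filter.Tendsto φ.symm (nhds (φ x)) (nhds x) := by
    have h := continuousAt_extChartAt_symm (I := 𝓡 m) x
    rwa [ContinuousAt, extChartAt_to_inv] at h
  have h₃ : ∀ᶠ z in nhds (φ x), ∀ v : 𝔼, ‖mfderivWithin 𝓘(ℝ, 𝔼) (𝓡 m) φ.symm (range (𝓡 m)) z v‖ₑ
      ≤ C₂ * ‖v‖ₑ := by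
    filter_upwards [hcont.eventually h₂, extChartAt_target_mem_nhds (I := 𝓡 m) x] with z hz hzt
    -- The type of the derivative depends on its base point, so `φ (φ.symm z) = z` is substituted
    -- through a free variable `z'`.
    have h : ∀ z', z' = z → (∀ v : 𝔼, enorm (E := TangentSpace (𝓡 m) (φ.symm z))
        (mfderivWithin 𝓘(ℝ, 𝔼) (𝓡 m) φ.symm (range (𝓡 m)) z' v) ≤ C₂ * ‖v‖ₑ) →
        ∀ v : 𝔼, ‖mfderivWithin 𝓘(ℝ, 𝔼) (𝓡 m) φ.symm (range (𝓡 m)) z v‖ₑ ≤ C₂ * ‖v‖ₑ := by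
      rintro _ rfl h
      exact h
    exact h _ (φ.right_inv hzt) hz
  have h₄ : ∀ᶠ z in nhds (φ x), φ.symm z ∈ Metric.ball x (ρ / 4) :=
    hcont.eventually (Metric.ball_mem_nhds x (by positivity))
  obtain ⟨r, hr, hrs⟩ := Metric.mem_nhds_iff.1 (Filter.inter_mem (Filter.inter_mem h₃ h₄)
    (extChartAt_target_mem_nhds (I := 𝓡 m) x))
  refine ⟨r, hr, max C₁ C₂, fun z hz ↦ (hrs hz).2, fun y hy z hz ↦ ⟨?_, ?_⟩⟩
  · rw [IsRiemannianManifold.out (I := 𝓡 m) (φ.symm y)]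
    refine (riemannianEDist_extChartAt_symm_le (convex_ball _ _) (fun z hz ↦ (hrs hz).2)
      (fun z hz ↦ (hrs hz).1.1) hy hz).trans ?_
    gcongr
    exact le_max_right _ _
  · have hy4 : φ.symm y ∈ Metric.ball x (ρ / 4) := (hrs hy).1.2
    have hz4 : φ.symm z ∈ Metric.ball x (ρ / 4) := (hrs hz).1.2
    have hd : edist (φ.symm y) (φ.symm z) < ENNReal.ofReal (ρ / 2) := by
      rw [edist_lt_ofReal]
      calc _ ≤ dist (φ.symm y) x + dist (φ.symm z) x := dist_triangle_right _ _ _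
        _ < ρ / 4 + ρ / 4 := add_lt_add hy4 hz4
        _ = _ := by ring
    -- A curve of length less than `ρ / 2` starting within `ρ / 4` of `x` stays in the ball of
    -- radius `ρ`, where the derivative of the chart is bounded; its image has length at most `C₁ *
    -- l`.
    have key : ∀ l, edist (φ.symm y) (φ.symm z) < l → edist y z ≤ C₁ * l := by
      intro l hl
      have hl' : Manifold.riemannianEDist (𝓡 m) (φ.symm y) (φ.symm z)
          < min l (ENNReal.ofReal (ρ / 2)) := by
        rw [← IsRiemannianManifold.out (I := 𝓡 m)]; exact lt_min hl hd
      obtain ⟨γ, hγ0, hγ1, hγ, hlen, -, -⟩ :=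
        Manifold.exists_lt_locally_constant_of_riemannianEDist_lt hl' zero_lt_one
      have hball : ∀ t ∈ Icc (0 : ℝ) 1, γ t ∈ Metric.ball x ρ := by
        intro t ht
        have h5 : edist (γ 0) (γ t) < ENNReal.ofReal (ρ / 2) := by
          rw [IsRiemannianManifold.out (I := 𝓡 m)]
          calc _ ≤ Manifold.pathELength (𝓡 m) γ 0 t :=
                Manifold.riemannianEDist_le_pathELength hγ.contMDiffOn rfl rfl ht.1
            _ ≤ Manifold.pathELength (𝓡 m) γ 0 1 := Manifold.pathELength_mono le_rfl ht.2
            _ < _ := hlen.trans_le (min_le_right _ _)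
        rw [edist_lt_ofReal, hγ0] at h5
        rw [Metric.mem_ball]
        calc dist (γ t) x ≤ dist (φ.symm y) (γ t) + dist (φ.symm y) x := by
              rw [dist_comm (φ.symm y)]; exact dist_triangle _ _ _
          _ < ρ / 2 + ρ / 4 := add_lt_add h5 hy4
          _ ≤ ρ := by linarith
      have h6 := enorm_extChartAt_sub_le (x := x) (C := C₁) hγ zero_le_one
        (fun t ht ↦ (hρs (hball t ht)).2) (fun t ht ↦ (hρs (hball t ht)).1)
      rw [hγ0, hγ1, φ.right_inv (hrs hy).2, φ.right_inv (hrs hz).2, ← edist_eq_enorm_sub,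
        edist_comm] at h6
      refine h6.trans ?_
      gcongr
      exact hlen.le.trans (min_le_left _ _)
    have h7 : edist y z ≤ C₁ * edist (φ.symm y) (φ.symm z) := by
      refine ENNReal.le_of_forall_pos_le_add fun ε hε _ ↦ ?_
      have hε' : 0 < ε / (C₁ + 1) := by positivity
      refine (key (edist (φ.symm y) (φ.symm z) + (ε / (C₁ + 1) : ℝ≥0))
        (ENNReal.lt_add_right (edist_ne_top _ _) (by simpa using hε'.ne'))).trans ?_
      rw [mul_add]
      gcongr
      rw [← ENNReal.coe_mul]
      norm_cast
      calc C₁ * (ε / (C₁ + 1)) = ε * (C₁ / (C₁ + 1)) := by ring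
        _ ≤ ε * 1 := by
          gcongr
          exact div_le_one_of_le₀ (by simp) (by positivity)
        _ = ε := mul_one ε
    refine h7.trans ?_
    gcongr
    exact le_max_left _ _

end Charts

end FractionalLifting

namespace FractionalLifting

/-! ### Hausdorff measures under Lipschitz maps -/

section Measures

variable {X Y : Type*} [MetricSpace X] [MeasurableSpace X] [BorelSpace X]
  [MetricSpace Y] [MeasurableSpace Y] [BorelSpace Y]

lemma euclideanHausdorffMeasure_image_le {f : X → Y} {K : ℝ≥0} {s : Set X}
    (h : LipschitzOnWith K f s) (d : ℕ) :
    (μHE[d] : Measure Y) (f '' s) ≤ (K : ℝ≥0∞) ^ d * (μHE[d] : Measure X) s := by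
  rw [Measure.euclideanHausdorffMeasure_def, Measure.euclideanHausdorffMeasure_def,
    Measure.smul_apply, Measure.smul_apply, ENNReal.smul_def, ENNReal.smul_def, smul_eq_mul,
    smul_eq_mul, ← ENNReal.rpow_natCast]
  refine (mul_le_mul_right (h.hausdorffMeasure_image_le (Nat.cast_nonneg d)) _).trans_eq ?_
  ring

lemma le_euclideanHausdorffMeasure_image [Nonempty X] {f : X → Y} {K : ℝ≥0} {s : Set X}
    (h : ∀ x ∈ s, ∀ y ∈ s, edist x y ≤ K * edist (f x) (f y)) (d : ℕ) :
    (μHE[d] : Measure X) s ≤ (K : ℝ≥0∞) ^ d * (μHE[d] : Measure Y) (f '' s) := by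
  have hinj : InjOn f s := fun x hx y hy hxy ↦ by
    have := h x hx y hy
    rw [hxy, edist_self, mul_zero] at this
    exact edist_le_zero.1 this
  have hg : LipschitzOnWith K (Function.invFunOn f s) (f '' s) := by
    rintro _ ⟨x, hx, rfl⟩ _ ⟨y, hy, rfl⟩
    rw [hinj.leftInvOn_invFunOn hx, hinj.leftInvOn_invFunOn hy]
    exact h x hx y hy
  have := euclideanHausdorffMeasure_image_le hg d
  rwa [hinj.leftInvOn_invFunOn.image_image] at this

end Measures

/-! ### Regular charts on a Riemannian manifold -/

section RegularCharts

variable {m : ℕ} {M : Type*} [MetricSpace M] [MeasurableSpace M] [BorelSpace M]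

local notation "𝔼" => EuclideanSpace ℝ (Fin m)

instance isAddHaarMeasure_euclideanSpace :
    (μHE[m] : Measure (EuclideanSpace ℝ (Fin m))).IsAddHaarMeasure := by
  have h := isAddHaarMeasure_euclideanHausdorffMeasure (E := EuclideanSpace ℝ (Fin m))
  rwa [finrank_euclideanSpace_fin] at h

lemma dyadicBall_two_subset {E : Type*} [NormedAddCommGroup E] [NormedSpace ℝ E]
    [FiniteDimensional ℝ E] [MeasurableSpace E] [BorelSpace E] :
    dyadicBall E 2 ⊆ Metric.ball 0 2 := by
  rw [dyadicBall_eq_ball]; exact Metric.ball_subset_ball (by norm_num)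

/-- Distances are distorted by at most `K`, and `m`-dimensional Hausdorff measures by at most `K ^
m`; the maximum of both serves as the single constant. -/
lemma hasRegularChart_of_bilipschitz {x : M} {ψ : 𝔼 → M} {K : ℝ≥0} (hK : 1 ≤ K)
    (hψ : Measurable ψ) (hx : ψ '' dyadicBall 𝔼 2 ∈ nhds x)
    (hlip : ∀ y ∈ Metric.ball (0 : 𝔼) 2, ∀ z ∈ Metric.ball (0 : 𝔼) 2,
      edist (ψ y) (ψ z) ≤ K * edist y z)
    (hanti : ∀ y ∈ Metric.ball (0 : 𝔼) 2, ∀ z ∈ Metric.ball (0 : 𝔼) 2,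
      edist y z ≤ K * edist (ψ y) (ψ z)) :
    HasRegularChart (μHE[m] : Measure 𝔼) (μHE[m] : Measure M) x := by
  have hK1 : K ≤ max K (K ^ m) := le_max_left _ _
  have hK2 : (K : ℝ≥0∞) ^ m ≤ (max K (K ^ m) : ℝ≥0) := by
    rw [← ENNReal.coe_pow]; exact ENNReal.coe_le_coe.2 (le_max_right _ _)
  refine ⟨ψ, max K (K ^ m), hK.trans hK1, hψ, hx, fun y hy z hz ↦ (hlip y hy z hz).trans ?_,
    fun y hy z hz ↦ (hanti y hy z hz).trans ?_, ?_, ?_⟩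
  · gcongr
  · gcongr
  · refine Measure.le_iff.2 fun S hS ↦ ?_
    rw [Measure.map_apply hψ hS, Measure.restrict_apply (hψ hS), Measure.smul_apply, smul_eq_mul]
    calc _ ≤ (K : ℝ≥0∞) ^ m * μHE[m] (ψ '' (ψ ⁻¹' S ∩ Metric.ball 0 2)) :=
          le_euclideanHausdorffMeasure_image (fun y hy z hz ↦ hanti y hy.2 z hz.2) m
      _ ≤ _ := by
          refine mul_le_mul' hK2 (measure_mono ?_)
          rintro _ ⟨y, hy, rfl⟩
          exact hy.1
  · refine Measure.le_iff.2 fun S hS ↦ ?_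
    rw [Measure.smul_apply, Measure.map_apply hψ hS, Measure.restrict_apply hS,
      Measure.restrict_apply (hψ hS), smul_eq_mul]
    calc μHE[m] (S ∩ ψ '' dyadicBall 𝔼 2) ≤ μHE[m] (ψ '' (ψ ⁻¹' S ∩ dyadicBall 𝔼 2)) := by
          refine measure_mono ?_
          rintro _ ⟨hS, y, hy, rfl⟩
          exact ⟨y, ⟨hS, hy⟩, rfl⟩
      _ ≤ (K : ℝ≥0∞) ^ m * μHE[m] (ψ ⁻¹' S ∩ dyadicBall 𝔼 2) :=
          euclideanHausdorffMeasure_image_le (fun y hy z hz ↦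
            hlip y (dyadicBall_two_subset hy.2) z (dyadicBall_two_subset hz.2)) m
      _ ≤ _ := mul_le_mul_left hK2 _

/-- The points of a Riemannian manifold have regular charts. -/
theorem hasRegularChart [ChartedSpace (EuclideanSpace ℝ (Fin m)) M] [IsManifold (𝓡 m) ∞ M]
    [RiemannianBundle (fun x : M ↦ TangentSpace (𝓡 m) x)]
    [IsContMDiffRiemannianBundle (𝓡 m) ∞ (EuclideanSpace ℝ (Fin m))
      (fun x : M ↦ TangentSpace (𝓡 m) x)]
    [IsRiemannianManifold (𝓡 m) M] (x : M) :
    HasRegularChart (μHE[m] : Measure 𝔼) (μHE[m] : Measure M) x := by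
  classical
  obtain ⟨r, hr, K, htarget, hK⟩ := exists_bilipschitz_extChartAt (m := m) x
  set φ := extChartAt (𝓡 m) x with hφ
  -- With `ρ = r / 2` the affine map `a` sends the ball of radius 2 into the ball of radius `r`.
  set ρ : ℝ≥0 := ⟨r / 2, by positivity⟩ with hρ
  have hρ0 : 0 < ρ := by rw [← NNReal.coe_pos]; exact half_pos hr
  set a : 𝔼 → 𝔼 := fun y ↦ φ x + (ρ : ℝ) • y with ha
  have hamem : ∀ y ∈ Metric.ball (0 : 𝔼) 2, a y ∈ Metric.ball (φ x) r := by
    intro y hy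
    rw [mem_ball_zero_iff] at hy
    rw [mem_ball_iff_norm]
    simp only [ha, add_sub_cancel_left, norm_smul, Real.norm_eq_abs, NNReal.abs_eq]
    calc (ρ : ℝ) * ‖y‖ < ρ * 2 := by gcongr
      _ = r := by change r / 2 * 2 = r; ring
  have hae : ∀ y z, edist (a y) (a z) = ρ * edist y z := by
    intro y z
    simp only [ha, edist_add_left, edist_smul₀, ENNReal.smul_def, smul_eq_mul]
    simp
  -- The constant value outside the ball is arbitrary; it makes `ψ` measurable on the whole space.
  set ψ : 𝔼 → M := (Metric.ball (0 : 𝔼) 2).piecewise (φ.symm ∘ a) fun _ ↦ x with hψ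
  have hψeq : ∀ y ∈ Metric.ball (0 : 𝔼) 2, ψ y = φ.symm (a y) := fun y hy ↦
    piecewise_eq_of_mem _ _ _ hy
  have hac : Continuous a := by fun_prop
  have hψm : Measurable ψ := by
    refine ContinuousOn.measurable_piecewise ?_ continuousOn_const measurableSet_ball
    exact (continuousOn_extChartAt_symm x).comp hac.continuousOn
      fun y hy ↦ htarget (hamem y hy)
  refine hasRegularChart_of_bilipschitz (K := 1 + K * ρ + K * ρ⁻¹) (by
    rw [add_assoc]; exact le_self_add) hψm ?_ ?_ ?_
  · have h1 : φ.source ∩ φ ⁻¹' (a '' dyadicBall 𝔼 2) ∈ nhds x := by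
      refine Filter.inter_mem (extChartAt_source_mem_nhds x)
        ((continuousAt_extChartAt x).preimage_mem_nhds ?_)
      have : Metric.ball (φ x) (ρ / 4) ⊆ a '' dyadicBall 𝔼 2 := by
        intro z hz
        refine ⟨(ρ : ℝ)⁻¹ • (z - φ x), ?_, ?_⟩
        · rw [dyadicBall_eq_ball, mem_ball_zero_iff, norm_smul, norm_inv, Real.norm_eq_abs,
            NNReal.abs_eq]
          rw [mem_ball_iff_norm] at hz
          have : (0 : ℝ) < ρ := hρ0
          rw [inv_mul_lt_iff₀ this]
          norm_num
          linarith
        · have : (ρ : ℝ) ≠ 0 := NNReal.coe_ne_zero.2 hρ0.ne'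
          simp [ha, smul_smul, this]
      exact Filter.mem_of_superset (Metric.ball_mem_nhds _ (by positivity)) this
    refine Filter.mem_of_superset h1 ?_
    rintro z ⟨hz, y, hy, hyz⟩
    refine ⟨y, hy, ?_⟩
    rw [hψeq y (dyadicBall_two_subset hy), hyz, φ.left_inv hz]
  · intro y hy z hz
    rw [hψeq y hy, hψeq z hz]
    refine ((hK _ (hamem y hy) _ (hamem z hz)).1).trans ?_
    rw [hae, ← mul_assoc, ← ENNReal.coe_mul]
    gcongr
    exact le_add_right le_add_self
  · intro y hy z hz
    rw [hψeq y hy, hψeq z hz]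
    have h1 := (hK _ (hamem y hy) _ (hamem z hz)).2
    rw [hae] at h1
    calc edist y z = (ρ⁻¹ : ℝ≥0) * (ρ * edist y z) := by
          rw [← mul_assoc, ← ENNReal.coe_mul, inv_mul_cancel₀ hρ0.ne', ENNReal.coe_one, one_mul]
      _ ≤ (ρ⁻¹ : ℝ≥0) * (K * edist (φ.symm (a y)) (φ.symm (a z))) := mul_le_mul_right h1 _
      _ = (K * ρ⁻¹ : ℝ≥0) * edist (φ.symm (a y)) (φ.symm (a z)) := by
          rw [ENNReal.coe_mul]; ring
      _ ≤ _ := by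
          gcongr
          exact le_add_self

end RegularCharts

/-! ### Finiteness, positivity and growth of the volume -/

section ChartConsequences

variable {E : Type*} [NormedAddCommGroup E] [NormedSpace ℝ E] [FiniteDimensional ℝ E]
  [MeasurableSpace E] [BorelSpace E] {μ : Measure E} [μ.IsAddHaarMeasure]
  {M : Type*} [MetricSpace M] [MeasurableSpace M] [BorelSpace M] {ν : Measure M}

local notation "dim" => Module.finrank ℝ E

lemma isFiniteMeasure_of_hasRegularChart [CompactSpace M] (h : ∀ x, HasRegularChart μ ν x) :
    IsFiniteMeasure ν := by
  have : IsLocallyFiniteMeasure ν := ⟨fun x ↦ by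
    obtain ⟨ψ, K, -, hψ, hx, -, -, -, hm⟩ := h x
    refine ⟨_, hx, ?_⟩
    have h1 := hm univ
    rw [Measure.restrict_apply_univ, Measure.smul_apply, Measure.map_apply hψ MeasurableSet.univ,
      preimage_univ, Measure.restrict_apply_univ] at h1
    refine h1.trans_lt (ENNReal.mul_lt_top ENNReal.coe_lt_top ?_)
    rw [dyadicBall_eq_ball]
    exact measure_ball_lt_top⟩
  exact ⟨isCompact_univ.measure_lt_top⟩

lemma isOpenPosMeasure_of_hasRegularChart (h : ∀ x, HasRegularChart μ ν x) :
    ν.IsOpenPosMeasure := ⟨by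
  rintro O hO ⟨x, hx⟩ hO0
  obtain ⟨ψ, K, -, hψ, hxn, hlip, -, hm, -⟩ := h x
  obtain ⟨y, hy, hyx⟩ := mem_of_mem_nhds hxn
  have hy2 : y ∈ Metric.ball (0 : E) 2 := dyadicBall_two_subset hy
  have h1 := hm O
  rw [Measure.smul_apply, hO0, smul_zero, Measure.map_apply hψ hO.measurableSet,
    Measure.restrict_apply (hψ hO.measurableSet)] at h1
  have hc : ContinuousOn ψ (Metric.ball 0 2) :=
    (show LipschitzOnWith K ψ _ from fun y hy z hz ↦ hlip y hy z hz).continuousOn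
  have h2 : IsOpen (Metric.ball 0 2 ∩ ψ ⁻¹' O) := hc.isOpen_inter_preimage Metric.isOpen_ball hO
  have h3 : 0 < μ (Metric.ball 0 2 ∩ ψ ⁻¹' O) := h2.measure_pos μ ⟨y, hy2, by
    rw [mem_preimage, hyx]; exact hx⟩
  rw [inter_comm] at h3
  exact h3.not_ge h1⟩

/-- The measure of the balls is at most a multiple of `r ^ m`. -/
lemma exists_measure_eball_le [CompactSpace M] (h : ∀ x, HasRegularChart μ ν x) :
    ∃ C : ℝ≥0∞, C ≠ ⊤ ∧ ∀ (x : M) (r : ℝ≥0), ν (Metric.eball x r) ≤ C * (r : ℝ≥0∞) ^ dim := by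
  have key : ∃ C : ℝ≥0∞, C ≠ ⊤ ∧ ∀ (x : M) (r : ℝ≥0),
      ν (univ ∩ Metric.eball x r) ≤ C * (r : ℝ≥0∞) ^ dim := by
    refine isCompact_univ.induction_on (p := fun S : Set M ↦ ∃ C : ℝ≥0∞, C ≠ ⊤ ∧
      ∀ (x : M) (r : ℝ≥0), ν (S ∩ Metric.eball x r) ≤ C * (r : ℝ≥0∞) ^ dim) ?_ ?_ ?_ ?_
    · exact ⟨0, by simp⟩
    · rintro S T hST ⟨C, hC, h⟩
      exact ⟨C, hC, fun x r ↦ (measure_mono (inter_subset_inter_left _ hST)).trans (h x r)⟩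
    · rintro S T ⟨C, hC, h⟩ ⟨C', hC', h'⟩
      refine ⟨C + C', by finiteness, fun x r ↦ ?_⟩
      rw [union_inter_distrib_right, add_mul]
      exact (measure_union_le _ _).trans (add_le_add (h x r) (h' x r))
    · intro x₀ _
      rw [nhdsWithin_univ]
      obtain ⟨ψ, K, -, hψ, hxn, -, hanti, -, hm⟩ := h x₀
      refine ⟨_, hxn, K * ((2 * K) ^ dim * ballVolume (E := E) μ), ?_, fun x r ↦ ?_⟩
      · have := ballVolume_ne_top (μ := μ)
        finiteness
      by_cases hne : (ψ '' dyadicBall E 2 ∩ Metric.eball x r).Nonempty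
      swap
      · rw [not_nonempty_iff_eq_empty.1 hne]; simp
      obtain ⟨_, ⟨b, hb, rfl⟩, hbx⟩ := hne
      have h1 := hm (Metric.eball x r)
      rw [Measure.restrict_apply Metric.isOpen_eball.measurableSet, inter_comm,
        Measure.smul_apply, Measure.map_apply hψ Metric.isOpen_eball.measurableSet,
        Measure.restrict_apply (hψ Metric.isOpen_eball.measurableSet), smul_eq_mul] at h1
      refine h1.trans ?_
      rw [mul_assoc]
      refine mul_le_mul_right ?_ _
      have h2 : ψ ⁻¹' Metric.eball x r ∩ dyadicBall E 2 ⊆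
          Metric.closedBall b (2 * K * r : ℝ≥0) := by
        rintro y ⟨hy, hy2⟩
        rw [Metric.mem_closedBall, ← coe_nndist, NNReal.coe_le_coe, ← ENNReal.coe_le_coe,
          ← edist_nndist]
        have h3 : edist (ψ y) (ψ b) ≤ 2 * r := by
          calc edist (ψ y) (ψ b) ≤ edist (ψ y) x + edist (ψ b) x := edist_triangle_right _ _ _
            _ ≤ r + r := add_le_add (le_of_lt hy) (le_of_lt hbx)
            _ = 2 * r := (two_mul _).symm
        calc edist y b ≤ K * edist (ψ y) (ψ b) :=
              hanti y (dyadicBall_two_subset hy2) b (dyadicBall_two_subset hb)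
          _ ≤ K * (2 * r) := mul_le_mul_right h3 _
          _ = (2 * K * r : ℝ≥0) := by push_cast; ring
      refine (measure_mono h2).trans ?_
      rw [Measure.addHaar_closedBall μ b (by positivity), ballVolume, ENNReal.ofReal_pow
        (by positivity), ENNReal.ofReal_coe_nnreal]
      refine le_of_eq ?_
      push_cast
      rw [mul_pow (2 * (K : ℝ≥0∞))]
      ring
  simpa using key

end ChartConsequences

end FractionalLifting

namespace FractionalLifting

/-! ### Energies as kernel integrals -/

section Energy

variable {M X : Type*} [MetricSpace M] [MeasurableSpace M] [BorelSpace M] [MetricSpace X]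

lemma gagliardoEnergy_eq_kernelEnergy (m : ℕ) (s p : ℝ) (u : M → X) :
    gagliardoEnergy m s p u
      = kernelEnergy (μHE[m] : Measure M) (m + s * p) (fun x y ↦ edist (u x) (u y) ^ p) := by
  unfold gagliardoEnergy kernelEnergy
  simp_rw [edist_comm]

lemma gagliardoEnergy_congr_ae {m : ℕ} (s p : ℝ) {u v : M → X}
    (h : u =ᵐ[(μHE[m] : Measure M)] v) : gagliardoEnergy m s p u = gagliardoEnergy m s p v := by
  refine lintegral_congr_ae ?_
  filter_upwards [h] with x hx
  refine lintegral_congr_ae ?_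
  filter_upwards [h] with y hy
  rw [hx, hy]

lemma gagliardoEnergy_of_subsingleton [Subsingleton M] (m : ℕ) (s : ℝ) {p : ℝ} (hp : 0 < p)
    (u : M → X) : gagliardoEnergy m s p u = 0 := by
  have : ∀ x y, edist (u x) (u y) = 0 := fun x y ↦ by rw [Subsingleton.elim x y, edist_self]
  simp [gagliardoEnergy, this, hp]

/-- The pseudometric `c * d(w(x), w(y))`. -/
noncomputable def scaledDist (c : ℝ≥0∞) (w : M → X) (x y : M) : ℝ≥0∞ := c * edist (w x) (w y)

lemma isMeasurablePseudoDist_scaledDist [MeasurableSpace X] [BorelSpace X]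
    [SecondCountableTopology X] {c : ℝ≥0∞} (hc : c ≠ ⊤) {w : M → X} (hw : Measurable w) :
    IsMeasurablePseudoDist (scaledDist c w) where
  measurable := (((hw.comp measurable_fst).edist (hw.comp measurable_snd))).const_mul c
  symm x y := by rw [scaledDist, scaledDist, edist_comm]
  triangle x y z := by
    unfold scaledDist
    rw [← mul_add]
    exact mul_le_mul_right (edist_triangle _ _ _) _
  ne_top x y := ENNReal.mul_ne_top hc (edist_ne_top _ _)

lemma kernelEnergy_const_mul {ν : Measure M} {β : ℝ} {g : M → M → ℝ≥0∞} {c : ℝ≥0∞} (hc : c ≠ ⊤) :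
    kernelEnergy ν β (fun x y ↦ c * g x y) = c * kernelEnergy ν β g := by
  unfold kernelEnergy
  simp_rw [mul_div_assoc, lintegral_const_mul' _ _ hc]

lemma kernelEnergy_mono {ν : Measure M} {β : ℝ} {g g' : M → M → ℝ≥0∞}
    (h : ∀ x y, g x y ≤ g' x y) : kernelEnergy ν β g ≤ kernelEnergy ν β g' :=
  lintegral_mono fun x ↦ lintegral_mono fun y ↦ ENNReal.div_le_div_right (h x y) _

/-- Passage to a measurable representative `v` of `w`: the domain of the inner integral agrees, up
to a null set, with a measurable one. The hypothesis on `κ` says that the scaled distance can reach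
1 only where the distance is at least `κ`. -/
lemma kernelEnergy_largeIndicator_le {ν : Measure M} {β : ℝ} [MeasurableSpace X] [BorelSpace X]
    [SecondCountableTopology X] {κ c : ℝ≥0∞} {w v : M → X} (hv : Measurable v) (hwv : w =ᵐ[ν] v)
    (hκ : ∀ t, 1 ≤ c * t → κ ≤ t) :
    kernelEnergy ν β (largeIndicator (scaledDist c v))
      ≤ ∫⁻ x, ∫⁻ y in {y | κ ≤ edist (w x) (w y)}, 1 / edist x y ^ β ∂ν ∂ν := by
  refine lintegral_mono_ae ?_
  filter_upwards [hwv] with x hx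
  have hS : MeasurableSet {y | κ ≤ edist (v x) (v y)} :=
    measurableSet_le measurable_const (measurable_const.edist hv)
  have hSS : ({y | κ ≤ edist (w x) (w y)} : Set M) =ᵐ[ν] {y | κ ≤ edist (v x) (v y)} := by
    filter_upwards [hwv] with y hy
    change (κ ≤ edist (w x) (w y)) = (κ ≤ edist (v x) (v y))
    rw [hx, hy]
  rw [setLIntegral_congr hSS, ← lintegral_indicator hS]
  refine lintegral_mono fun y ↦ ?_
  by_cases h : 1 ≤ scaledDist c v x y
  · have hy : y ∈ {y | κ ≤ edist (v x) (v y)} := hκ _ h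
    rw [indicator_of_mem hy, largeIndicator, if_pos h]
  · simp [largeIndicator, h]

end Energy

/-! ### The energy of a lifting -/

section Lifting

variable {m : ℕ} {M : Type*} [MetricSpace M] [CompactSpace M] [ConnectedSpace M]
  [MeasurableSpace M] [BorelSpace M]
  [ChartedSpace (EuclideanSpace ℝ (Fin m)) M] [IsManifold (𝓡 m) ∞ M]
  [RiemannianBundle (fun x : M ↦ TangentSpace (𝓡 m) x)]
  [IsContMDiffRiemannianBundle (𝓡 m) ∞ (EuclideanSpace ℝ (Fin m))
    (fun x : M ↦ TangentSpace (𝓡 m) x)]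
  [IsRiemannianManifold (𝓡 m) M]

lemma subsingleton_of_dim_zero {M : Type*} [TopologicalSpace M] [ConnectedSpace M]
    [ChartedSpace (EuclideanSpace ℝ (Fin 0)) M] : Subsingleton M := by
  have : DiscreteTopology M := ChartedSpace.discreteTopology (EuclideanSpace ℝ (Fin 0)) M
  exact PreconnectedSpace.trivial_of_discrete

/-- The estimate of the energy of a map by the energy of its composition with a map which preserves
the distances less than `δ`. -/
theorem exists_gagliardoEnergy_le {s p : ℝ} (hs₀ : 0 < s) (hs₁ : s < 1) (hp : 1 < p)
    (hspm : (m : ℝ) ≤ s * p) (hsp : 1 < s * p)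
    {X Y : Type*} [MetricSpace X] [MeasurableSpace X] [BorelSpace X] [SecondCountableTopology X]
    [MetricSpace Y] {pr : X → Y} {δ : ℝ≥0} (hδ : 0 < δ)
    (hpr : ∀ a b, edist a b < δ → edist (pr a) (pr b) = edist a b) {κ : ℝ≥0∞} (hκ : κ ≤ δ) :
    ∃ C : ℝ≥0, 0 < C ∧ ∀ w : M → X, AEMeasurable w (μHE[m] : Measure M) →
      ∫⁻ x, ∫⁻ y in {y | κ ≤ edist (w x) (w y)}, 1 / edist x y ^ ((m : ℝ) + 1) ∂μHE[m] ∂μHE[m] < ⊤ →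
      gagliardoEnergy m s p w ≤
        C * (gagliardoEnergy m s p (pr ∘ w) + gagliardoEnergy m s p (pr ∘ w) ^ (1 / s)) := by
  have hp0 : 0 < p := by linarith
  -- The local theory needs a nontrivial model space; in dimension zero the manifold is a point and
  -- both energies vanish.
  rcases Nat.eq_zero_or_pos m with rfl | hm
  · have := subsingleton_of_dim_zero (M := M)
    exact ⟨1, one_pos, fun w _ _ ↦ by simp [gagliardoEnergy_of_subsingleton _ _ hp0]⟩
  have : Nonempty (Fin m) := ⟨⟨0, hm⟩⟩
  have : Nontrivial (EuclideanSpace ℝ (Fin m)) := inferInstance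
  have hchart := hasRegularChart (m := m) (M := M)
  have := isFiniteMeasure_of_hasRegularChart hchart
  have := isOpenPosMeasure_of_hasRegularChart hchart
  have hqp : s * p < p := by nlinarith
  -- With `q = s p`, the nonlinear exponent `p / q` of the local estimate is `1 / s`.
  have hps : p / (s * p) = 1 / s := by field_simp
  obtain ⟨C, hC, hmain⟩ := exists_kernelEnergy_le _ hchart hsp hqp (by simpa using hspm)
  rw [finrank_euclideanSpace_fin] at hmain
  -- Scaling distances by `1 / δ` makes 1 the threshold below which `pr` preserves them.
  set c : ℝ≥0∞ := ((δ⁻¹ : ℝ≥0) : ℝ≥0∞) with hc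
  have hδ0 : (δ : ℝ≥0∞) ≠ 0 := by simpa using hδ.ne'
  have hcδ : c = (δ : ℝ≥0∞)⁻¹ := ENNReal.coe_inv hδ.ne'
  have hct : c ≠ ⊤ := ENNReal.coe_ne_top
  have hcp : c ^ p ≠ ⊤ := ENNReal.rpow_ne_top_of_nonneg hp0.le hct
  have hδp : (δ : ℝ≥0∞) ^ p ≠ ⊤ := ENNReal.rpow_ne_top_of_nonneg hp0.le ENNReal.coe_ne_top
  have hs' : 0 ≤ 1 / s := by positivity
  have hcps : (c ^ p) ^ (1 / s) ≠ ⊤ := ENNReal.rpow_ne_top_of_nonneg hs' hcp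
  have h1c : ∀ t : ℝ≥0∞, c * t < 1 ↔ t < δ := by
    intro t
    rw [hcδ, mul_comm, ← div_eq_mul_inv,
      ENNReal.div_lt_iff (Or.inl hδ0) (Or.inl ENNReal.coe_ne_top), one_mul]
  set C' : ℝ≥0∞ := (δ : ℝ≥0∞) ^ p * (C * (c ^ p + (c ^ p) ^ (1 / s))) with hC'
  have hC't : C' ≠ ⊤ := by finiteness
  refine ⟨C'.toNNReal + 1, by positivity, fun w hw hfin ↦ ?_⟩
  obtain ⟨v, hv, hwv⟩ := hw
  rw [gagliardoEnergy_congr_ae s p hwv,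
    gagliardoEnergy_congr_ae s p (show pr ∘ w =ᵐ[μHE[m]] pr ∘ v from hwv.fun_comp pr)]
  have hfin' : kernelEnergy (μHE[m] : Measure M) (m + 1) (largeIndicator (scaledDist c v)) ≠ ⊤ :=
    ne_top_of_le_ne_top hfin.ne (kernelEnergy_largeIndicator_le hv hwv fun t ht ↦
      hκ.trans (not_lt.1 fun h ↦ ((h1c t).2 h).not_ge ht))
  have h1 := hmain _ (isMeasurablePseudoDist_scaledDist hct hv) hfin'
  rw [hps] at h1
  have h2 : kernelEnergy (μHE[m] : Measure M) (m + s * p)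
      (fun x y ↦ smallValues (scaledDist c v) x y ^ p)
      ≤ c ^ p * gagliardoEnergy m s p (pr ∘ v) := by
    rw [gagliardoEnergy_eq_kernelEnergy, ← kernelEnergy_const_mul hcp]
    refine kernelEnergy_mono fun x y ↦ ?_
    unfold smallValues
    split_ifs with h
    · rw [Function.comp_apply, Function.comp_apply, hpr _ _ ((h1c _).1 h), scaledDist,
        ENNReal.mul_rpow_of_nonneg _ _ hp0.le]
    · simp [hp0]
  have h3 : gagliardoEnergy m s p v = (δ : ℝ≥0∞) ^ p
      * kernelEnergy (μHE[m] : Measure M) (m + s * p) (fun x y ↦ scaledDist c v x y ^ p) := by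
    rw [gagliardoEnergy_eq_kernelEnergy, ← kernelEnergy_const_mul hδp]
    congr 1
    ext x y
    rw [scaledDist, ← ENNReal.mul_rpow_of_nonneg _ _ hp0.le, ← mul_assoc, hcδ,
      ENNReal.mul_inv_cancel hδ0 ENNReal.coe_ne_top, one_mul]
  rw [h3]
  calc _ ≤ (δ : ℝ≥0∞) ^ p * (C * ((c ^ p + (c ^ p) ^ (1 / s)) * (gagliardoEnergy m s p (pr ∘ v)
        + gagliardoEnergy m s p (pr ∘ v) ^ (1 / s)))) :=
        mul_le_mul_right (h1.trans (mul_le_mul_right (add_rpow_le_mul hs' h2) _)) _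
    _ = C' * (gagliardoEnergy m s p (pr ∘ v)
        + gagliardoEnergy m s p (pr ∘ v) ^ (1 / s)) := by rw [hC']; ring
    _ ≤ _ := by
        refine mul_le_mul_left ?_ _
        rw [ENNReal.coe_add, ENNReal.coe_toNNReal hC't]
        exact le_self_add

end Lifting

end FractionalLifting

/-! ### The injectivity radius of the circle -/

namespace FractionalLifting

/-- A Lebesgue number of the cover of `[0, ℓ]` by the intervals on which the curve realizes
distances. -/
lemma IsUnitSpeedGeodesic.exists_uniform {X : Type*} [MetricSpace X] {c : ℝ → X} {ℓ : ℝ}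
    (hc : IsUnitSpeedGeodesic c ℓ) : ∃ ε > 0, ∀ t₁ ∈ Icc 0 ℓ, ∀ t₂ ∈ Icc 0 ℓ, |t₁ - t₂| < ε →
      dist (c t₁) (c t₂) = |t₁ - t₂| := by
  choose! e he h using hc
  obtain ⟨ε, hε, hcov⟩ := lebesgue_number_lemma_of_metric (isCompact_Icc (a := (0 : ℝ)) (b := ℓ))
    (c := fun t : Icc (0 : ℝ) ℓ ↦ Metric.ball (t : ℝ) (e t)) (fun _ ↦ Metric.isOpen_ball)
    (fun t ht ↦ mem_iUnion.2 ⟨⟨t, ht⟩, Metric.mem_ball_self (he t ht)⟩)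
  refine ⟨ε, hε, fun t₁ h₁ t₂ h₂ h₁₂ ↦ ?_⟩
  obtain ⟨⟨t, ht⟩, hsub⟩ := hcov t₁ h₁
  refine h t ht t₁ h₁ t₂ h₂ (hsub (Metric.mem_ball_self hε)) (hsub ?_)
  rwa [Metric.mem_ball, dist_comm]

lemma exists_real_norm_eq (z : AddCircle (2 * Real.pi)) :
    ∃ r : ℝ, (r : AddCircle (2 * Real.pi)) = z ∧ |r| = ‖z‖ := by
  have : Fact (0 < 2 * Real.pi) := ⟨Real.two_pi_pos⟩
  obtain ⟨r, hr, rfl⟩ : z ∈ (QuotientAddGroup.mk : ℝ → AddCircle (2 * Real.pi)) ''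
      Icc (-Real.pi) (-Real.pi + 2 * Real.pi) := by
    rw [AddCircle.coe_image_Icc_eq]; trivial
  refine ⟨r, rfl, ?_⟩
  symm
  rw [AddCircle.norm_coe_eq_abs_iff _ Real.two_pi_pos.ne', abs_of_pos Real.two_pi_pos, abs_le]
  constructor <;> linarith [hr.1, hr.2]

lemma abs_add_three {r₁ r₂ r₃ : ℝ} (h₂ : r₂ ≠ 0) (h₁₂ : |r₁ + r₂| = |r₁| + |r₂|)
    (h₂₃ : |r₂ + r₃| = |r₂| + |r₃|) : |r₁ + r₂ + r₃| = |r₁| + |r₂| + |r₃| := by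
  rw [abs_add_eq_add_abs_iff] at h₁₂ h₂₃
  rcases lt_or_gt_of_ne h₂ with h | h
  · have h1 : r₁ ≤ 0 := by rcases h₁₂ with h' | h' <;> linarith [h'.1, h'.2]
    have h3 : r₃ ≤ 0 := by rcases h₂₃ with h' | h' <;> linarith [h'.1, h'.2]
    rw [abs_of_nonpos h1, abs_of_neg h, abs_of_nonpos h3, abs_of_nonpos (by linarith)]; ring
  · have h1 : 0 ≤ r₁ := by rcases h₁₂ with h' | h' <;> linarith [h'.1, h'.2]
    have h3 : 0 ≤ r₃ := by rcases h₂₃ with h' | h' <;> linarith [h'.1, h'.2]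
    rw [abs_of_nonneg h1, abs_of_pos h, abs_of_nonneg h3, abs_of_nonneg (by linarith)]

/-- The successive differences are represented by reals. Lengths being at most 1, the norm on the
circle is the absolute value, so additivity of the distances on both overlapping pairs means equal
signs; the nonzero middle step links the two signs. -/
lemma dist_addCircle_of_chain {a b x y : AddCircle (2 * Real.pi)} {l₁ l₂ l₃ : ℝ} (h₂ : 0 < l₂)
    (hl : l₁ + l₂ + l₃ ≤ 1)
    (hab : dist a b = l₁) (hbx : dist b x = l₂) (hxy : dist x y = l₃) (hax : dist a x = l₁ + l₂)
    (hby : dist b y = l₂ + l₃) : dist a y = l₁ + l₂ + l₃ := by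
  have hpi := Real.pi_gt_three
  have key : ∀ r : ℝ, |r| ≤ 1 → ‖(r : AddCircle (2 * Real.pi))‖ = |r| := fun r hr ↦ by
    rw [AddCircle.norm_coe_eq_abs_iff _ Real.two_pi_pos.ne', abs_of_pos Real.two_pi_pos]; linarith
  have h1 : 0 ≤ l₁ := hab ▸ dist_nonneg
  have h3 : 0 ≤ l₃ := hxy ▸ dist_nonneg
  obtain ⟨r₁, hr₁, hn₁⟩ := exists_real_norm_eq (a - b)
  obtain ⟨r₂, hr₂, hn₂⟩ := exists_real_norm_eq (b - x)
  obtain ⟨r₃, hr₃, hn₃⟩ := exists_real_norm_eq (x - y)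
  rw [← dist_eq_norm, hab] at hn₁
  rw [← dist_eq_norm, hbx] at hn₂
  rw [← dist_eq_norm, hxy] at hn₃
  have h12 : |r₁ + r₂| = |r₁| + |r₂| := by
    rw [← key _ ((abs_add_le _ _).trans (by linarith)), AddCircle.coe_add, hr₁, hr₂,
      sub_add_sub_cancel, ← dist_eq_norm,
      hax, hn₁, hn₂]
  have h23 : |r₂ + r₃| = |r₂| + |r₃| := by
    rw [← key _ ((abs_add_le _ _).trans (by linarith)), AddCircle.coe_add, hr₂, hr₃,
      sub_add_sub_cancel, ← dist_eq_norm,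
      hby, hn₂, hn₃]
  have h123 := abs_add_three (abs_pos.1 (hn₂ ▸ h₂)) h12 h23
  rw [dist_eq_norm, ← hn₁, ← hn₂, ← hn₃, ← h123, ← key _ (by rw [h123]; linarith),
    AddCircle.coe_add, AddCircle.coe_add, hr₁, hr₂, hr₃,
    sub_add_sub_cancel, sub_add_sub_cancel]

/-- Induction on the length in steps of `ε / 3`: the arc from `a` to `t`, known by induction, and a
last arc shorter than `ε` overlap on `[t - ε / 3, t]`, so `dist_addCircle_of_chain` glues them. -/
lemma dist_eq_of_isUnitSpeedGeodesic_addCircle {c : ℝ → AddCircle (2 * Real.pi)} {ℓ : ℝ}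
    (h0 : 0 ≤ ℓ) (h1 : ℓ ≤ 1) (hc : IsUnitSpeedGeodesic c ℓ) : dist (c 0) (c ℓ) = ℓ := by
  obtain ⟨ε, hε, h⟩ := hc.exists_uniform
  have key : ∀ k : ℕ, ∀ a b : ℝ, 0 ≤ a → a ≤ b → b ≤ ℓ → b ≤ k * (ε / 3) →
      dist (c a) (c b) = b - a := by
    intro k
    induction k with
    | zero =>
      intro a b ha hab hb hbk
      have hb0 : b = 0 := by simp at hbk; linarith
      have ha0 : a = 0 := by linarith
      simp [hb0, ha0]
    | succ k ih =>
      intro a b ha hab hb hbk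
      rcases lt_or_ge (b - a) ε with hlt | hge
      · rw [h a ⟨ha, hab.trans hb⟩ b ⟨ha.trans hab, hb⟩
          (by rw [abs_sub_comm, abs_of_nonneg] <;> linarith),
          abs_sub_comm, abs_of_nonneg (by linarith)]
      push_cast at hbk
      set t := b - ε / 3 with ht
      have htk : t ≤ k * (ε / 3) := by linarith
      have hloc : ∀ u v, a ≤ u → u ≤ v → v ≤ b → v - u < ε → dist (c u) (c v) = v - u := by
        intro u v hu huv hv hlt
        rw [h u ⟨ha.trans hu, by linarith⟩ v ⟨by linarith, by linarith⟩
          (by rw [abs_sub_comm, abs_of_nonneg] <;> linarith),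
          abs_sub_comm, abs_of_nonneg (by linarith)]
      have := dist_addCircle_of_chain (a := c a) (b := c (t - ε / 3)) (x := c t) (y := c b)
        (l₁ := t - ε / 3 - a) (l₂ := ε / 3) (l₃ := b - t) (by positivity) (by linarith)
        (ih _ _ ha (by linarith) (by linarith) (by linarith))
        (by rw [hloc _ _ (by linarith) (by linarith) (by linarith) (by linarith)]; ring)
        (hloc _ _ (by linarith) (by linarith) (by linarith) (by linarith))
        (by rw [ih _ _ ha (by linarith) (by linarith) htk]; ring)
        (by rw [hloc _ _ (by linarith) (by linarith) (by linarith) (by linarith)]; ring)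
      rw [this]; ring
  obtain ⟨k, hk⟩ := exists_nat_ge (ℓ / (ε / 3))
  have := key k 0 ℓ le_rfl h0 le_rfl (by rwa [div_le_iff₀ (by positivity)] at hk)
  simpa using this

/-- A crude bound: only the positivity of the injectivity radius is needed afterwards. -/
lemma one_le_injectivityRadius_addCircle : 1 ≤ injectivityRadius (AddCircle (2 * Real.pi)) := by
  refine le_iSup₂_of_le (1 : ℝ≥0) (fun ℓ c h0 h1 hc ↦ ?_) (by simp)
  exact dist_eq_of_isUnitSpeedGeodesic_addCircle h0 (by simpa using h1) hc

/-! ### Integrals of truncated powers against the singular kernel -/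

section
variable {M : Type*} [MetricSpace M] [MeasurableSpace M] [BorelSpace M]

lemma setLIntegral_shell_le {ν : Measure M} {m : ℕ} {A : ℝ≥0∞}
    (hball : ∀ (x : M) (r : ℝ≥0), ν (Metric.eball x r) ≤ A * r ^ m) {q : ℝ} (hq : 0 < q)
    (x : M) {ρ : ℝ} (hρ : 0 < ρ) {g : M → ℝ≥0∞} {H : ℝ≥0∞}
    (hg : ∀ y, ρ ≤ dist x y → dist x y < 2 * ρ → g y ≤ H) :
    ∫⁻ y in {y | ρ ≤ dist x y ∧ dist x y < 2 * ρ}, g y / edist x y ^ ((m : ℝ) + q) ∂ν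
      ≤ 2 ^ m * A * (H * ENNReal.ofReal (ρ ^ (-q))) := by
  have hS : MeasurableSet {y | ρ ≤ dist x y ∧ dist x y < 2 * ρ} :=
    (measurableSet_le measurable_const (continuous_const.dist continuous_id).measurable).inter
      (measurableSet_lt (continuous_const.dist continuous_id).measurable measurable_const)
  have hρ0 : ENNReal.ofReal ρ ≠ 0 := by simpa using hρ
  calc _ ≤ ∫⁻ y in {y | ρ ≤ dist x y ∧ dist x y < 2 * ρ},
        H / ENNReal.ofReal ρ ^ ((m : ℝ) + q) ∂ν := by
        refine setLIntegral_mono' hS fun y hy ↦ ENNReal.div_le_div (hg y hy.1 hy.2) ?_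
        rw [edist_dist]
        gcongr
        exact hy.1
    _ ≤ H / ENNReal.ofReal ρ ^ ((m : ℝ) + q) * (A * ((2 * ρ).toNNReal : ℝ≥0∞) ^ m) := by
        rw [setLIntegral_const]
        refine mul_le_mul_right ((measure_mono fun y hy ↦ ?_).trans (hball x _)) _
        rw [Metric.mem_eball, edist_comm, edist_dist]
        exact (ENNReal.ofReal_lt_ofReal_iff (by positivity)).2 hy.2
    _ = _ := by
        rw [← ENNReal.ofReal_rpow_of_pos hρ]
        change _ * (A * ENNReal.ofReal (2 * ρ) ^ m) = _
        rw [ENNReal.ofReal_mul zero_le_two, mul_pow, div_eq_mul_inv, ← ENNReal.rpow_neg, neg_add,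
          ENNReal.rpow_add _ _ hρ0 ENNReal.ofReal_ne_top, ENNReal.rpow_neg, ENNReal.rpow_natCast]
        have h1 : (ENNReal.ofReal ρ ^ m)⁻¹ * ENNReal.ofReal ρ ^ m = 1 :=
          ENNReal.inv_mul_cancel (by simpa using fun h ↦ absurd h hρ.not_ge) (by finiteness)
        calc _ = 2 ^ m * A * (H * ENNReal.ofReal ρ ^ (-q))
              * ((ENNReal.ofReal ρ ^ m)⁻¹ * ENNReal.ofReal ρ ^ m) := by
              rw [ENNReal.ofReal_ofNat]; ring
          _ = _ := by rw [h1, mul_one]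

/-- The integral of a truncated power of the distance against a singular kernel, at scale
`1 / L`. -/
lemma exists_lintegral_min_le {ν : Measure M} {m : ℕ} {A : ℝ≥0∞} (hA : A ≠ ⊤)
    (hball : ∀ (x : M) (r : ℝ≥0), ν (Metric.eball x r) ≤ A * r ^ m) {p q : ℝ} (hq : 0 < q)
    (hqp : q < p) :
    ∃ C : ℝ≥0∞, C ≠ ⊤ ∧ ∀ (x : M) (L : ℝ), 0 < L →
      ∫⁻ y, ENNReal.ofReal (min (L * dist x y) 4 ^ p) / edist x y ^ ((m : ℝ) + q) ∂ν
        ≤ C * ENNReal.ofReal (L ^ q) := by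
  have hp : 0 < p := hq.trans hqp
  set a : ℝ≥0∞ := ENNReal.ofReal ((2 : ℝ) ^ (-q)) with ha
  set b : ℝ≥0∞ := ENNReal.ofReal ((2 : ℝ) ^ (q - p)) with hb
  have ha1 : a < 1 := by
    rw [ha, ENNReal.ofReal_lt_one]
    exact Real.rpow_lt_one_of_one_lt_of_neg one_lt_two (by linarith)
  have hb1 : b < 1 := by
    rw [hb, ENNReal.ofReal_lt_one]
    exact Real.rpow_lt_one_of_one_lt_of_neg one_lt_two (by linarith)
  have ha' : (1 - a)⁻¹ ≠ ⊤ := ENNReal.inv_ne_top.2 (tsub_pos_of_lt ha1).ne'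
  have hb' : (1 - b)⁻¹ ≠ ⊤ := ENNReal.inv_ne_top.2 (tsub_pos_of_lt hb1).ne'
  refine ⟨2 ^ m * A * (ENNReal.ofReal (4 ^ p) * (1 - a)⁻¹)
    + 2 ^ m * A * (ENNReal.ofReal (2 ^ q) * (1 - b)⁻¹), by finiteness, fun x L hL ↦ ?_⟩
  set F : M → ℝ≥0∞ := fun y ↦ ENNReal.ofReal (min (L * dist x y) 4 ^ p) with hF
  set S : ℝ → Set M := fun ρ ↦ {y | ρ ≤ dist x y ∧ dist x y < 2 * ρ} with hS
  -- Dyadic shells around `x`, outside and inside the radius `1 / L`. The point `x` itself is not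
  -- covered, but the integrand vanishes there.
  have hsupp : (fun y ↦ F y / edist x y ^ ((m : ℝ) + q)).support
      ⊆ (⋃ k : ℕ, S (2 ^ k / L)) ∪ ⋃ k : ℕ, S ((1 / 2) ^ (k + 1) / L) := by
    intro y hy
    have hxy : 0 < dist x y := by
      refine dist_nonneg.lt_of_ne' fun h ↦ hy ?_
      simp [hF, h, hp.ne']
    have ht : 0 < L * dist x y := by positivity
    rcases le_or_gt 1 (L * dist x y) with h | h
    · obtain ⟨k, h1, h2⟩ := exists_nat_pow_near h one_lt_two
      refine Or.inl (mem_iUnion.2 ⟨k, ?_, ?_⟩)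
      · rwa [div_le_iff₀' hL]
      · rw [← mul_div_assoc, lt_div_iff₀' hL]; rwa [pow_succ'] at h2
    · obtain ⟨k, h1, h2⟩ := exists_nat_pow_near_of_lt_one (x := L * dist x y) (y := 1 / 2)
        ht h.le (by norm_num) (by norm_num)
      -- The interval obtained is closed at its upper end, whereas shells are closed at the lower
      -- end; in the case of equality the point belongs to the next larger shell.
      rcases h2.lt_or_eq with h2 | h2
      · refine Or.inr (mem_iUnion.2 ⟨k, ?_, ?_⟩)
        · rw [div_le_iff₀' hL]; exact h1.le
        · rw [← mul_div_assoc, lt_div_iff₀' hL, pow_succ']; linarith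
      · rcases k with _ | k
        · rw [pow_zero] at h2; exact absurd h2 h.ne
        · refine Or.inr (mem_iUnion.2 ⟨k, ?_, ?_⟩)
          · rw [div_le_iff₀' hL]; exact h2.ge
          · rw [← mul_div_assoc, lt_div_iff₀' hL, h2]
            have : (0 : ℝ) < (1 / 2) ^ (k + 1) := by positivity
            linarith
  -- Outside, the truncation at 4 leaves a series of ratio `2 ^ (-q)`.
  have h1 : ∀ k : ℕ, ∫⁻ y in S (2 ^ k / L), F y / edist x y ^ ((m : ℝ) + q) ∂ν
      ≤ 2 ^ m * A * (ENNReal.ofReal (4 ^ p) * a ^ k) * ENNReal.ofReal (L ^ q) := by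
    intro k
    refine (setLIntegral_shell_le hball hq x (by positivity) (H := ENNReal.ofReal (4 ^ p))
      fun y _ _ ↦ ?_).trans_eq ?_
    · exact ENNReal.ofReal_le_ofReal (Real.rpow_le_rpow (le_min (by positivity) (by norm_num))
        (min_le_right _ _) hp.le)
    · rw [Real.div_rpow (by positivity) hL.le, Real.rpow_neg hL.le, div_inv_eq_mul,
        ENNReal.ofReal_mul (by positivity), ha, ← ENNReal.ofReal_pow (by positivity),
        ← Real.rpow_natCast, ← Real.rpow_natCast, ← Real.rpow_mul zero_le_two,
        ← Real.rpow_mul zero_le_two, mul_comm (k : ℝ)]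
      ring
  -- Inside, `L * dist x y < 2 ^ (-k)` gives the ratio `2 ^ (q - p)`, summable because `q < p`.
  have h2 : ∀ k : ℕ, ∫⁻ y in S ((1 / 2) ^ (k + 1) / L), F y / edist x y ^ ((m : ℝ) + q) ∂ν
      ≤ 2 ^ m * A * (ENNReal.ofReal (2 ^ q) * b ^ k) * ENNReal.ofReal (L ^ q) := by
    intro k
    refine (setLIntegral_shell_le hball hq x (by positivity)
      (H := ENNReal.ofReal ((2 : ℝ) ^ (-(k * p)))) fun y _ hy ↦ ?_).trans_eq ?_
    · refine ENNReal.ofReal_le_ofReal ?_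
      rw [← neg_mul, Real.rpow_mul zero_le_two]
      refine Real.rpow_le_rpow (le_min (by positivity) (by norm_num))
        ((min_le_left _ _).trans ?_) hp.le
      rw [← mul_div_assoc, lt_div_iff₀' hL, pow_succ'] at hy
      rw [Real.rpow_neg zero_le_two, Real.rpow_natCast, ← inv_pow]
      have : (2⁻¹ : ℝ) ^ k = 2 * (1 / 2 * (1 / 2) ^ k) := by rw [one_div]; ring
      linarith
    · have : (2 : ℝ) ^ (-(k * p)) * ((1 / 2) ^ (k + 1) / L) ^ (-q)
          = 2 ^ q * (2 ^ (q - p)) ^ k * L ^ q := by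
        rw [Real.div_rpow (by positivity) hL.le, Real.rpow_neg hL.le q, div_inv_eq_mul,
          show ((1 : ℝ) / 2) ^ (k + 1) = 2 ^ (-((k : ℝ) + 1)) by
            rw [Real.rpow_neg zero_le_two, ← Nat.cast_add_one, Real.rpow_natCast, one_div, inv_pow],
          ← Real.rpow_natCast, ← Real.rpow_mul zero_le_two, ← Real.rpow_mul zero_le_two,
          ← Real.rpow_add zero_lt_two, ← mul_assoc, ← Real.rpow_add zero_lt_two]
        ring_nf
      rw [← ENNReal.ofReal_mul (by positivity), this, ENNReal.ofReal_mul (by positivity),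
        ENNReal.ofReal_mul (by positivity), hb, ← ENNReal.ofReal_pow (by positivity)]
      ring
  calc _ ≤ ∫⁻ y in (⋃ k : ℕ, S (2 ^ k / L)) ∪ ⋃ k : ℕ, S ((1 / 2) ^ (k + 1) / L),
        F y / edist x y ^ ((m : ℝ) + q) ∂ν := by
        rw [setLIntegral_eq_of_support_subset hsupp]
    _ ≤ ∑' k : ℕ, ∫⁻ y in S (2 ^ k / L), F y / edist x y ^ ((m : ℝ) + q) ∂ν
        + ∑' k : ℕ, ∫⁻ y in S ((1 / 2) ^ (k + 1) / L), F y / edist x y ^ ((m : ℝ) + q) ∂ν :=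
        (lintegral_union_le _ _ _).trans
          (add_le_add (lintegral_iUnion_le _ _) (lintegral_iUnion_le _ _))
    _ ≤ _ := by
        refine (add_le_add (ENNReal.tsum_le_tsum h1) (ENNReal.tsum_le_tsum h2)).trans_eq ?_
        simp_rw [ENNReal.tsum_mul_right, ENNReal.tsum_mul_left, ENNReal.tsum_geometric]
        ring
end

end FractionalLifting

namespace FractionalLifting

/-! ### Optimality of the exponent -/

section Optimality

variable {m : ℕ} {M : Type*} [MetricSpace M] [CompactSpace M] [ConnectedSpace M]
  [MeasurableSpace M] [BorelSpace M]
  [ChartedSpace (EuclideanSpace ℝ (Fin m)) M] [IsManifold (𝓡 m) ∞ M]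
  [RiemannianBundle (fun x : M ↦ TangentSpace (𝓡 m) x)]
  [IsContMDiffRiemannianBundle (𝓡 m) ∞ (EuclideanSpace ℝ (Fin m))
    (fun x : M ↦ TangentSpace (𝓡 m) x)]
  [IsRiemannianManifold (𝓡 m) M]

lemma not_subsingleton_of_chartedSpace {E M : Type*} [NormedAddCommGroup E] [NormedSpace ℝ E]
    [Nontrivial E] [TopologicalSpace M] [ChartedSpace E M] (x : M) : ¬ Subsingleton M := by
  intro h
  have := Module.punctured_nhds_neBot ℝ E (chartAt E x x)
  refine not_isOpen_singleton (chartAt E x x) ?_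
  have : (chartAt E x).target = {chartAt E x x} := by
    refine Subset.antisymm (fun y hy ↦ ?_) (singleton_subset_iff.2 (mem_chart_target E x))
    rw [mem_singleton_iff, ← (chartAt E x).right_inv hy, Subsingleton.elim ((chartAt E x).symm y) x]
  rw [← this]
  exact (chartAt E x).open_target

lemma gagliardoEnergy_const_mul (s : ℝ) {p : ℝ} (hp : 0 < p) {c : ℝ} (hc : 0 ≤ c) (u : M → ℝ) :
    gagliardoEnergy m s p (fun x ↦ c * u x) = ENNReal.ofReal (c ^ p) * gagliardoEnergy m s p u := by
  rw [gagliardoEnergy_eq_kernelEnergy, gagliardoEnergy_eq_kernelEnergy,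
    ← kernelEnergy_const_mul ENNReal.ofReal_ne_top]
  congr 1
  ext x y
  rw [edist_dist, edist_dist, Real.dist_eq, Real.dist_eq, ← mul_sub, abs_mul, abs_of_nonneg hc,
    ENNReal.ofReal_mul hc, ENNReal.mul_rpow_of_nonneg _ _ hp.le,
    ENNReal.ofReal_rpow_of_nonneg hc hp.le]

lemma gagliardoEnergy_le_add [SFinite (μHE[m] : Measure M)] (s : ℝ) {p : ℝ} (hp : 1 ≤ p)
    {X Y Z : Type*}
    [MetricSpace X] [MetricSpace Y] [MetricSpace Z] {u : M → X} {v : M → Y} {w : M → Z}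
    (hv : Continuous v) (h : ∀ x y, edist (u x) (u y) ≤ edist (v x) (v y) + edist (w x) (w y)) :
    gagliardoEnergy m s p u
      ≤ 2 ^ (p - 1) * (gagliardoEnergy m s p v + gagliardoEnergy m s p w) := by
  have hm : Measurable (Function.uncurry fun x y ↦
      edist (v x) (v y) ^ p / edist x y ^ ((m : ℝ) + s * p)) :=
    measurable_div_edist (((hv.comp continuous_fst).edist
      (hv.comp continuous_snd)).measurable.pow_const p) _
  have h2 : (2 : ℝ≥0∞) ^ (p - 1) ≠ ⊤ :=
    ENNReal.rpow_ne_top_of_nonneg (by linarith) (by simp)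
  simp_rw [gagliardoEnergy_eq_kernelEnergy]
  calc _ ≤ kernelEnergy μHE[m] (m + s * p) (fun x y ↦ 2 ^ (p - 1) *
        (edist (v x) (v y) ^ p + edist (w x) (w y) ^ p)) :=
        kernelEnergy_mono fun x y ↦ (ENNReal.rpow_le_rpow (h x y) (by linarith)).trans
          (ENNReal.rpow_add_le_mul_rpow_add_rpow _ _ hp)
    _ = _ := by
        rw [kernelEnergy_const_mul h2]
        congr 1
        unfold kernelEnergy
        simp_rw [ENNReal.add_div]
        have hI : Measurable fun x ↦ ∫⁻ y, edist (v x) (v y) ^ p / edist x y ^ ((m : ℝ) + s * p)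
            ∂(μHE[m] : Measure M) := hm.lintegral_prod_right'
        rw [← lintegral_add_left hI]
        exact lintegral_congr fun x ↦ lintegral_add_left (hm.of_uncurry_left (x := x)) _

/-- The distance to `x₀`, truncated at `1`. -/
def truncatedDist {X : Type*} [MetricSpace X] (x₀ x : X) : ℝ := min (dist x x₀) 1

lemma continuous_truncatedDist {X : Type*} [MetricSpace X] (x₀ : X) :
    Continuous (truncatedDist x₀) :=
  (continuous_id.dist continuous_const).min continuous_const

lemma abs_truncatedDist_sub_le {X : Type*} [MetricSpace X] (x₀ x y : X) :
    |truncatedDist x₀ x - truncatedDist x₀ y| ≤ dist x y := by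
  refine (abs_min_sub_min_le_max _ _ _ _).trans ?_
  simpa using abs_dist_sub_le x y x₀

lemma abs_truncatedDist_sub_le_one {X : Type*} [MetricSpace X] (x₀ x y : X) :
    |truncatedDist x₀ x - truncatedDist x₀ y| ≤ 1 := by
  have h : ∀ z, 0 ≤ truncatedDist x₀ z ∧ truncatedDist x₀ z ≤ 1 := fun z ↦
    ⟨le_min dist_nonneg zero_le_one, min_le_right _ _⟩
  rw [abs_le]
  constructor <;> linarith [(h x).1, (h x).2, (h y).1, (h y).2]

/-- Zero energy would make this continuous function constant almost everywhere, hence everywhere,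
and reduce `M` to the point `x₀`, which `m ≥ 1` forbids. -/
lemma gagliardoEnergy_truncatedDist_ne_zero [IsFiniteMeasure (μHE[m] : Measure M)]
    [(μHE[m] : Measure M).IsOpenPosMeasure]
    (hm : 1 ≤ m) {s p : ℝ} (hs : 0 < s) (hp : 0 < p) (x₀ : M) :
    gagliardoEnergy m s p (truncatedDist x₀) ≠ 0 := by
  intro h
  rw [gagliardoEnergy_eq_kernelEnergy] at h
  have hmeas : Measurable (Function.uncurry fun x y ↦
      edist (truncatedDist x₀ x) (truncatedDist x₀ y) ^ p / edist x y ^ ((m : ℝ) + s * p)) :=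
    measurable_div_edist ((((continuous_truncatedDist x₀).comp continuous_fst).edist
      ((continuous_truncatedDist x₀).comp continuous_snd)).measurable.pow_const p) _
  have hI : Measurable fun x ↦ ∫⁻ y, edist (truncatedDist x₀ x) (truncatedDist x₀ y) ^ p
      / edist x y ^ ((m : ℝ) + s * p) ∂(μHE[m] : Measure M) := hmeas.lintegral_prod_right'
  obtain ⟨x, hx⟩ := ((lintegral_eq_zero_iff hI).1 h).exists
  replace hx := (lintegral_eq_zero_iff (hmeas.of_uncurry_left (x := x))).1 hx
  have hae : truncatedDist x₀ =ᵐ[(μHE[m] : Measure M)] fun _ ↦ truncatedDist x₀ x := by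
    filter_upwards [hx] with y hy
    simp only [Pi.zero_apply, ENNReal.div_eq_zero_iff] at hy
    rcases hy with hy | hy
    · rw [ENNReal.rpow_eq_zero_iff_of_pos hp, edist_eq_zero] at hy
      exact hy.symm
    · exact absurd hy (ENNReal.rpow_ne_top_of_nonneg (by positivity) (edist_ne_top _ _))
  rw [Continuous.ae_eq_iff_eq _ (continuous_truncatedDist x₀) continuous_const] at hae
  have h0 : ∀ y, y = x₀ := fun y ↦ by
    have h1 : truncatedDist x₀ y = truncatedDist x₀ x₀ :=
      (congrFun hae y).trans (congrFun hae x₀).symm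
    simp only [truncatedDist, dist_self, zero_le_one, inf_of_le_left] at h1
    rcases min_choice (dist y x₀) 1 with h2 | h2
    · exact dist_eq_zero.1 (h2.symm.trans h1)
    · rw [h2] at h1; exact absurd h1 one_ne_zero
  have : Nonempty (Fin m) := ⟨⟨0, hm⟩⟩
  exact not_subsingleton_of_chartedSpace (E := EuclideanSpace ℝ (Fin m)) x₀
    ⟨fun a b ↦ (h0 a).trans (h0 b).symm⟩

/-- Pairs whose values are far apart are themselves far apart, so the kernel is bounded on them and
the volume is finite. -/
lemma memX_of_lipschitz [IsFiniteMeasure (μHE[m] : Measure M)] {N : Type*} [MetricSpace N]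
    (hN : 0 < injectivityRadius N)
    {w : M → ℝ} {L : ℝ} (hL : 0 ≤ L) (hw : ∀ x y, |w x - w y| ≤ L * dist x y) : MemX N m w := by
  have hcont : Continuous w := (LipschitzWith.of_dist_le_mul (K := L.toNNReal) fun x y ↦ by
    rw [Real.coe_toNNReal _ hL]; exact hw x y).continuous
  refine ⟨hcont.measurable.aemeasurable, ?_⟩
  -- The minimum with 1 covers the case of an infinite injectivity radius.
  obtain ⟨κ, hκ0, hκ⟩ : ∃ κ : ℝ, 0 < κ ∧ ENNReal.ofReal κ ≤ injectivityRadius N / 2 := by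
    refine ⟨(min (injectivityRadius N / 2) 1).toReal, ENNReal.toReal_pos ?_ (by simp), ?_⟩
    · exact (lt_min (ENNReal.div_pos hN.ne' (by simp)) one_pos).ne'
    · rw [ENNReal.ofReal_toReal (by simp)]
      exact min_le_left _ _
  have hβ : (0 : ℝ) ≤ (m : ℝ) + 1 := by positivity
  set B : ℝ≥0∞ := 1 / ENNReal.ofReal (κ / (L + 1)) ^ ((m : ℝ) + 1) with hB
  have hBt : B ≠ ⊤ := by
    refine ENNReal.div_ne_top ENNReal.one_ne_top ?_
    rw [ENNReal.ofReal_rpow_of_pos (by positivity)]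
    simp only [ne_eq, ENNReal.ofReal_eq_zero, not_le]
    positivity
  calc _ ≤ ∫⁻ _ : M, ∫⁻ _ : M, B ∂μHE[m] ∂μHE[m] := by
        refine lintegral_mono fun x ↦ ?_
        have hS : MeasurableSet {y | injectivityRadius N / 2 ≤ edist (w x) (w y)} :=
          measurableSet_le measurable_const (continuous_const.edist hcont).measurable
        refine (setLIntegral_mono' hS fun y hy ↦ ?_).trans (setLIntegral_le_lintegral _ _)
        refine ENNReal.div_le_div_left (ENNReal.rpow_le_rpow ?_ hβ) _
        rw [edist_dist]
        refine ENNReal.ofReal_le_ofReal ?_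
        have h1 := hκ.trans hy
        rw [edist_dist, ENNReal.ofReal_le_ofReal_iff dist_nonneg, Real.dist_eq] at h1
        rw [div_le_iff₀ (by positivity)]
        nlinarith [hw x y, dist_nonneg (x := x) (y := y)]
    _ < ⊤ := by
        rw [lintegral_const, lintegral_const]
        finiteness

lemma norm_coe_addCircle_le (r : ℝ) : ‖(r : AddCircle (2 * Real.pi))‖ ≤ min |r| 4 := by
  refine le_min (QuotientAddGroup.norm_mk_le_norm (m := r)) ?_
  have h1 := AddCircle.norm_le_half_period (2 * Real.pi) (x := r) Real.two_pi_pos.ne'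
  rw [abs_of_pos Real.two_pi_pos] at h1
  linarith [Real.pi_le_four]

lemma dist_coe_addCircle (a b : ℝ) :
    dist (a : AddCircle (2 * Real.pi)) b = ‖((a - b : ℝ) : AddCircle (2 * Real.pi))‖ := by
  rw [dist_eq_norm, AddCircle.coe_sub]

lemma dist_coe_addCircle_of_le_one {a b : ℝ} (h : |a - b| ≤ 1) :
    dist (a : AddCircle (2 * Real.pi)) b = dist a b := by
  rw [dist_coe_addCircle, AddCircle.norm_coe_eq_abs_iff _ Real.two_pi_pos.ne' |>.2, Real.dist_eq]
  rw [abs_of_pos Real.two_pi_pos]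
  linarith [Real.pi_gt_three]

/-- The optimality of the exponent in the estimate of the energy of the liftings to the universal
covering of the circle. -/
theorem one_div_le_of_gagliardoEnergy_le (hm : 1 ≤ m) {s p : ℝ} (hs₀ : 0 < s) (hs₁ : s < 1)
    (hp : 1 < p) {γ : ℝ} {C : ℝ≥0}
    (hC : ∀ w : M → ℝ, MemX (AddCircle (2 * Real.pi)) m w →
      MemFractionalSobolev m s p (fun x ↦ (w x : AddCircle (2 * Real.pi))) →
      gagliardoEnergy m s p w ≤
        C * (gagliardoEnergy m s p (fun x ↦ (w x : AddCircle (2 * Real.pi))) +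
          gagliardoEnergy m s p (fun x ↦ (w x : AddCircle (2 * Real.pi))) ^ γ)) :
    1 / s ≤ γ := by
  have hp0 : 0 < p := by linarith
  have hq0 : 0 < s * p := by positivity
  have hqp : s * p < p := by nlinarith
  have : Nonempty (Fin m) := ⟨⟨0, hm⟩⟩
  have hchart := hasRegularChart (m := m) (M := M)
  have := isFiniteMeasure_of_hasRegularChart hchart
  have := isOpenPosMeasure_of_hasRegularChart hchart
  obtain ⟨A, hA, hball⟩ := exists_measure_eball_le hchart
  rw [finrank_euclideanSpace_fin] at hball
  obtain ⟨x₀⟩ : Nonempty M := inferInstance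
  set ψ : M → ℝ := truncatedDist x₀ with hψ
  set a : ℕ → ℝ≥0∞ := fun n ↦
    gagliardoEnergy m s p (fun x ↦ ((n * ψ x : ℝ) : AddCircle (2 * Real.pi))) with ha
  set e := gagliardoEnergy m s p ψ with he
  have hLip : ∀ (n : ℕ) (x y : M), |n * ψ x - n * ψ y| ≤ n * dist x y := fun n x y ↦ by
    rw [← mul_sub, abs_mul, Nat.abs_cast]
    exact mul_le_mul_of_nonneg_left (abs_truncatedDist_sub_le x₀ x y) n.cast_nonneg
  have hcont : ∀ n : ℕ, Continuous fun x ↦ ((n * ψ x : ℝ) : AddCircle (2 * Real.pi)) := fun n ↦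
    (AddCircle.continuous_mk' _).comp (continuous_const.mul (continuous_truncatedDist x₀))
  -- On the circle distances are at most 4 and the map is `n`-Lipschitz, so the truncated kernel
  -- estimate with `L = n` gives growth of order `n ^ (s p)` only.
  obtain ⟨K, hK, haK⟩ : ∃ K : ℝ≥0∞, K ≠ ⊤ ∧ ∀ n : ℕ, 1 ≤ n →
      a n ≤ K * ENNReal.ofReal ((n : ℝ) ^ (s * p)) := by
    obtain ⟨K, hK, h⟩ := exists_lintegral_min_le hA hball hq0 hqp
    refine ⟨K * (μHE[m] : Measure M) univ, by finiteness, fun n hn ↦ ?_⟩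
    have hn0 : (0 : ℝ) < n := by exact_mod_cast hn
    calc a n ≤ ∫⁻ x : M, K * ENNReal.ofReal ((n : ℝ) ^ (s * p)) ∂μHE[m] := by
          rw [ha]
          simp only [gagliardoEnergy_eq_kernelEnergy]
          refine lintegral_mono fun x ↦ (lintegral_mono fun y ↦ ?_).trans (h x n hn0)
          refine ENNReal.div_le_div_right ?_ _
          beta_reduce
          rw [edist_dist, dist_coe_addCircle, ENNReal.ofReal_rpow_of_nonneg (norm_nonneg _) hp0.le]
          exact ENNReal.ofReal_le_ofReal (Real.rpow_le_rpow (norm_nonneg _)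
            ((norm_coe_addCircle_le _).trans (min_le_min_right _ (hLip n x y))) hp0.le)
      _ = _ := by rw [lintegral_const]; ring
  have hat : ∀ n, 1 ≤ n → a n ≠ ⊤ := fun n hn ↦ ne_top_of_le_ne_top (by finiteness) (haK n hn)
  have ha1 : a 1 = e := by
    rw [ha, he]
    simp only [gagliardoEnergy_eq_kernelEnergy]
    congr 1
    ext x y
    rw [edist_dist, Nat.cast_one, one_mul, one_mul,
      dist_coe_addCircle_of_le_one (abs_truncatedDist_sub_le_one x₀ x y), ← edist_dist]
  have het : e ≠ ⊤ := ha1 ▸ hat 1 le_rfl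
  have he0 : e ≠ 0 := gagliardoEnergy_truncatedDist_ne_zero hm hs₀ hp0 x₀
  have hmain : ∀ n : ℕ, 1 ≤ n → ENNReal.ofReal ((n : ℝ) ^ p) * e ≤ C * (a n + a n ^ γ) := by
    intro n hn
    rw [he, ← gagliardoEnergy_const_mul s hp0 n.cast_nonneg]
    refine hC _ (memX_of_lipschitz (one_pos.trans_le one_le_injectivityRadius_addCircle)
      n.cast_nonneg (hLip n)) ⟨(hcont n).measurable.aemeasurable, (hat n hn).lt_top⟩
  set c : ℝ≥0∞ := e / 2 ^ p with hc
  have h2p : (2 : ℝ≥0∞) ^ p ≠ ⊤ := ENNReal.rpow_ne_top_of_nonneg hp0.le (by simp)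
  have h2p0 : (2 : ℝ≥0∞) ^ p ≠ 0 := by simp
  have hc0 : c ≠ 0 := ENNReal.div_ne_zero.2 ⟨he0, h2p⟩
  have hct : c ≠ ⊤ := ENNReal.div_ne_top het h2p0
  -- A lower bound on the projected energy is needed when `γ < 0`. Since `ψ = (N + 1) ψ - N ψ`, the
  -- energies of two consecutive projections cannot both be small.
  have hfreq : ∃ᶠ n in Filter.atTop, c ≤ a n := by
    rw [Filter.frequently_atTop]
    intro N
    by_contra! h
    have h1 := gagliardoEnergy_le_add (M := M) (m := m) s hp.le
      (u := fun x ↦ ((ψ x : ℝ) : AddCircle (2 * Real.pi))) (hcont N)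
      (w := fun x ↦ (((N + 1 : ℕ) * ψ x : ℝ) : AddCircle (2 * Real.pi))) fun x y ↦ by
        simp only [edist_dist]
        rw [← ENNReal.ofReal_add dist_nonneg dist_nonneg]
        refine ENNReal.ofReal_le_ofReal ?_
        simp only [dist_coe_addCircle]
        have : ψ x - ψ y = ((N + 1 : ℕ) * ψ x - (N + 1 : ℕ) * ψ y) - (N * ψ x - N * ψ y) := by
          push_cast; ring
        rw [this, AddCircle.coe_sub]
        exact (norm_sub_le _ _).trans_eq (add_comm _ _)
    have h2 : e = gagliardoEnergy m s p (fun x ↦ ((ψ x : ℝ) : AddCircle (2 * Real.pi))) := by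
      rw [← ha1, ha]; simp
    rw [← h2] at h1
    have h3 : a N + a (N + 1) < c + c := ENNReal.add_lt_add (h N le_rfl) (h _ N.le_succ)
    have h4 : (2 : ℝ≥0∞) ^ (p - 1) * (c + c) = e := by
      rw [← two_mul, ← mul_assoc]
      nth_rewrite 2 [← ENNReal.rpow_one 2]
      rw [← ENNReal.rpow_add _ _ (by simp) (by simp), sub_add_cancel, hc,
        ENNReal.mul_div_cancel h2p0 h2p]
    have h5 : (2 : ℝ≥0∞) ^ (p - 1) ≠ 0 := by simp
    have h6 : (2 : ℝ≥0∞) ^ (p - 1) ≠ ⊤ := ENNReal.rpow_ne_top_of_nonneg (by linarith) (by simp)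
    exact (h1.trans_lt ((ENNReal.mul_lt_mul_iff_right h5 h6).2 h3)).ne h4.symm
  by_contra! hγ
  -- For negative `γ` the lower bound `c` makes `a n ^ γ` bounded, which corresponds to the exponent
  -- 0.
  set θ := max γ 0 with hθ
  have hθp : s * p * θ < p := by
    have : θ < 1 / s := max_lt hγ (by positivity)
    rw [lt_div_iff₀ hs₀] at this
    nlinarith
  obtain ⟨K₂, hK₂, haγ⟩ : ∃ K₂ : ℝ≥0∞, K₂ ≠ ⊤ ∧ ∀ n : ℕ, 1 ≤ n → c ≤ a n →
      a n ^ γ ≤ K₂ * ENNReal.ofReal ((n : ℝ) ^ (s * p * θ)) := by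
    rcases le_or_gt 0 γ with h | h
    · refine ⟨K ^ γ, ENNReal.rpow_ne_top_of_nonneg h hK, fun n hn _ ↦ ?_⟩
      rw [hθ, max_eq_left h, Real.rpow_mul n.cast_nonneg, ← ENNReal.ofReal_rpow_of_nonneg
        (by positivity) h, ← ENNReal.mul_rpow_of_nonneg _ _ h]
      exact ENNReal.rpow_le_rpow (haK n hn) h
    · refine ⟨c ^ γ, by simp [hc0, hct], fun n hn hn' ↦ ?_⟩
      rw [hθ, max_eq_right h.le, mul_zero, Real.rpow_zero, ENNReal.ofReal_one, mul_one]
      rw [← neg_neg γ, ENNReal.rpow_neg, ENNReal.rpow_neg c]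
      exact ENNReal.inv_le_inv.2 (ENNReal.rpow_le_rpow hn' (by linarith))
  -- Dividing the inequality by `n ^ p` leaves negative powers of `n` on the right, while the left
  -- side remains the positive number `e`.
  have hlim : Filter.Tendsto (fun n : ℕ ↦ C * (K.toReal * (n : ℝ) ^ (-(p - s * p))
      + K₂.toReal * (n : ℝ) ^ (-(p - s * p * θ)))) Filter.atTop (nhds 0) := by
    have h1 := (tendsto_rpow_neg_atTop (sub_pos.2 hqp)).comp
      (tendsto_natCast_atTop_atTop (R := ℝ))
    have h2 := (tendsto_rpow_neg_atTop (sub_pos.2 hθp)).comp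
      (tendsto_natCast_atTop_atTop (R := ℝ))
    simpa using ((h1.const_mul K.toReal).add (h2.const_mul K₂.toReal)).const_mul (C : ℝ)
  refine (ENNReal.toReal_pos he0 het).not_ge (ge_of_tendsto_of_frequently hlim
    ((hfreq.and_eventually (Filter.eventually_ge_atTop 1)).mono fun n ⟨hn, hn1⟩ ↦ ?_))
  have hn0 : (0 : ℝ) < n := by exact_mod_cast hn1
  have h1 := (hmain n hn1).trans (mul_le_mul_right (add_le_add (haK n hn1) (haγ n hn1 hn)) _)
  have h2 := ENNReal.toReal_mono (by finiteness) h1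
  rw [ENNReal.toReal_mul, ENNReal.toReal_mul, ENNReal.toReal_add (by finiteness) (by finiteness),
    ENNReal.toReal_mul, ENNReal.toReal_mul, ENNReal.toReal_ofReal (by positivity),
    ENNReal.toReal_ofReal (by positivity), ENNReal.toReal_ofReal (by positivity),
    ENNReal.coe_toReal] at h2
  have h3 : (0 : ℝ) < (n : ℝ) ^ p := by positivity
  rw [← mul_le_mul_iff_right₀ h3]
  refine h2.trans_eq ?_
  have h4 : (n : ℝ) ^ p * (n : ℝ) ^ (-(p - s * p)) = (n : ℝ) ^ (s * p) := by
    rw [← Real.rpow_add hn0]; congr 1; ring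
  have h5 : (n : ℝ) ^ p * (n : ℝ) ^ (-(p - s * p * θ)) = (n : ℝ) ^ (s * p * θ) := by
    rw [← Real.rpow_add hn0]; congr 1; ring
  rw [← h4, ← h5]
  ring

end Optimality

end FractionalLifting

namespace FractionalLifting

/-! ### Almost minimizing curves -/

section Paths

variable {n : ℕ} {X : Type*} [MetricSpace X]
  [ChartedSpace (EuclideanSpace ℝ (Fin n)) X] [IsManifold (𝓡 n) ∞ X]
  [RiemannianBundle (fun x : X ↦ TangentSpace (𝓡 n) x)]
  [IsContMDiffRiemannianBundle (𝓡 n) ∞ (EuclideanSpace ℝ (Fin n))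
    (fun x : X ↦ TangentSpace (𝓡 n) x)]
  [IsRiemannianManifold (𝓡 n) X]

variable (n) in
lemma exists_pathELength_lt {a b : X} {r : ℝ≥0∞} (h : edist a b < r) :
    ∃ γ : ℝ → X, γ 0 = a ∧ γ 1 = b ∧ ContMDiff 𝓘(ℝ, ℝ) (𝓡 n) 1 γ ∧
      Manifold.pathELength (𝓡 n) γ 0 1 < r := by
  rw [IsRiemannianManifold.out (I := 𝓡 n)] at h
  have := isContinuousRiemannianBundle_tangentSpace (m := n) (M := X)
  obtain ⟨γ, h0, h1, h2, h3, -, -⟩ :=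
    Manifold.exists_lt_locally_constant_of_riemannianEDist_lt h zero_lt_one
  exact ⟨γ, h0, h1, h2, h3⟩

lemma edist_le_pathELength {γ : ℝ → X} (hγ : ContMDiff 𝓘(ℝ, ℝ) (𝓡 n) 1 γ) {a b : ℝ}
    (hab : a ≤ b) : edist (γ a) (γ b) ≤ Manifold.pathELength (𝓡 n) γ a b := by
  rw [IsRiemannianManifold.out (I := 𝓡 n)]
  exact Manifold.riemannianEDist_le_pathELength hγ.contMDiffOn rfl rfl hab

/-- Two points of a Riemannian manifold are joined by curves which are almost parametrized by arc
length and almost minimizing. -/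
lemma exists_almost_isometric_curve (n : ℕ) {X : Type*} [MetricSpace X]
    [ChartedSpace (EuclideanSpace ℝ (Fin n)) X] [IsManifold (𝓡 n) ∞ X]
    [RiemannianBundle (fun x : X ↦ TangentSpace (𝓡 n) x)]
    [IsContMDiffRiemannianBundle (𝓡 n) ∞ (EuclideanSpace ℝ (Fin n))
      (fun x : X ↦ TangentSpace (𝓡 n) x)]
    [IsRiemannianManifold (𝓡 n) X] (a b : X) {ε : ℝ} (hε : 0 < ε) :
    ∃ c : ℝ → X, c 0 = a ∧ c (dist a b) = b ∧ ∀ s ∈ Icc 0 (dist a b), ∀ t ∈ Icc 0 (dist a b),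
      |s - t| ≤ dist (c s) (c t) ∧ dist (c s) (c t) ≤ |s - t| + ε := by
  set ℓ := dist a b with hℓ
  have hr : edist a b < ENNReal.ofReal (ℓ + ε) := by
    rw [edist_dist]
    exact (ENNReal.ofReal_lt_ofReal_iff (by positivity)).2 (by linarith)
  obtain ⟨γ, h0, h1, hγ, hlen⟩ := exists_pathELength_lt n hr
  have hsplit : ∀ u ∈ Icc (0 : ℝ) 1, ∀ v ∈ Icc (0 : ℝ) 1, u ≤ v →
      dist a (γ u) + dist (γ u) (γ v) + dist (γ v) b ≤ ℓ + ε := by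
    intro u hu v hv huv
    have h2 : edist (γ 0) (γ u) + edist (γ u) (γ v) + edist (γ v) (γ 1)
        ≤ ENNReal.ofReal (ℓ + ε) := by
      refine le_trans ?_ hlen.le
      rw [← Manifold.pathELength_add hv.1 hv.2, ← Manifold.pathELength_add hu.1 huv]
      exact add_le_add (add_le_add (edist_le_pathELength hγ hu.1) (edist_le_pathELength hγ huv))
        (edist_le_pathELength hγ hv.2)
    rwa [edist_dist, edist_dist, edist_dist, ← ENNReal.ofReal_add (by positivity) (by positivity),
      ← ENNReal.ofReal_add (by positivity) (by positivity),
      ENNReal.ofReal_le_ofReal_iff (by positivity), h0, h1] at h2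
  have hivt : ∀ s ∈ Icc 0 ℓ, ∃ u ∈ Icc (0 : ℝ) 1, dist a (γ u) = s := by
    intro s hs
    have := intermediate_value_Icc (zero_le_one' ℝ)
      (f := fun u ↦ dist a (γ u)) (continuous_const.dist hγ.continuous).continuousOn
    rw [h0, h1, dist_self] at this
    exact this hs
  -- `c s` is some point of the curve at distance `s` from `a`, with prescribed endpoints;
  -- continuity of `c` is not needed. A path of length less than `ℓ + ε` leaves only a defect `ε` in
  -- the triangle inequalities along it.
  have hA : ∀ s ∈ Icc 0 ℓ, ∃ x : X, (∃ u ∈ Icc (0 : ℝ) 1, γ u = x) ∧ dist a x = s ∧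
      (s = 0 → x = a) ∧ (s = ℓ → x = b) := by
    intro s hs
    by_cases hsl : s = ℓ
    · exact ⟨b, ⟨1, by simp, h1⟩, by rw [hsl],
        fun h ↦ (dist_eq_zero.1 (by rw [← hℓ, ← hsl, h])).symm, fun _ ↦ rfl⟩
    · obtain ⟨u, hu, hus⟩ := hivt s hs
      exact ⟨γ u, ⟨u, hu, rfl⟩, hus, fun h ↦ (dist_eq_zero.1 (hus.trans h)).symm,
        fun h ↦ absurd h hsl⟩
  have : Nonempty X := ⟨a⟩
  choose! c hcu hcs hc0 hcl using hA
  have hℓ0 : 0 ≤ ℓ := dist_nonneg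
  refine ⟨c, hc0 0 ⟨le_rfl, hℓ0⟩ rfl, hcl ℓ ⟨hℓ0, le_rfl⟩ rfl, fun s hs t ht ↦ ⟨?_, ?_⟩⟩
  · have := abs_dist_sub_le (c s) (c t) a
    rwa [dist_comm _ a, dist_comm _ a, hcs s hs, hcs t ht] at this
  · obtain ⟨u, hu, hus⟩ := hcu s hs
    obtain ⟨v, hv, hvt⟩ := hcu t ht
    have key : ∀ x y : X, dist a x + dist x y + dist y b ≤ ℓ + ε →
        dist x y ≤ |dist a x - dist a y| + ε := by
      intro x y h
      have h1 := dist_triangle a y b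
      rw [← hℓ] at h1
      linarith [neg_abs_le (dist a x - dist a y)]
    rcases le_total u v with huv | huv
    · have := key (c s) (c t) (by rw [← hus, ← hvt]; exact hsplit u hu v hv huv)
      rwa [hcs s hs, hcs t ht] at this
    · rw [dist_comm (c s), abs_sub_comm]
      have := key (c t) (c s) (by rw [← hus, ← hvt]; exact hsplit v hv u hu huv)
      rwa [hcs s hs, hcs t ht] at this

end Paths

/-! ### Riemannian coverings are isometric below the injectivity radius -/

section Covering

variable {n : ℕ} {N : Type*} [MetricSpace N]
  [ChartedSpace (EuclideanSpace ℝ (Fin n)) N] [IsManifold (𝓡 n) ∞ N]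
  [RiemannianBundle (fun x : N ↦ TangentSpace (𝓡 n) x)]
  [IsContMDiffRiemannianBundle (𝓡 n) ∞ (EuclideanSpace ℝ (Fin n))
    (fun x : N ↦ TangentSpace (𝓡 n) x)]
  [IsRiemannianManifold (𝓡 n) N]
  {N' : Type*} [MetricSpace N']
  [ChartedSpace (EuclideanSpace ℝ (Fin n)) N'] [IsManifold (𝓡 n) ∞ N']
  [RiemannianBundle (fun x : N' ↦ TangentSpace (𝓡 n) x)]
  [IsContMDiffRiemannianBundle (𝓡 n) ∞ (EuclideanSpace ℝ (Fin n))
    (fun x : N' ↦ TangentSpace (𝓡 n) x)]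
  [IsRiemannianManifold (𝓡 n) N']
  {pr : N' → N}

lemma IsRiemannianCovering.pathELength_comp (hpr : IsRiemannianCovering (n := n) pr) {γ : ℝ → N'}
    (hγ : ContMDiff 𝓘(ℝ, ℝ) (𝓡 n) 1 γ) (a b : ℝ) :
    Manifold.pathELength (𝓡 n) (pr ∘ γ) a b = Manifold.pathELength (𝓡 n) γ a b := by
  rw [Manifold.pathELength_eq_lintegral_mfderiv_Icc, Manifold.pathELength_eq_lintegral_mfderiv_Icc]
  refine lintegral_congr fun t ↦ ?_
  have h1 : MDifferentiableAt (𝓡 n) (𝓡 n) pr (γ t) :=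
    (hpr.isLocalDiffeomorph (γ t)).mdifferentiableAt (by simp)
  rw [mfderiv_comp t h1 ((hγ.mdifferentiable (by simp)) t)]
  set v := mfderiv 𝓘(ℝ, ℝ) (𝓡 n) γ t 1 with hv
  change ‖mfderiv (𝓡 n) (𝓡 n) pr (γ t) v‖ₑ = ‖v‖ₑ
  rw [← ofReal_norm, ← ofReal_norm, norm_eq_sqrt_real_inner, norm_eq_sqrt_real_inner,
    hpr.inner_mfderiv]

lemma IsRiemannianCovering.contMDiff (hpr : IsRiemannianCovering (n := n) pr) :
    ContMDiff (𝓡 n) (𝓡 n) 1 pr :=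
  (hpr.isLocalDiffeomorph.contMDiff).of_le (by exact_mod_cast le_top)

lemma IsRiemannianCovering.edist_le (hpr : IsRiemannianCovering (n := n) pr) (a b : N') :
    edist (pr a) (pr b) ≤ edist a b := by
  refine le_of_forall_gt fun r hr ↦ ?_
  obtain ⟨γ, rfl, rfl, hγ, hlen⟩ := exists_pathELength_lt n hr
  refine lt_of_le_of_lt ?_ hlen
  rw [← hpr.pathELength_comp hγ]
  exact edist_le_pathELength (hpr.contMDiff.comp hγ) zero_le_one

lemma contMDiff_of_comp_isLocalDiffeomorph (hpr : IsLocalDiffeomorph (𝓡 n) (𝓡 n) ∞ pr)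
    {γ : ℝ → N'} (hγ : Continuous γ) (h : ContMDiff 𝓘(ℝ, ℝ) (𝓡 n) 1 (pr ∘ γ)) :
    ContMDiff 𝓘(ℝ, ℝ) (𝓡 n) 1 γ := by
  intro t
  have h1 := (hpr (γ t)).localInverse_contMDiffAt.of_le 
    (show (1 : ℕ∞ω) ≤ (∞ : ℕ∞ω) by exact_mod_cast le_top)
  have h2 : ContMDiffAt 𝓘(ℝ, ℝ) (𝓡 n) 1 ((hpr (γ t)).localInverse ∘ (pr ∘ γ)) t :=
    ContMDiffAt.comp t h1 (h t)
  refine h2.congr_of_eventuallyEq ?_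
  exact ((hpr (γ t)).localInverse_eventuallyEq_left.comp_tendsto hγ.continuousAt).symm

/-- The lift of an almost minimizing curve has the same length. -/
lemma IsRiemannianCovering.exists_edist_lt (hpr : IsRiemannianCovering (n := n) pr) (a : N')
    {y : N} {r : ℝ≥0∞} (h : edist (pr a) y < r) : ∃ b, pr b = y ∧ edist a b < r := by
  obtain ⟨γ, h0, h1, hγ, hlen⟩ := exists_pathELength_lt n h
  obtain ⟨Γ, ⟨hΓ0, hΓ⟩, -⟩ := hpr.isCoveringMap.existsUnique_continuousMap_lifts
    ⟨γ, hγ.continuous⟩ 0 a h0.symm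
  have hΓ' : pr ∘ Γ = γ := hΓ
  have hs : ContMDiff 𝓘(ℝ, ℝ) (𝓡 n) 1 Γ :=
    contMDiff_of_comp_isLocalDiffeomorph hpr.isLocalDiffeomorph Γ.continuous (by rw [hΓ']; exact hγ)
  refine ⟨Γ 1, (congrFun hΓ' 1).trans h1, ?_⟩
  rw [← hΓ0]
  refine (edist_le_pathELength hs zero_le_one).trans_lt ?_
  rwa [← hpr.pathELength_comp hs, hΓ']

/-- `δ` is a Lebesgue number of the cover of `N` by evenly covered open sets. A curve of length less
than `δ` projects into one of them, so its sheet is constant, and two of its points with the same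
projection coincide. -/
lemma IsRiemannianCovering.exists_le_edist_of_ne [CompactSpace N]
    (hpr : IsRiemannianCovering (n := n) pr) :
    ∃ δ : ℝ≥0, 0 < δ ∧ ∀ a b, pr a = pr b → edist a b < δ → a = b := by
  choose hI U hyU hU hpU H hH using hpr.isCoveringMap
  obtain ⟨δ, hδ, hcov⟩ := lebesgue_number_lemma_of_metric (isCompact_univ (X := N)) hU
    (fun y _ ↦ mem_iUnion.2 ⟨y, hyU y⟩)
  refine ⟨δ.toNNReal, by simpa using hδ, fun a b hab hlt ↦ ?_⟩
  obtain ⟨γ, h0, h1, hγ, hlen⟩ := exists_pathELength_lt n hlt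
  obtain ⟨y, hy⟩ := hcov (pr a) trivial
  have hmem : ∀ t ∈ Icc (0 : ℝ) 1, pr (γ t) ∈ U y := by
    intro t ht
    refine hy ?_
    rw [Metric.mem_ball, dist_comm, ← ENNReal.ofReal_lt_ofReal_iff hδ, ← edist_dist]
    calc edist (pr a) (pr (γ t)) ≤ edist (γ 0) (γ t) := by rw [h0]; exact hpr.edist_le _ _
      _ ≤ Manifold.pathELength (𝓡 n) γ 0 t := edist_le_pathELength hγ ht.1
      _ ≤ Manifold.pathELength (𝓡 n) γ 0 1 := Manifold.pathELength_mono le_rfl ht.2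
      _ < _ := hlen
  have := hI y
  have hcont : Continuous fun t : Icc (0 : ℝ) 1 ↦
      (H y ⟨γ t, hmem t t.2⟩ : U y × (pr ⁻¹' {y})).2 :=
    continuous_snd.comp ((H y).continuous.comp
      ((hγ.continuous.comp continuous_subtype_val).subtype_mk _))
  have hpre : PreconnectedSpace (Icc (0 : ℝ) 1) :=
    isPreconnected_iff_preconnectedSpace.1 isPreconnected_Icc
  have h2 := PreconnectedSpace.constant hpre hcont (x := ⟨0, by simp⟩) (y := ⟨1, by simp⟩)
  have h3 : H y ⟨γ 0, hmem 0 (by simp)⟩ = H y ⟨γ 1, hmem 1 (by simp)⟩ := by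
    refine Prod.ext (Subtype.ext ?_) h2
    rw [hH, hH]
    simp only [h0, h1, hab]
  have h4 := congrArg Subtype.val ((H y).injective h3)
  rw [← h0, ← h1]
  exact h4

/-- A Riemannian covering of a compact manifold is isometric at small scales, uniformly. -/
lemma IsRiemannianCovering.exists_edist_eq [CompactSpace N]
    (hpr : IsRiemannianCovering (n := n) pr) :
    ∃ δ : ℝ≥0, 0 < δ ∧ ∀ a b, edist a b < δ → edist (pr a) (pr b) = edist a b := by
  obtain ⟨δ, hδ, h⟩ := hpr.exists_le_edist_of_ne
  refine ⟨δ / 2, by positivity, fun a b hab ↦ (hpr.edist_le a b).antisymm ?_⟩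
  -- If `pr` shortened the distance, lifting a short curve would produce a point of the fiber of `pr
  -- b` closer to `a` than `b`, yet within `δ` of `b`, hence equal to `b`.
  by_contra! hlt
  obtain ⟨b', hb', hab'⟩ := hpr.exists_edist_lt a hlt
  have : b' = b := by
    refine h _ _ hb' ?_
    calc edist b' b ≤ edist a b' + edist a b := edist_triangle_left _ _ _
      _ < ((δ / 2 : ℝ≥0) : ℝ≥0∞) + ((δ / 2 : ℝ≥0) : ℝ≥0∞) :=
        ENNReal.add_lt_add (hab'.trans hab) hab
      _ = δ := by rw [← ENNReal.coe_add, add_halves]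
  exact absurd hab' (by rw [this]; exact lt_irrefl _)

/-- A Riemannian covering of a compact manifold is isometric below the injectivity radius. -/
lemma IsRiemannianCovering.edist_eq_of_lt_injectivityRadius [CompactSpace N]
    (hpr : IsRiemannianCovering (n := n) pr) {a b : N'} (hab : edist a b < injectivityRadius N) :
    edist (pr a) (pr b) = edist a b := by
  obtain ⟨δ, hδ, hiso⟩ := hpr.exists_edist_eq
  have hiso' : ∀ x y, dist x y < δ → dist (pr x) (pr y) = dist x y := fun x y hxy ↦ by
    have := hiso x y (by rw [edist_dist, ← ENNReal.ofReal_coe_nnreal]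
                         exact (ENNReal.ofReal_lt_ofReal_iff (by exact_mod_cast hδ)).2 hxy)
    rw [dist_edist, dist_edist, this]
  set ℓ := dist a b with hℓ
  -- Rather than a minimizing geodesic in the covering space, a limit of projected almost isometric
  -- curves is taken along an ultrafilter, using the compactness of the base only.
  choose c hc0 hcl hc using fun k : ℕ ↦
    exists_almost_isometric_curve n a b (ε := 1 / ((k : ℝ) + 1)) (by positivity)
  set 𝒰 : Ultrafilter ℕ := Filter.hyperfilter ℕ with h𝒰
  have hlim : ∀ t, ∃ x, Filter.Tendsto (fun k ↦ pr (c k t)) 𝒰 (nhds x) := fun t ↦ by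
    obtain ⟨x, -, hx⟩ := (isCompact_univ (X := N)).ultrafilter_le_nhds
      (𝒰.map fun k ↦ pr (c k t)) (by simp)
    exact ⟨x, hx⟩
  choose e he using hlim
  have heps : Filter.Tendsto (fun k : ℕ ↦ 1 / ((k : ℝ) + 1)) 𝒰 (nhds 0) :=
    tendsto_one_div_add_atTop_nhds_zero_nat.mono_left
      (by rw [← Nat.cofinite_eq_atTop]; exact Filter.hyperfilter_le_cofinite)
  -- At scales below `δ` the projection preserves distances, so the limit curve realizes distances
  -- locally; its length `ℓ` is below the injectivity radius, and it is therefore minimizing from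
  -- `pr a` to `pr b`.
  have hgeo : IsUnitSpeedGeodesic e ℓ := by
    intro t _
    refine ⟨δ / 4, by positivity, fun t₁ h₁ t₂ h₂ ht₁ ht₂ ↦ ?_⟩
    have hδ' : (0 : ℝ) < δ := by exact_mod_cast hδ
    have h12 : |t₁ - t₂| < δ / 2 := by
      have := abs_sub_le t₁ t t₂
      rw [abs_sub_comm t t₂] at this
      linarith
    have h3 : Filter.Tendsto (fun k ↦ dist (c k t₁) (c k t₂)) 𝒰 (nhds |t₁ - t₂|) := by
      refine tendsto_of_tendsto_of_tendsto_of_le_of_le tendsto_const_nhds ?_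
        (fun k ↦ (hc k t₁ h₁ t₂ h₂).1) (fun k ↦ (hc k t₁ h₁ t₂ h₂).2)
      simpa using heps.const_add |t₁ - t₂|
    have h4 : ∀ᶠ k in (𝒰 : Filter ℕ),
        dist (c k t₁) (c k t₂) = dist (pr (c k t₁)) (pr (c k t₂)) := by
      filter_upwards [h3.eventually (gt_mem_nhds (show |t₁ - t₂| < (δ : ℝ) by linarith))] with k hk
      exact (hiso' _ _ hk).symm
    exact tendsto_nhds_unique ((he t₁).dist (he t₂)) (h3.congr' h4)
  have he0 : e 0 = pr a := tendsto_nhds_unique (he 0) (by simp [hc0])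
  have hel : e ℓ = pr b := tendsto_nhds_unique (he ℓ) (by simp [hcl, hℓ])
  unfold injectivityRadius at hab
  obtain ⟨r, hr⟩ := lt_iSup_iff.1 hab
  obtain ⟨hr1, hr2⟩ := lt_iSup_iff.1 hr
  have hle : ℓ ≤ r := by
    rw [edist_dist, ← ENNReal.ofReal_coe_nnreal] at hr2
    exact (ENNReal.lt_ofReal_iff_toReal_lt ENNReal.ofReal_ne_top).1 hr2 |>.le.trans' (by simp [hℓ])
  have := hr1 ℓ e dist_nonneg hle hgeo
  rw [he0, hel] at this
  rw [edist_dist, edist_dist, this]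

end Covering

end FractionalLifting

/-! ### The theorem -/

open FractionalLifting in
theorem theorem1p8 {m : ℕ} {M : Type*} [MetricSpace M] [CompactSpace M] [ConnectedSpace M]
    [MeasurableSpace M] [BorelSpace M]
    [ChartedSpace (EuclideanSpace ℝ (Fin m)) M] [IsManifold (𝓡 m) ∞ M]
    [RiemannianBundle (fun x : M ↦ TangentSpace (𝓡 m) x)]
    [IsContMDiffRiemannianBundle (𝓡 m) ∞ (EuclideanSpace ℝ (Fin m))
      (fun x : M ↦ TangentSpace (𝓡 m) x)]
    [IsRiemannianManifold (𝓡 m) M]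
    (s p : ℝ) (hs₀ : 0 < s) (hs₁ : s < 1) (hp : 1 < p)
    (hspm : (m : ℝ) ≤ s * p) (hsp : 1 < s * p) :
    -- membership of the lifting and the estimate, for every Riemannian covering of a compact `N`
    (∀ {n : ℕ} {N : Type*} [MetricSpace N] [CompactSpace N] [ConnectedSpace N]
      [MeasurableSpace N] [BorelSpace N]
      [ChartedSpace (EuclideanSpace ℝ (Fin n)) N] [IsManifold (𝓡 n) ∞ N]
      [RiemannianBundle (fun x : N ↦ TangentSpace (𝓡 n) x)]
      [IsContMDiffRiemannianBundle (𝓡 n) ∞ (EuclideanSpace ℝ (Fin n))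
        (fun x : N ↦ TangentSpace (𝓡 n) x)]
      [IsRiemannianManifold (𝓡 n) N]
      {N' : Type*} [MetricSpace N'] [ConnectedSpace N'] [SecondCountableTopology N']
      [MeasurableSpace N'] [BorelSpace N']
      [ChartedSpace (EuclideanSpace ℝ (Fin n)) N'] [IsManifold (𝓡 n) ∞ N']
      [RiemannianBundle (fun x : N' ↦ TangentSpace (𝓡 n) x)]
      [IsContMDiffRiemannianBundle (𝓡 n) ∞ (EuclideanSpace ℝ (Fin n))
        (fun x : N' ↦ TangentSpace (𝓡 n) x)]
      [IsRiemannianManifold (𝓡 n) N']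
      (pr : N' → N), IsRiemannianCovering (n := n) pr →
      ∃ C : ℝ≥0, 0 < C ∧ ∀ w : M → N', MemX N m w → MemFractionalSobolev m s p (pr ∘ w) →
        MemFractionalSobolev m s p w ∧
        gagliardoEnergy m s p w ≤
          C * (gagliardoEnergy m s p (pr ∘ w) + gagliardoEnergy m s p (pr ∘ w) ^ (1 / s))) ∧
    -- optimality of the exponent, for the universal covering `ℝ → ℝ / 2πℤ` of the unit circle
    (1 ≤ m → ∀ γ : ℝ,
      (∃ C : ℝ≥0, ∀ w : M → ℝ, MemX (AddCircle (2 * Real.pi)) m w →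
        MemFractionalSobolev m s p (fun x ↦ (w x : AddCircle (2 * Real.pi))) →
        gagliardoEnergy m s p w ≤
          C * (gagliardoEnergy m s p (fun x ↦ (w x : AddCircle (2 * Real.pi))) +
            gagliardoEnergy m s p (fun x ↦ (w x : AddCircle (2 * Real.pi))) ^ γ)) →
      1 / s ≤ γ) := by
  refine ⟨?_, fun hm γ ⟨C, hC⟩ ↦ one_div_le_of_gagliardoEnergy_le hm hs₀ hs₁ hp hC⟩
  intro n N _ _ _ _ _ _ _ _ _ _ N' _ _ _ _ _ _ _ _ _ _ pr hpr
  obtain ⟨δ₀, hδ₀, hiso⟩ := hpr.exists_edist_eq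
  have hinj : ∀ a b, edist a b < injectivityRadius N → edist (pr a) (pr b) = edist a b :=
    fun a b ↦ hpr.edist_eq_of_lt_injectivityRadius
  -- With an infinite injectivity radius `pr` preserves all distances, and the two energies
  -- coincide.
  rcases eq_or_ne (injectivityRadius N) ⊤ with htop | htop
  · refine ⟨1, one_pos, fun w hw hu ↦ ?_⟩
    have heq : gagliardoEnergy m s p w = gagliardoEnergy m s p (pr ∘ w) := by
      simp only [gagliardoEnergy, Function.comp_apply]
      simp_rw [hinj _ _ (htop ▸ edist_lt_top _ _)]
    exact ⟨⟨hw.1, heq ▸ hu.2⟩, by rw [heq, ENNReal.coe_one, one_mul]; exact le_self_add⟩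
  -- Taking the maximum puts the threshold `inj(N) / 2` of `X` within the scale of isometry, while
  -- `δ₀` ensures positivity without any lower bound on the injectivity radius.
  · have hlt : ∀ a b, edist a b < (max δ₀ (injectivityRadius N / 2).toNNReal : ℝ≥0) →
        edist (pr a) (pr b) = edist a b := by
      intro a b hab
      rw [ENNReal.coe_max, ENNReal.coe_toNNReal (ENNReal.div_ne_top htop two_ne_zero)] at hab
      rcases lt_max_iff.1 hab with h | h
      · exact hiso a b h
      · exact hinj a b (h.trans_le ENNReal.half_le_self)
    obtain ⟨C, hC, h⟩ := exists_gagliardoEnergy_le (M := M) hs₀ hs₁ hp hspm hsp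
      (lt_max_of_lt_left hδ₀) hlt (κ := injectivityRadius N / 2) (by
        rw [ENNReal.coe_max, ENNReal.coe_toNNReal (ENNReal.div_ne_top htop two_ne_zero)]
        exact le_max_right _ _)
    refine ⟨C, hC, fun w hw hu ↦ ?_⟩
    have hE := h w hw.1 hw.2
    refine ⟨⟨hw.1, hE.trans_lt ?_⟩, hE⟩
    have := hu.2.ne
    have : gagliardoEnergy m s p (pr ∘ w) ^ (1 / s) ≠ ⊤ :=
      ENNReal.rpow_ne_top_of_nonneg (by positivity) hu.2.ne
    finiteness
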